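/- Let $Y$ be a smooth integral variety over $\mathbb{C}$, let $F$ and $E$ be vector bundles on $Y$ of ranks $n$ and $2n$, let $\langle\,,\,\rangle$ be an everywhere nondegenerate skew-symmetric $2$-form on $E$ with values in $\mathcal{O}_Y$, and let $\phi:F\to E$ be a Lagrangian morphism: a morphism of $\mathcal{O}_Y$-modules whose generic rank is $n$ and such that for every $y\in Y$ the image of $\phi_y:F_y\to E_y$ is isotropic for $\langle\,,\,\rangle$. Let $Y_{\le k}$, resp. $Y_k$, be the locus of points where $\phi$ has rank $\le k$, resp. exactly $k$; the locus $Y_{n-1}$ is closed in the open set $U=Y\setminus Y_{\le n-2}$ and is endowed with the scheme structure defined by the $n\times n$ minors of $\phi$. Let $\phi^*:E\to F^*$ be the transpose of $\phi$ with respect to the self-duality of $E$, $\phi^*(e)(f)=\langle e,\phi(f)\rangle$. Assume that $Y_{\le n-1}$ has codimension at least $2$ in $Y$. Then: (i) $Y_{n-1}$ is a local complete intersection of codimension $2$ in $U$ (or is empty): its ideal sheaf is locally generated by a regular sequence of length $2$, and every irreducible component of $Y_{n-1}$ has codimension $2$ in $Y$. (ii) There is an exact sequence of $\mathcal{O}_Y$-modules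 $$0\to F\xrightarrow{\ \phi\ }E\xrightarrow{\ \phi^*\ }F^*\to\mathcal{G}\to 0,$$ where $\mathcal{G}$ is a torsion sheaf supported on $Y_{\le n-1}$, and $\mathcal{G}_{|U}$ is a line bundle on $Y_{n-1}$, i.e. the direct image on $U$ of a line bundle on the scheme $Y_{n-1}$, again denoted by $\mathcal{G}$. (iii) There is a vector bundle $\mathcal{E}_2$ of rank $2$ on $Y_{n-1}$ with trivial determinant such that the normal bundle of $Y_{n-1}$ in $Y$ is isomorphic to $\mathcal{H}om(\mathcal{E}_2,\mathcal{G})$. -/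

import Mathlib

open CategoryTheory AlgebraicGeometry TopologicalSpace Opposite

noncomputable section

namespace LagrangianMorphism

universe u

section HomSheaf

variable {X : Scheme.{u}}

/-- Restriction of sections of an `𝒪_X`-module. -/
def res (M : X.Modules) {U V : X.Opens} (h : V ≤ U) : Γ(M, U) →+ Γ(M, V) :=
  (M.presheaf.map (homOfLE h).op).hom

/-- Restriction of functions. -/
def resO (X : Scheme.{u}) {U V : X.Opens} (h : V ≤ U) : Γ(X, U) →+* Γ(X, V) :=
  (X.presheaf.map (homOfLE h).op).hom

lemma res_smul (M : X.Modules) {U V : X.Opens} (h : V ≤ U) (r : Γ(X, U)) (m : Γ(M, U)) :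
    res M h (r • m) = resO X h r • res M h m :=
  M.map_smul (homOfLE h) r m

lemma res_self (M : X.Modules) {U : X.Opens} (m : Γ(M, U)) : res M le_rfl m = m := by
  change M.presheaf.map (𝟙 _) m = m
  simp

lemma res_res (M : X.Modules) {U V W : X.Opens} (h : V ≤ U) (h' : W ≤ V) (m : Γ(M, U)) :
    res M h' (res M h m) = res M (h'.trans h) m := by
  change (M.presheaf.map (homOfLE h).op ≫ M.presheaf.map (homOfLE h').op) m = _
  rw [← Functor.map_comp]
  rfl

lemma resO_resO {U V W : X.Opens} (h : V ≤ U) (h' : W ≤ V) (m : Γ(X, U)) :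
    resO X h' (resO X h m) = resO X (h'.trans h) m := by
  change (X.presheaf.map (homOfLE h).op ≫ X.presheaf.map (homOfLE h').op) m = _
  rw [← Functor.map_comp]
  rfl

lemma app_res {M N : X.Modules} (φ : M ⟶ N) {U V : X.Opens} (h : V ≤ U) (m : Γ(M, U)) :
    φ.app V (res M h m) = res N h (φ.app U m) :=
  CategoryTheory.congr_fun (φ.mapPresheaf.naturality (homOfLE h).op) m

/-- The linear map on sections over `U` induced by a morphism of `𝒪_X`-modules. -/
def appLinear {M N : X.Modules} (φ : M ⟶ N) (U : X.Opens) : Γ(M, U) →ₗ[Γ(X, U)] Γ(N, U) where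
  toFun := φ.app U
  map_add' := map_add _
  map_smul' := φ.app_smul

/-- The sections over `U` of the sheaf `ℋom(M, N)`, i.e. the homomorphisms `M|_U ⟶ N|_U` of
`𝒪_U`-modules: families of `Γ(X, V)`-linear maps `Γ(M, V) → Γ(N, V)`, one for each open `V ≤ U`,
that commute with restriction. -/
def homSections (M N : X.Modules) (U : X.Opens) :
    AddSubgroup (∀ V : {V : X.Opens // V ≤ U}, Γ(M, V.1) →ₗ[Γ(X, V.1)] Γ(N, V.1)) where
  carrier := {f | ∀ (V W : {V : X.Opens // V ≤ U}) (h : W.1 ≤ V.1) (m : Γ(M, V.1)),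
    f W (res M h m) = res N h (f V m)}
  add_mem' {f g} hf hg V W h m := by simp [hf V W h m, hg V W h m]
  zero_mem' V W h m := by simp
  neg_mem' {f} hf V W h m := by simp [hf V W h m]

instance (M N : X.Modules) (U : X.Opens) : Module Γ(X, U) (homSections M N U) where
  smul r f := ⟨fun V ↦ resO X V.2 r • f.1 V, fun V W h m ↦ by
    simp [f.2 V W h m, res_smul, resO_resO]⟩
  one_smul f := by ext V m; change resO X V.2 1 • f.1 V m = _; simp
  mul_smul r s f := by
    ext V m; change resO X V.2 (r * s) • f.1 V m = resO X V.2 r • resO X V.2 s • f.1 V m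
    simp [mul_smul]
  smul_zero r := by ext V m; change resO X V.2 r • (0 : Γ(N, V.1)) = 0; simp
  smul_add r f g := by
    ext V m; change resO X V.2 r • (f.1 V m + g.1 V m) = resO X V.2 r • f.1 V m + resO X V.2 r • g.1 V m
    simp
  add_smul r s f := by
    ext V m; change resO X V.2 (r + s) • f.1 V m = resO X V.2 r • f.1 V m + resO X V.2 s • f.1 V m
    simp [add_smul]
  zero_smul f := by ext V m; change resO X V.2 0 • f.1 V m = 0; simp

lemma homSections_smul_apply {M N : X.Modules} {U : X.Opens} (r : Γ(X, U))
    (f : homSections M N U) (V : {V : X.Opens // V ≤ U}) :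
    (r • f).1 V = resO X V.2 r • f.1 V := rfl

/-- Restriction of homomorphisms to a smaller open set. -/
def homRes (M N : X.Modules) {U U' : X.Opens} (h : U' ≤ U) :
    homSections M N U →+ homSections M N U' where
  toFun f := ⟨fun V ↦ f.1 ⟨V.1, V.2.trans h⟩, fun V W hWV m ↦
    f.2 ⟨V.1, V.2.trans h⟩ ⟨W.1, W.2.trans h⟩ hWV m⟩
  map_zero' := rfl
  map_add' _ _ := rfl

lemma homRes_smul (M N : X.Modules) {U U' : X.Opens} (h : U' ≤ U) (r : Γ(X, U))
    (f : homSections M N U) : homRes M N h (r • f) = resO X h r • homRes M N h f := by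
  refine Subtype.ext (funext fun V ↦ ?_)
  change resO X (V.2.trans h) r • f.1 ⟨V.1, V.2.trans h⟩ =
    resO X V.2 (resO X h r) • f.1 ⟨V.1, V.2.trans h⟩
  rw [resO_resO]

/-- The abelian presheaf underlying `ℋom(M, N)`. -/
def homPresheaf (M N : X.Modules) : TopCat.Presheaf Ab.{u} X where
  obj U := AddCommGrpCat.of (homSections M N U.unop)
  map i := AddCommGrpCat.ofHom (homRes M N (leOfHom i.unop))
  map_id _ := rfl
  map_comp _ _ := rfl

lemma homPresheaf_isSheaf (M N : X.Modules) : (homPresheaf M N).IsSheaf := by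
  rw [TopCat.Presheaf.isSheaf_iff_isSheafUniqueGluing]
  intro ι U sf hsf
  let N' : TopCat.Sheaf Ab.{u} X := ⟨N.presheaf, N.isSheaf⟩
  let sf' (i : ι) : homSections M N (U i) := sf i
  have hcov (V : X.Opens) (hV : V ≤ iSup U) : V ≤ ⨆ i, V ⊓ U i := by
    rw [← inf_iSup_eq]; exact le_inf le_rfl hV
  have hcomp (i j : ι) (V : X.Opens) (hi : V ≤ U i) (hj : V ≤ U j) :
      (sf' i).1 ⟨V, hi⟩ = (sf' j).1 ⟨V, hj⟩ := by
    have h1 : homRes M N inf_le_left (sf' i) = homRes M N inf_le_right (sf' j) := hsf i j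
    exact congrFun (congrArg Subtype.val h1) ⟨V, le_inf hi hj⟩
  have key (V : X.Opens) (hV : V ≤ iSup U) (m : Γ(M, V)) :
      ∃! s : Γ(N, V), ∀ i, res N (inf_le_left : V ⊓ U i ≤ V) s =
        (sf' i).1 ⟨V ⊓ U i, inf_le_right⟩ (res M inf_le_left m) := by
    refine N'.existsUnique_gluing' (fun i ↦ V ⊓ U i) V (fun i ↦ homOfLE inf_le_left) (hcov V hV)
      (fun i ↦ (sf' i).1 ⟨V ⊓ U i, inf_le_right⟩ (res M inf_le_left m)) ?_
    intro i j
    change res N inf_le_left _ = res N inf_le_right _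
    rw [← (sf' i).2 ⟨V ⊓ U i, inf_le_right⟩ ⟨V ⊓ U i ⊓ (V ⊓ U j), inf_le_left.trans inf_le_right⟩,
      ← (sf' j).2 ⟨V ⊓ U j, inf_le_right⟩ ⟨V ⊓ U i ⊓ (V ⊓ U j), inf_le_right.trans inf_le_right⟩,
      res_res, res_res, hcomp i j]
  have hsep (V : X.Opens) (hV : V ≤ iSup U) (s t : Γ(N, V))
      (h : ∀ i, res N (inf_le_left : V ⊓ U i ≤ V) s = res N inf_le_left t) : s = t :=
    N'.eq_of_locally_eq' (fun i ↦ V ⊓ U i) V (fun i ↦ homOfLE inf_le_left) (hcov V hV) s t h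
  choose g hg using fun (V : {V : X.Opens // V ≤ iSup U}) (m : Γ(M, V.1)) ↦ (key V.1 V.2 m).exists
  let G : homSections M N (iSup U) := ⟨fun V ↦
    { toFun := g V
      map_add' := fun a b ↦ hsep V.1 V.2 _ _ fun i ↦ by simp [hg]
      map_smul' := fun r a ↦ hsep V.1 V.2 _ _ fun i ↦ by simp [hg, res_smul] }, by
    intro V W h m
    refine hsep W.1 W.2 _ _ fun i ↦ ?_
    change res N _ (g W (res M h m)) = res N _ (res N h (g V m))
    have h' : W.1 ⊓ U i ≤ V.1 ⊓ U i := inf_le_inf_right _ h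
    rw [hg, res_res, res_res, ← res_res N inf_le_left h', hg,
      ← (sf' i).2 ⟨V.1 ⊓ U i, inf_le_right⟩ ⟨W.1 ⊓ U i, inf_le_right⟩ h', res_res]⟩
  refine ⟨G, fun i ↦ ?_, fun H hH ↦ ?_⟩
  · change homRes M N (le_iSup U i) G = sf' i
    ext V m
    have h : V.1 ≤ iSup U := V.2.trans (le_iSup U i)
    refine hsep V.1 h _ _ fun j ↦ ?_
    change res N _ (g ⟨V.1, h⟩ m) = res N _ ((sf' i).1 V m)
    rw [hg, ← (sf' i).2 V ⟨V.1 ⊓ U j, inf_le_left.trans V.2⟩ inf_le_left,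
      hcomp j i _ inf_le_right (inf_le_left.trans V.2)]
  · let H' : homSections M N (iSup U) := H
    have hH' (i : ι) : homRes M N (le_iSup U i) H' = sf' i := hH i
    change H' = G
    ext V m
    refine hsep V.1 V.2 _ _ fun i ↦ ?_
    change res N _ (H'.1 V m) = res N _ (g V m)
    rw [hg, ← hH' i, ← H'.2 V ⟨V.1 ⊓ U i, inf_le_left.trans V.2⟩ inf_le_left]
    rfl

instance (M N : X.Modules) (U : X.Opensᵒᵖ) :
    Module (X.ringCatSheaf.obj.obj U) ((homPresheaf M N).obj U) :=
  inferInstanceAs (Module Γ(X, U.unop) (homSections M N U.unop))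

/-- The sheaf `ℋom(M, N)` of homomorphisms of `𝒪_X`-modules. -/
def homSheaf (M N : X.Modules) : X.Modules where
  val := PresheafOfModules.ofPresheaf (R := X.ringCatSheaf.obj) (homPresheaf M N)
    fun _ _ i r f ↦ homRes_smul M N (leOfHom i.unop) r f
  isSheaf := homPresheaf_isSheaf M N

/-- The morphism `ℋom(N, P) ⟶ ℋom(M, P)` given by composition with `φ : M ⟶ N`. -/
def homSheafPrecomp {M N : X.Modules} (φ : M ⟶ N) (P : X.Modules) :
    homSheaf N P ⟶ homSheaf M P where
  val := PresheafOfModules.homMk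
    { app := fun U ↦ AddCommGrpCat.ofHom
        { toFun := fun f : homSections N P U.unop ↦
            (⟨fun V ↦ f.1 V ∘ₗ appLinear φ V.1, fun V W h m ↦ by
                change f.1 W (φ.app W.1 (res M h m)) = _
                rw [app_res, f.2 V W h]
                rfl⟩ : homSections M P U.unop)
          map_zero' := rfl
          map_add' := fun _ _ ↦ rfl }
      naturality := fun _ _ _ ↦ rfl }
    fun _ _ _ ↦ rfl

/-- The structure sheaf, as a module over itself. -/
def structureModule (X : Scheme.{u}) : X.Modules := SheafOfModules.unit X.ringCatSheaf

/-- The dual `M* = ℋom(M, 𝒪_X)`. -/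
def dual (M : X.Modules) : X.Modules := homSheaf M (structureModule X)

/-- The value `l(m)` of a section `l` of `M*` over `U` at a section `m` of `M` over `U`. -/
def dualEval {M : X.Modules} {U : X.Opens} (l : Γ(dual M, U)) (m : Γ(M, U)) : Γ(X, U) :=
  (show homSections M (structureModule X) U from l).1 ⟨U, le_rfl⟩ m

end HomSheaf

section ExteriorPower

variable {X : Scheme.{u}}

/-- Restriction on exterior powers of modules of sections:
`m₁ ∧ ⋯ ∧ m_r ↦ m₁|_V ∧ ⋯ ∧ m_r|_V`. -/
def extRes (M : X.Modules) (r : ℕ) {U V : X.Opens} (h : V ≤ U) :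
    ⋀[Γ(X, U)]^r Γ(M, U) →ₛₗ[resO X h] ⋀[Γ(X, V)]^r Γ(M, V) :=
  letI := Module.compHom (⋀[Γ(X, V)]^r Γ(M, V)) (resO X h)
  let a : Γ(M, U) [⋀^Fin r]→ₗ[Γ(X, U)] ⋀[Γ(X, V)]^r Γ(M, V) :=
    { toFun := fun m ↦ exteriorPower.ιMulti Γ(X, V) r fun i ↦ res M h (m i)
      map_update_add' := fun {_} m i x y ↦ by
        have (z : Γ(M, U)) : (fun j ↦ res M h (Function.update m i z j)) =
            Function.update (fun j ↦ res M h (m j)) i (res M h z) := by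
          ext j; by_cases hj : j = i <;> [(subst hj; simp); simp [hj]]
        simp only [this, map_add, AlternatingMap.map_update_add]
      map_update_smul' := fun {_} m i c x ↦ by
        have (z : Γ(M, U)) : (fun j ↦ res M h (Function.update m i z j)) =
            Function.update (fun j ↦ res M h (m j)) i (res M h z) := by
          ext j; by_cases hj : j = i <;> [(subst hj; simp); simp [hj]]
        simp only [this, res_smul, AlternatingMap.map_update_smul]
        rfl
      map_eq_zero_of_eq' := fun m i j hm hij ↦
        (exteriorPower.ιMulti Γ(X, V) r).map_eq_zero_of_eq _ (congrArg (res M h) hm) hij }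
  let l := exteriorPower.alternatingMapLinearEquiv a
  { toFun := l
    map_add' := l.map_add
    map_smul' := l.map_smul }

lemma extRes_ιMulti (M : X.Modules) (r : ℕ) {U V : X.Opens} (h : V ≤ U) (m : Fin r → Γ(M, U)) :
    extRes M r h (exteriorPower.ιMulti Γ(X, U) r m) =
      exteriorPower.ιMulti Γ(X, V) r fun i ↦ res M h (m i) := by
  let := Module.compHom (⋀[Γ(X, V)]^r Γ(M, V)) (resO X h)
  exact exteriorPower.alternatingMapLinearEquiv_apply_ιMulti _ m

lemma extRes_self (M : X.Modules) (r : ℕ) {U : X.Opens} (x : ⋀[Γ(X, U)]^r Γ(M, U)) :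
    extRes M r le_rfl x = x := by
  have hx := exteriorPower.ιMulti_span Γ(X, U) r Γ(M, U) ▸ Submodule.mem_top (x := x)
  induction hx using Submodule.span_induction with
  | mem x hx => obtain ⟨m, rfl⟩ := hx; simp [extRes_ιMulti, res_self]
  | zero => simp
  | add x y _ _ h₁ h₂ => simp [h₁, h₂]
  | smul c x _ h =>
    rw [LinearMap.map_smulₛₗ, h]
    congr 1
    change X.presheaf.map (𝟙 _) c = c
    simp

lemma extRes_extRes (M : X.Modules) (r : ℕ) {U V W : X.Opens} (h : V ≤ U) (h' : W ≤ V)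
    (x : ⋀[Γ(X, U)]^r Γ(M, U)) :
    extRes M r h' (extRes M r h x) = extRes M r (h'.trans h) x := by
  have hx := exteriorPower.ιMulti_span Γ(X, U) r Γ(M, U) ▸ Submodule.mem_top (x := x)
  induction hx using Submodule.span_induction with
  | mem x hx => obtain ⟨m, rfl⟩ := hx; simp [extRes_ιMulti, res_res]
  | zero => simp
  | add x y _ _ h₁ h₂ => simp [h₁, h₂]
  | smul c x _ h₁ => simp only [LinearMap.map_smulₛₗ, h₁, resO_resO]

/-- The abelian presheaf `U ↦ ⋀^r Γ(M, U)`. -/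
def extPresheaf (M : X.Modules) (r : ℕ) : TopCat.Presheaf Ab.{u} X where
  obj U := AddCommGrpCat.of (⋀[Γ(X, U.unop)]^r Γ(M, U.unop))
  map i := AddCommGrpCat.ofHom (extRes M r (leOfHom i.unop)).toAddMonoidHom
  map_id _ := AddCommGrpCat.hom_ext (AddMonoidHom.ext fun x ↦ extRes_self M r x)
  map_comp i j := AddCommGrpCat.hom_ext (AddMonoidHom.ext fun x ↦
    (extRes_extRes M r (leOfHom i.unop) (leOfHom j.unop) x).symm)

instance (M : X.Modules) (r : ℕ) (U : X.Opensᵒᵖ) :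
    Module (X.ringCatSheaf.obj.obj U) ((extPresheaf M r).obj U) :=
  inferInstanceAs (Module Γ(X, U.unop) (⋀[Γ(X, U.unop)]^r Γ(M, U.unop)))

/-- The exterior power `⋀^r M`: the sheaf of `𝒪_X`-modules associated with `U ↦ ⋀^r Γ(M, U)`. -/
def sheafExteriorPower (M : X.Modules) (r : ℕ) : X.Modules :=
  (PresheafOfModules.sheafification (𝟙 X.ringCatSheaf.obj)).obj
    (PresheafOfModules.ofPresheaf (R := X.ringCatSheaf.obj) (extPresheaf M r)
      fun _ _ i c x ↦ (extRes M r (leOfHom i.unop)).map_smulₛₗ c x)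

end ExteriorPower

section VectorBundle

/-- A vector bundle of rank `r`: an `𝒪_X`-module that is locally isomorphic to `𝒪^r`. -/
def IsVectorBundle {X : Scheme.{0}} (M : X.Modules) (r : ℕ) : Prop :=
  ∀ x : X, ∃ U : X.Opens, x ∈ U ∧
    Nonempty (M.restrict U.ι ≅ SheafOfModules.free (R := U.toScheme.ringCatSheaf) (Fin r))

/-- The line bundle `det M = ⋀^r M` of a vector bundle of rank `r` is trivial. -/
def HasTrivialDet {X : Scheme.{u}} (M : X.Modules) (r : ℕ) : Prop :=
  Nonempty (sheafExteriorPower M r ≅ structureModule X)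

variable {X : Scheme.{u}}

/-- The stalk `M_x`, a module over `𝒪_{X,x}`. -/
abbrev stalk (M : X.Modules) (x : X) : Type u := M.presheaf.stalk x

/-- `M` as a presheaf of modules over the presheaf of commutative rings `𝒪_X`. -/
abbrev toPresheafMod (M : X.Modules) :
    PresheafOfModules (X.presheaf ⋙ forget₂ CommRingCat RingCat) := M.val

instance (M : X.Modules) (x : X) : Module (X.presheaf.stalk x) (stalk M x) :=
  inferInstanceAs (Module (X.presheaf.stalk x)
    (TopCat.Presheaf.stalk (C := Ab.{u}) (X := X.carrier) (toPresheafMod M).presheaf x))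

lemma germ_smul (M : X.Modules) (x : X) {U : X.Opens} (hx : x ∈ U) (r : Γ(X, U)) (m : Γ(M, U)) :
    (M.presheaf.germ U x hx (r • m) : stalk M x) =
      X.presheaf.germ U x hx r • (M.presheaf.germ U x hx m : stalk M x) :=
  PresheafOfModules.germ_smul (R := X.presheaf) (toPresheafMod M) x U hx r m

/-- The map `M_x ⟶ N_x` of stalks induced by `φ : M ⟶ N`. -/
def stalkMap {M N : X.Modules} (φ : M ⟶ N) (x : X) :
    stalk M x →ₗ[X.presheaf.stalk x] stalk N x where
  toFun := (TopCat.Presheaf.stalkFunctor Ab.{u} x).map φ.mapPresheaf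
  map_add' := map_add _
  map_smul' r m := by
    obtain ⟨U, hU, r, rfl⟩ := X.presheaf.exists_germ_eq r
    obtain ⟨V, hVU, hV, m, rfl⟩ := M.presheaf.exists_le_germ_eq m hU
    have hr : X.presheaf.germ U x hU r = X.presheaf.germ V x hV (resO X hVU r) :=
      (X.presheaf.germ_res_apply (homOfLE hVU) x hV r).symm
    have h (m : Γ(M, V)) : (TopCat.Presheaf.stalkFunctor Ab.{u} x).map φ.mapPresheaf
        (M.presheaf.germ V x hV m) = N.presheaf.germ V x hV (φ.app V m) :=
      TopCat.Presheaf.stalkFunctor_map_germ_apply V x hV φ.mapPresheaf m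
    rw [hr, ← germ_smul, h, h, φ.app_smul, germ_smul]
    rfl

/-- The map `φ(x) : κ(x) ⊗ M_x ⟶ κ(x) ⊗ N_x` on fibres at `x` induced by `φ : M ⟶ N`. -/
def fibreMap {M N : X.Modules} (φ : M ⟶ N) (x : X) :=
  (stalkMap φ x).baseChange (IsLocalRing.ResidueField (X.presheaf.stalk x))

/-- The rank of `φ : M ⟶ N` at the point `x`. -/
def rankAt {M N : X.Modules} (φ : M ⟶ N) (x : X) : ℕ :=
  Module.finrank (IsLocalRing.ResidueField (X.presheaf.stalk x)) (LinearMap.range (fibreMap φ x))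

end VectorBundle

section Codimension

variable {X : Scheme.{u}}

/-- The codimension of a (constructible) set `S` of points: the infimum over `x ∈ S` of the
codimension `dim 𝒪_{X,x}` of the closure of `x`. It is `⊤` if `S` is empty. -/
def codim (S : Set X) : ℕ∞ := ⨅ x ∈ S, Order.coheight x

/-- Every irreducible component of the locally closed set `S` has codimension `c`, that is,
every point of `S` that is not a proper specialization of a point of `S` has codimension `c`. -/
def HasPureCodim (S : Set X) (c : ℕ∞) : Prop :=
  ∀ x ∈ S, (∀ x' ∈ S, x' ⤳ x → x' = x) → Order.coheight x = c

end Codimension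

section ClosedImmersion

variable {Z U : Scheme.{u}}

/-- `i : Z ⟶ U` is the inclusion of a closed subscheme that is locally a complete intersection of
codimension `c`: near every point of `Z`, the ideal of `Z` is generated by a regular sequence of
length `c`. -/
def IsLocalCompleteIntersection (i : Z ⟶ U) (c : ℕ) : Prop :=
  IsClosedImmersion i ∧ ∀ z : Z, ∃ V : U.affineOpens, i z ∈ V.1 ∧ ∃ s : List Γ(U, V.1),
    s.length = c ∧ RingTheory.Sequence.IsRegular Γ(U, V.1) s ∧
      RingHom.ker (i.app V.1).hom = Ideal.ofList s

/-- The ideal sheaf `ℐ = ker (𝒪_U ⟶ i_* 𝒪_Z)` as an `𝒪_U`-module. -/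
def idealModule (i : Z ⟶ U) : U.Modules :=
  Limits.kernel (show structureModule U ⟶ (Scheme.Modules.pushforward i).obj (structureModule Z)
    from SheafOfModules.unitToPushforwardObjUnit i.toRingCatSheafHom)

/-- The conormal sheaf `i^* ℐ = ℐ / ℐ²`. -/
def conormalSheaf (i : Z ⟶ U) : Z.Modules := (Scheme.Modules.pullback i).obj (idealModule i)

/-- The normal sheaf `(ℐ / ℐ²)*`. -/
def normalSheaf (i : Z ⟶ U) : Z.Modules := dual (conormalSheaf i)

end ClosedImmersion

section Lagrangian

variable {Y : Scheme.{u}} {E F : Y.Modules}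

/-- A morphism `ω : E ⟶ E*` regarded as the bilinear form `⟨s, t⟩ = ω(s)(t)`. -/
def pairing (ω : E ⟶ dual E) {U : Y.Opens} (s t : Γ(E, U)) : Γ(Y, U) :=
  dualEval (ω.app U s) t

/-- `ω` is an everywhere nondegenerate skew-symmetric (alternating) `2`-form on the vector bundle
`E`. Nondegeneracy at all points means that `E ⟶ E*` is an isomorphism. -/
structure IsSymplecticForm (ω : E ⟶ dual E) : Prop where
  alternating : ∀ (U : Y.Opens) (s : Γ(E, U)), pairing ω s s = 0
  nondegenerate : IsIso ω

/-- The transpose `φ* : E ⟶ F*` of `φ : F ⟶ E` with respect to the self-duality of `E`,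
`φ*(e)(f) = ⟨e, φ(f)⟩`. -/
def transpose (ω : E ⟶ dual E) (φ : F ⟶ E) : E ⟶ dual F :=
  ω ≫ homSheafPrecomp φ (structureModule Y)

/-- A Lagrangian morphism from a vector bundle `F` of rank `n` to a vector bundle `E` of rank `2n`
with symplectic form `ω`: the generic rank is `n`, and at every point `y` the image of `F(y)` in
`E(y)` is isotropic, i.e. the functions `⟨φ(s), φ(t)⟩` vanish at `y` for all sections `s`, `t` of
`F` near `y`. -/
structure IsLagrangian [IrreducibleSpace Y] (n : ℕ) (ω : E ⟶ dual E) (φ : F ⟶ E) : Prop where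
  rank_genericPoint : rankAt φ (genericPoint Y) = n
  isotropic : ∀ (y : Y) (U : Y.Opens) (hy : y ∈ U) (s t : Γ(F, U)),
    Y.evaluation U y hy (pairing ω (φ.app U s) (φ.app U t)) = 0

/-- `Y_{≤ n-1}`, the set of points where `φ` has rank at most `n - 1`. -/
def degeneracyLocus (φ : F ⟶ E) (n : ℕ) : Set Y := {y | rankAt φ y < n}

/-- `Y_{n-1}`, the set of points where `φ` has rank exactly `n - 1`. -/
def corankOneLocus (φ : F ⟶ E) (n : ℕ) : Set Y := {y | rankAt φ y + 1 = n}

/-- The ideal of `Γ(V, 𝒪_Y)` generated by the `n × n` minors of `φ`, that is, by the determinants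
`det (l_j (φ (f_i)))` where `f_1, …, f_n` are sections of `F` and `l_1, …, l_n` sections of `E*`
over `V`. -/
def minorIdeal (φ : F ⟶ E) (n : ℕ) (V : Y.Opens) : Ideal Γ(Y, V) :=
  Ideal.span {a | ∃ (f : Fin n → Γ(F, V)) (l : Fin n → Γ(dual E, V)),
    a = (Matrix.of fun i j ↦ dualEval (l j) (φ.app V (f i))).det}

/-- The quasi-coherent ideal sheaf of the `n × n` minors of `φ`. -/
def degeneracyIdeal (φ : F ⟶ E) (n : ℕ) : Y.IdealSheafData :=
  .ofIdeals fun V ↦ minorIdeal φ n V.1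

/-- The part over the open set `U` of the closed subscheme of `Y` defined by the `n × n` minors
of `φ`. When `U` is the set of points where `φ` has rank at least `n - 1`, this is the locally
closed subset `Y_{n-1}` with its scheme structure as a determinantal locus. -/
def determinantalScheme (φ : F ⟶ E) (n : ℕ) (U : Y.Opens) : Scheme.{u} :=
  ((degeneracyIdeal φ n).subschemeι ⁻¹ᵁ U).toScheme

/-- The inclusion of `determinantalScheme φ n U` in `U`. -/
def determinantalι (φ : F ⟶ E) (n : ℕ) (U : Y.Opens) :
    determinantalScheme φ n U ⟶ U.toScheme :=
  (degeneracyIdeal φ n).subschemeι ∣_ U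

/-- `G` is a torsion sheaf: over affine open sets, its sections are torsion. -/
def IsTorsionSheaf (G : Y.Modules) : Prop :=
  ∀ V : Y.affineOpens, Module.IsTorsion Γ(Y, V.1) Γ(G, V.1)

/-- `G` is supported on the set `S`: its stalks outside `S` vanish. -/
def IsSupportedOn (G : Y.Modules) (S : Set Y) : Prop :=
  ∀ y ∉ S, Subsingleton (stalk G y)

end Lagrangian

end LagrangianMorphism

end

open LagrangianMorphism

/-!
# Lagrangian morphisms that degenerate in codimension two

The proof rests on a normal form. Near a point where the rank of `φ` is `n - 1` there are a frame
`f` of `F` and a symplectic frame `q` of `E` such that `φ f_i = q_i` for all indices but one, `o`,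
and `φ f_o = a q_o + b q'_o`, where `q_o, q'_o` span a hyperbolic plane (`IsAdapted`,
`exists_isAdapted`). It comes from linear algebra over the local ring of the point
(`exists_adapted_bases`). In such frames the ideal of `n × n` minors is `(a, b)`
(`IsAdapted.minorIdeal_eq`). By hypothesis this ideal has height at least two, and `Y` is smooth,
hence normal (`isIntegrallyClosed_of_smooth`). In a normal Noetherian domain a fraction whose ideal
of denominators has height at least two is regular (`exists_algebraMap_eq_of_two_le_height`); so
`a, b` is a regular sequence, and Krull's height theorem gives codimension exactly two.

The same fact about fractions gives exactness of `F → E → F*`: a vector orthogonal to the image of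
`φ` lies in this image over the function field, and by Cramer's rule the minors are denominators for
its coefficients (`exists_mulVec_eq_of_two_le_height`). Cramer's rule also shows that the minors
annihilate the cokernel `𝒢` of `φ* : E → F*` (`IsNormalLagrangian.minor_smul_eq_zero`), so that `𝒢`
is torsion and supported on the degeneracy locus. In adapted frames `𝒢` is generated by the class of
the dual vector `f_o^*`, with annihilator `(a, b)`. Hence on `U` it is the direct image of the line
bundle `L = i^* 𝒢`, where `i` is the inclusion of `Y_{n-1}` (`isIso_unit_of_isPrincipal`).

For the normal bundle `𝒩` put `ℰ₂ = ℋom(𝒩, L)`. Since `L` is a line bundle and `𝒩` a vector bundle,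
evaluation is an isomorphism `𝒩 ≅ ℋom(ℰ₂, L)`. An adapted frame provides the frame
`a ⊗ f_o^*, b ⊗ f_o^*` of `ℰ₂ = ℐ/ℐ² ⊗ L`. For a section `e` of `E` the element
`∑ ⟨e, φ f_j⟩ ⊗ f_j^*` does not depend on the frame `f`; therefore two adapted frames differ on `ℰ₂`
by the matrix of pairings of the two hyperbolic planes (`IsAdapted.sum_pairing_smul`). The
determinant of this matrix is one modulo the ideal of minors (`IsAdapted.transition_det`), because
the remaining basis vectors `q_j = φ f_j` pair into this ideal with the plane of the other frame. So
the local determinants glue to a trivialization of `det ℰ₂` (`hasTrivialDet_of_frames`).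

Vector bundles are handled through frames, that is, families of sections over an open set that form
a basis over every smaller open set (`IsFrame`).
-/

noncomputable section

namespace LagrangianMorphism

set_option linter.unusedSectionVars false

universe u

/-! ### Ideals of height two in normal rings -/

section Height

variable {R : Type*} [CommRing R] [IsDomain R] [IsNoetherianRing R]

/-- In a normal Noetherian domain, a fraction whose ideal of denominators has height at least `2`
is regular. An associated prime of `K / R` would otherwise have height at most `1`. -/
lemma exists_algebraMap_eq_of_two_le_height [IsIntegrallyClosed R] {K : Type*} [Field K]
    [Algebra R K] [IsFractionRing R K] {I : Ideal R}
    (hI : ∀ P : Ideal R, P.IsPrime → I ≤ P → 2 ≤ P.height) {x : K}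
    (hx : ∀ r ∈ I, ∃ s : R, algebraMap R K s = r • x) : ∃ s : R, algebraMap R K s = x := by
  by_contra hne
  let N : Submodule R K := LinearMap.range (Algebra.linearMap R K)
  have hN (y : K) : N.mkQ y = 0 ↔ ∃ s : R, algebraMap R K s = y := by
    simp [N, Submodule.Quotient.mk_eq_zero]
  obtain ⟨P, hP, hle⟩ := exists_le_isAssociatedPrime_of_isNoetherianRing R (N.mkQ x)
    (fun h ↦ hne ((hN x).mp h))
  rw [isAssociatedPrime_iff] at hP
  obtain ⟨hPp, y', hy'⟩ := hP
  obtain ⟨y, rfl⟩ := N.mkQ_surjective y'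
  have hmem (r : R) : r ∈ P ↔ ∃ s : R, algebraMap R K s = r • y := by
    rw [hy', Submodule.mem_colon_singleton, Submodule.mem_bot, ← map_smul, hN]
  have hIP : I ≤ P := fun r hr ↦ hle (by
    rw [Submodule.mem_colon_singleton, Submodule.mem_bot, ← map_smul, hN]
    exact hx r hr)
  have hht := hI P hPp hIP
  -- `P y ⊆ R` for the lift `y`. If `P y ⊄ P`, then `P` becomes principal after localization;
  -- otherwise `y` is integral over `R`.
  by_cases hcase : ∃ p ∈ P, ∃ u ∉ P, algebraMap R K u = p • y
  · obtain ⟨p, hp, u, hu, hpu⟩ := hcase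
    have hmin : P ∈ (Ideal.span {p}).minimalPrimes := by
      refine ⟨⟨hPp, (Ideal.span_singleton_le_iff_mem _).mpr hp⟩, fun Q ⟨hQ, hpQ⟩ hQP r hr ↦ ?_⟩
      obtain ⟨s, hs⟩ := (hmem r).mp hr
      have h1 : r * u = p * s := by
        apply IsFractionRing.injective R K
        rw [map_mul, map_mul, hpu, hs, Algebra.smul_def, Algebra.smul_def]
        ring
      have h2 : r * u ∈ Q := h1 ▸ Q.mul_mem_right _ (hpQ (Ideal.mem_span_singleton_self p))
      exact (hQ.mem_or_mem h2).resolve_right fun h ↦ hu (hQP h)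
    have h3 := Ideal.height_le_one_of_isPrincipal_of_mem_minimalPrimes (Ideal.span {p}) P hmin
    exact absurd (hht.trans h3) (by norm_num)
  · push Not at hcase
    have hP0 : P ≠ ⊥ := by
      rintro rfl
      rw [Ideal.height_bot] at hht
      exact absurd hht (by norm_num)
    let A : Submodule R K := Submodule.map (Algebra.linearMap R K) P
    have hint : IsIntegral R y := by
      refine isIntegral_of_smul_mem_submodule A ?_ ((IsNoetherian.noetherian P).map _) y ?_
      · obtain ⟨p, hp, hp0⟩ := Submodule.exists_mem_ne_zero_of_ne_bot hP0
        intro hA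
        have : algebraMap R K p ∈ A := ⟨p, hp, rfl⟩
        rw [hA, Submodule.mem_bot] at this
        exact hp0 ((map_eq_zero_iff _ (IsFractionRing.injective R K)).mp this)
      · rintro _ ⟨p, hp, rfl⟩
        obtain ⟨s, hs⟩ := (hmem p).mp hp
        refine ⟨s, ?_, ?_⟩
        · by_contra hsP
          exact hcase p hp s hsP hs
        · simp only [Algebra.linearMap_apply, hs, smul_eq_mul, Algebra.smul_def]
          ring
    have h1 := IsIntegrallyClosed.isIntegral_iff.mp hint
    exact hPp.ne_top ((Ideal.eq_top_iff_one _).mpr ((hmem 1).mpr (by simpa using h1)))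

lemma ne_zero_of_two_le_height {a b : R}
    (hI : ∀ P : Ideal R, P.IsPrime → Ideal.span {a, b} ≤ P → 2 ≤ P.height)
    (htop : Ideal.span {a, b} ≠ ⊤) : a ≠ 0 := by
  rintro rfl
  obtain ⟨P, hP⟩ := Ideal.nonempty_minimalPrimes htop
  have h0 : Ideal.span {0, b} = Ideal.span {b} := by
    rw [Ideal.span_insert]; simp
  rw [h0] at hP hI
  have h3 := Ideal.height_le_one_of_isPrincipal_of_mem_minimalPrimes (Ideal.span {b}) P hP
  exact absurd ((hI P hP.1.1 hP.1.2).trans h3) (by norm_num)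

/-- The fraction `x / a` has both `a` and `b` as denominators. -/
lemma dvd_of_dvd_mul_of_two_le_height [IsIntegrallyClosed R] {a b x : R} (ha : a ≠ 0)
    (hI : ∀ P : Ideal R, P.IsPrime → Ideal.span {a, b} ≤ P → 2 ≤ P.height)
    (h : a ∣ b * x) : a ∣ x := by
  obtain ⟨y, hy⟩ := h
  let K := FractionRing R
  have ha' : algebraMap R K a ≠ 0 := by
    exact (map_ne_zero_iff _ (IsFractionRing.injective R K)).mpr ha
  obtain ⟨s, hs⟩ := exists_algebraMap_eq_of_two_le_height (K := K) hI
    (x := algebraMap R K x / algebraMap R K a) fun r hr ↦ by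
      obtain ⟨c, d, rfl⟩ := Ideal.mem_span_pair.mp hr
      refine ⟨c * x + d * y, ?_⟩
      have hy' : algebraMap R K b * algebraMap R K x = algebraMap R K a * algebraMap R K y := by
        rw [← map_mul, hy, map_mul]
      rw [Algebra.smul_def]
      rw [← mul_div_assoc, eq_div_iff ha']
      simp only [map_add, map_mul]
      linear_combination (-(algebraMap R K d)) * hy'
  refine ⟨s, IsFractionRing.injective R K ?_⟩
  rw [map_mul, hs, mul_div_cancel₀ _ ha']

open RingTheory.Sequence Pointwise in
lemma isRegular_pair_of_two_le_height [IsIntegrallyClosed R] {a b : R}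
    (hI : ∀ P : Ideal R, P.IsPrime → Ideal.span {a, b} ≤ P → 2 ≤ P.height)
    (htop : Ideal.span {a, b} ≠ ⊤) : IsRegular R [a, b] := by
  have ha := ne_zero_of_two_le_height hI htop
  refine ⟨(isWeaklyRegular_cons_iff R a [b]).mpr ⟨?_, ?_⟩, ?_⟩
  · exact fun x y h ↦ mul_left_cancel₀ ha h
  · rw [isWeaklyRegular_singleton_iff]
    have hab : ∀ m : R, m ∈ a • (⊤ : Submodule R R) ↔ a ∣ m := fun m ↦ by
      simp [Submodule.mem_smul_pointwise_iff_exists, Dvd.dvd, eq_comm]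
    refine isSMulRegular_iff_right_eq_zero_of_smul.mpr fun z hz ↦ ?_
    obtain ⟨z, rfl⟩ := Submodule.Quotient.mk_surjective _ z
    have h0 : (Submodule.Quotient.mk (b • z) : R ⧸ a • (⊤ : Submodule R R)) = 0 := hz
    rw [Submodule.Quotient.mk_eq_zero, hab] at h0
    change (Submodule.Quotient.mk z : R ⧸ a • (⊤ : Submodule R R)) = 0
    rw [Submodule.Quotient.mk_eq_zero, hab]
    exact dvd_of_dvd_mul_of_two_le_height ha hI h0
  · rw [smul_eq_mul, Ideal.mul_top]
    have : Ideal.ofList [a, b] = Ideal.span {a, b} := by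
      simp [Ideal.ofList_cons, Ideal.span_insert]
    rw [this]
    exact fun h ↦ htop h.symm

end Height

/-! ### Maximal minors and Lagrangian matrices -/

section Minors

open Matrix

variable {κ ι : Type*} [Fintype κ] [Fintype ι] [DecidableEq κ] [DecidableEq ι]

/-- Cramer's rule for the rows of `A` selected by `s`. -/
lemma adjugate_submatrix_mulVec {R : Type*} [CommRing R] (A : Matrix κ ι R) (s : ι → κ)
    (x : ι → R) :
    (A.submatrix s id).adjugate *ᵥ (fun i ↦ (A *ᵥ x) (s i)) = (A.submatrix s id).det • x := by
  have : (fun i ↦ (A *ᵥ x) (s i)) = A.submatrix s id *ᵥ x := rfl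
  rw [this, mulVec_mulVec, adjugate_mul, smul_mulVec, one_mulVec]

/-- A matrix over a field has full column rank if and only if it has a nonzero maximal minor. -/
lemma rank_eq_card_iff_exists_minor {k : Type*} [Field k] (A : Matrix κ ι k) :
    A.rank = Fintype.card ι ↔ ∃ s : ι → κ, (A.submatrix s id).det ≠ 0 := by
  constructor
  · intro h
    rw [A.rank_eq_finrank_span_row] at h
    obtain ⟨κ', f, hf, hspan, hli⟩ := exists_linearIndependent' k A.row
    have : Fintype κ' := Fintype.ofInjective _ hf
    have hcard : Fintype.card κ' = Fintype.card ι := by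
      rw [← h, ← hspan]
      exact (finrank_span_eq_card hli).symm
    let e : ι ≃ κ' := Fintype.equivOfCardEq hcard.symm
    refine ⟨f ∘ e, ?_⟩
    have hrow : LinearIndependent k (A.submatrix (f ∘ e) id).row := hli.comp e e.injective
    exact ((isUnit_iff_isUnit_det _).mp (linearIndependent_rows_iff_isUnit.mp hrow)).ne_zero
  · rintro ⟨s, hs⟩
    refine le_antisymm (A.rank_le_card_width) ?_
    rw [← rank_of_det_ne_zero hs]
    exact rank_submatrix_le A s id

/-- Over a field, the orthogonal of a Lagrangian subspace is the subspace itself. -/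
lemma exists_mulVec_eq_of_isotropic {k : Type*} [Field k] {A : Matrix κ ι k} {J : Matrix κ κ k}
    (hcard : Fintype.card κ = 2 * Fintype.card ι) (hJ : IsUnit J.det) (hA : Aᵀ * J * A = 0)
    (hrank : A.rank = Fintype.card ι) {e : κ → k} (he : e ᵥ* (J * A) = 0) :
    ∃ x, A *ᵥ x = e := by
  have hrank' : ((J * A)ᵀ).rank = Fintype.card ι := by
    rw [rank_transpose, rank_mul_eq_right_of_isUnit_det _ _ hJ, hrank]
  have hle : LinearMap.range A.mulVecLin ≤ LinearMap.ker ((J * A)ᵀ).mulVecLin := by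
    rintro _ ⟨x, rfl⟩
    have h0 : (J * A)ᵀ * A = 0 := by
      rw [← transpose_transpose ((J * A)ᵀ * A), transpose_mul, transpose_transpose,
        ← Matrix.mul_assoc, hA, transpose_zero]
    rw [LinearMap.mem_ker, mulVecLin_apply, mulVecLin_apply, mulVec_mulVec, h0, zero_mulVec]
  have heq : LinearMap.range A.mulVecLin = LinearMap.ker ((J * A)ᵀ).mulVecLin := by
    refine Submodule.eq_of_le_of_finrank_eq hle ?_
    have h1 := ((J * A)ᵀ).mulVecLin.finrank_range_add_finrank_ker
    rw [Module.finrank_fintype_fun_eq_card, hcard] at h1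
    change A.rank = _
    change ((J * A)ᵀ).rank + _ = _ at h1
    omega
  have : e ∈ LinearMap.range A.mulVecLin := by
    rw [heq, LinearMap.mem_ker, mulVecLin_apply, mulVec_transpose, he]
  exact this

variable {R : Type*} [CommRing R] [IsDomain R]

lemma exists_minor_ne_zero {A : Matrix κ ι R}
    (hI : ∀ P : Ideal R, P.IsPrime → (∀ s : ι → κ, (A.submatrix s id).det ∈ P) → 2 ≤ P.height) :
    ∃ s : ι → κ, (A.submatrix s id).det ≠ 0 := by
  by_contra! h
  have := hI ⊥ Ideal.isPrime_bot fun s ↦ (h s)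
  rw [Ideal.height_bot] at this
  exact absurd this (by norm_num)

lemma mulVec_injective_of_minor_ne_zero {A : Matrix κ ι R} {s : ι → κ}
    (hs : (A.submatrix s id).det ≠ 0) {x : ι → R} (hx : A *ᵥ x = 0) : x = 0 := by
  have h := adjugate_submatrix_mulVec A s x
  simp only [hx, Pi.zero_apply] at h
  have h0 : (fun _ : ι ↦ (0 : R)) = 0 := rfl
  rw [h0, mulVec_zero] at h
  exact (smul_eq_zero.mp h.symm).resolve_left hs

/-- A Lagrangian morphism of free modules over a normal Noetherian domain is the kernel of its
transpose, if its maximal minors generate an ideal of height at least `2`: a vector orthogonal to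
the columns of `A` is a combination of them over the fraction field, and by Cramer's rule the
maximal minors are denominators for the coefficients. -/
lemma exists_mulVec_eq_of_two_le_height [IsNoetherianRing R] [IsIntegrallyClosed R]
    {A : Matrix κ ι R} {J : Matrix κ κ R}
    (hcard : Fintype.card κ = 2 * Fintype.card ι) (hJ : IsUnit J.det) (hA : Aᵀ * J * A = 0)
    (hI : ∀ P : Ideal R, P.IsPrime → (∀ s : ι → κ, (A.submatrix s id).det ∈ P) → 2 ≤ P.height)
    {e : κ → R} (he : e ᵥ* (J * A) = 0) : ∃ x, A *ᵥ x = e := by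
  let K := FractionRing R
  let α := algebraMap R K
  have hα : Function.Injective α := IsFractionRing.injective R K
  obtain ⟨s₀, hs₀⟩ := exists_minor_ne_zero hI
  have hdet (s : ι → κ) : ((A.map α).submatrix s id).det = α (A.submatrix s id).det := by
    rw [RingHom.map_det]; rfl
  obtain ⟨x, hx⟩ := exists_mulVec_eq_of_isotropic (A := A.map α) (J := J.map α) (e := α ∘ e) hcard
    (by
      have : (J.map α).det = α J.det := (α.map_det J).symm
      rw [this]; exact hJ.map α)
    (by rw [← transpose_map, ← Matrix.map_mul, ← Matrix.map_mul, hA]; simp)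
    ((rank_eq_card_iff_exists_minor _).mpr ⟨s₀, by
      rw [hdet]; exact (map_ne_zero_iff _ hα).mpr hs₀⟩)
    (by
      rw [← Matrix.map_mul]
      funext j
      have := congrArg α (congrFun he j)
      rw [RingHom.map_vecMul] at this
      simpa using this)
  have hcramer (s : ι → κ) (j : ι) : ∃ y : R, α y = (A.submatrix s id).det • x j := by
    refine ⟨((A.submatrix s id).adjugate *ᵥ (e ∘ s)) j, ?_⟩
    have h1 := congrFun (adjugate_submatrix_mulVec (A.map α) s x) j
    rw [hx, hdet] at h1
    rw [RingHom.map_mulVec, Algebra.smul_def, ← smul_eq_mul]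
    refine Eq.trans ?_ h1
    have : (A.submatrix s id).adjugate.map α = ((A.map α).submatrix s id).adjugate :=
      α.map_adjugate _
    rw [← this]
    rfl
  have hint (j : ι) : ∃ y : R, α y = x j := by
    refine exists_algebraMap_eq_of_two_le_height
      (I := Ideal.span (Set.range fun s : ι → κ ↦ (A.submatrix s id).det)) (fun P hP hle ↦
        hI P hP fun s ↦ hle (Ideal.subset_span ⟨s, rfl⟩)) fun r hr ↦ ?_
    induction hr using Submodule.span_induction with
    | mem r hr => obtain ⟨s, rfl⟩ := hr; exact hcramer s j
    | zero => exact ⟨0, by simp⟩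
    | add a b _ _ ha hb =>
      obtain ⟨a', ha'⟩ := ha
      obtain ⟨b', hb'⟩ := hb
      exact ⟨a' + b', by rw [map_add, ha', hb', add_smul]⟩
    | smul c a _ ha =>
      obtain ⟨a', ha'⟩ := ha
      exact ⟨c * a', by rw [map_mul, ha', smul_eq_mul, mul_smul, Algebra.smul_def c]⟩
  choose y hy using hint
  refine ⟨y, funext fun i ↦ hα ?_⟩
  rw [RingHom.map_mulVec]
  have : α ∘ y = x := funext hy
  rw [this, hx]
  rfl

end Minors

/-! ### Symplectic bases over local rings -/

section Adapted

open Matrix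

variable {R : Type*} [CommRing R] {κ ι : Type*} [Fintype κ] [DecidableEq κ]

lemma toBilin'_apply_col (J : Matrix κ κ R) {μ ν : Type*} (M : Matrix κ μ R) (N : Matrix κ ν R)
    (i : μ) (j : ν) : toBilin' J (M.col i) (N.col j) = (Mᵀ * J * N) i j := by
  rw [toBilin'_apply', Matrix.mul_assoc, Matrix.mul_apply]
  simp only [dotProduct, mulVec, Matrix.mul_apply, transpose_apply, col_apply]

lemma isAlt_toBilin' {J : Matrix κ κ R} (h₁ : ∀ i j, J i j = -J j i) (h₀ : ∀ i, J i i = 0) :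
    (toBilin' J).IsAlt := by
  intro x
  rw [toBilin'_apply, ← Finset.sum_product']
  refine Finset.sum_involution (fun p _ ↦ (p.2, p.1)) ?_ ?_ ?_ ?_
  · rintro ⟨i, j⟩ _
    dsimp only
    rw [h₁ i j]; ring
  · rintro ⟨i, j⟩ _ h heq
    obtain rfl : j = i := congrArg Prod.fst heq
    simp [h₀] at h
  · simp
  · simp

variable {J : Matrix κ κ R}

/-- A family dual to an isotropic family can be made isotropic. -/
lemma exists_isotropic_dual_family [Fintype ι] [LinearOrder ι] {B : LinearMap.BilinForm R (κ → R)}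
    (hB : B.IsAlt) {e x : ι → κ → R} (he : ∀ i j, B (e i) (e j) = 0)
    (hx : ∀ i j, B (e i) (x j) = if i = j then 1 else 0) :
    ∃ x' : ι → κ → R, (∀ i j, B (e i) (x' j) = if i = j then 1 else 0) ∧
      ∀ i j, B (x' i) (x' j) = 0 := by
  have hxe (i j) : B (x j) (e i) = if i = j then -1 else 0 := by
    rw [← hB.neg_eq, hx]; split_ifs <;> simp
  -- the pairings `B (x i) (x j)` with `i < j` are cancelled by correcting `x j` only
  let x' (j : ι) : κ → R := x j + ∑ k, (if k < j then B (x k) (x j) else 0) • e k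
  have hex' (i j) : B (e i) (x' j) = if i = j then 1 else 0 := by
    simp only [x', map_add, map_sum, map_smul, he, hx, smul_zero, Finset.sum_const_zero, add_zero]
  refine ⟨x', hex', fun i j ↦ ?_⟩
  have h1 : B (x' i) (x' j) = B (x i) (x j) - (if i < j then B (x i) (x j) else 0) +
      (if j < i then B (x j) (x i) else 0) := by
    have h2 : B (x i) (x' j) = B (x i) (x j) - (if i < j then B (x i) (x j) else 0) := by
      simp only [x', map_add, map_sum, map_smul, hxe]
      simp [sub_eq_add_neg]
    have h3 (z) : B (x' i) z = B (x i) z +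
        ∑ k, (if k < i then B (x k) (x i) else 0) • B (e k) z := by
      simp only [x', map_add, map_sum, map_smul, LinearMap.add_apply, LinearMap.sum_apply,
        LinearMap.smul_apply]
    rw [h3, h2]
    simp [hex']
  rw [h1]
  rcases lt_trichotomy i j with h | rfl | h
  · simp [h, h.not_gt]
  · simp [hB.self_eq_zero]
  · simp [h, h.not_gt, ← hB.neg_eq (x i) (x j)]

/-- A vector orthogonal to a symplectic basis vanishes. -/
lemma eq_zero_of_orthogonal_symplectic_basis [Fintype ι] [DecidableEq ι]
    (hcard : Fintype.card κ = 2 * Fintype.card ι) {Q : Matrix κ (ι ⊕ ι) R}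
    (hQ : Qᵀ * J * Q = fromBlocks 0 1 (-1) 0) {z : κ → R}
    (hz : ∀ i, toBilin' J (Q.col i) z = 0) : z = 0 := by
  -- `Q` is square, so the left inverse given by its Gram matrix is also a right inverse
  have h1 : (fromBlocks 0 (-1) 1 0 : Matrix (ι ⊕ ι) (ι ⊕ ι) R) * (Qᵀ * J) * Q = 1 := by
    rw [Matrix.mul_assoc, hQ, fromBlocks_multiply]
    simp [fromBlocks_one]
  have h2 := (mul_eq_one_comm_of_card_eq _ _ _ (by
    rw [Fintype.card_sum, hcard, two_mul])).mp h1
  have h3 : (Qᵀ * J) *ᵥ z = 0 := by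
    funext i
    have := hz i
    rw [toBilin'_apply'] at this
    rw [← mulVec_mulVec]
    exact this
  rw [← one_mulVec z, ← h2, ← mulVec_mulVec, ← mulVec_mulVec, h3, mulVec_zero,
    mulVec_zero]

variable [IsLocalRing R]

open IsLocalRing in
/-- Vectors that are independent modulo the maximal ideal have a dual family with respect to a
perfect pairing. -/
lemma exists_dual_family [Fintype ι] [DecidableEq ι] (hJ : IsUnit J.det) (e : ι → κ → R)
    (he : LinearIndependent (ResidueField R) fun i ↦ residue R ∘ e i) :
    ∃ x : ι → κ → R, ∀ i j, toBilin' J (e i) (x j) = if i = j then 1 else 0 := by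
  let M : Matrix ι κ R := of e * J
  have hM : (M.map (residue R))ᵀ.rank = Fintype.card ι := by
    rw [rank_transpose, Matrix.map_mul, rank_mul_eq_left_of_isUnit_det]
    · exact he.rank_matrix
    · have : (J.map (residue R)).det = residue R J.det := ((residue R).map_det J).symm
      rw [this]
      exact hJ.map _
  obtain ⟨s, hs⟩ := (rank_eq_card_iff_exists_minor _).mp hM
  have hN : IsUnit (M.submatrix id s).det := by
    rw [← residue_ne_zero_iff_isUnit, RingHom.map_det]
    rw [← det_transpose] at hs
    exact hs
  -- the right inverse of `M` supported on the rows of an invertible maximal minor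
  let X : Matrix κ ι R := (1 : Matrix κ κ R).submatrix id s * (M.submatrix id s)⁻¹
  have hX : M * X = 1 := by
    have h1 : M * (1 : Matrix κ κ R).submatrix id s = M.submatrix id s := by
      have := Matrix.submatrix_mul_equiv M (1 : Matrix κ κ R) id (Equiv.refl κ) s
      simpa using this
    rw [← Matrix.mul_assoc, h1, mul_nonsing_inv _ hN]
  refine ⟨fun j ↦ X.col j, fun i j ↦ ?_⟩
  have h2 := congrFun (congrFun hX i) j
  rw [Matrix.one_apply] at h2
  rw [← h2]
  exact toBilin'_apply_col J (of e)ᵀ X i j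

open IsLocalRing in
/-- The orthogonal complement of fewer than half of the hyperbolic planes of a symplectic space
contains another hyperbolic plane. -/
lemma exists_hyperbolic_pair [Fintype ι] [DecidableEq ι] (hJ : IsUnit J.det)
    (hB : (toBilin' J).IsAlt)
    (hcard : 2 * Fintype.card ι < Fintype.card κ) {e x : ι → κ → R}
    (he : ∀ i j, toBilin' J (e i) (e j) = 0) (hx : ∀ i j, toBilin' J (x i) (x j) = 0)
    (hex : ∀ i j, toBilin' J (e i) (x j) = if i = j then 1 else 0) :
    ∃ u w : κ → R, toBilin' J u w = 1 ∧ (∀ i, toBilin' J (e i) u = 0) ∧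
      (∀ i, toBilin' J (e i) w = 0) ∧ (∀ i, toBilin' J (x i) u = 0) ∧
      ∀ i, toBilin' J (x i) w = 0 := by
  let B := toBilin' J
  have hxe (i j) : B (x j) (e i) = if i = j then -1 else 0 := by
    rw [← hB.neg_eq, hex]; split_ifs <;> simp
  -- the projection to the orthogonal complement
  let π (z : κ → R) : κ → R := z + ∑ i, B (x i) z • e i - ∑ i, B (e i) z • x i
  have hπe (i) (z) : B (e i) (π z) = 0 := by
    simp [π, B, he, hex]
  have hπx (i) (z) : B (x i) (π z) = 0 := by
    simp only [π, map_sub, map_add, map_sum, map_smul, hxe]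
    simp [B, hx]
  have hππ (z z') : B (π z) z' = B (π z) (π z') := by
    conv_rhs => arg 2; simp only [π]
    have h1 (i) : B (π z) (e i) = 0 := by rw [← hB.neg_eq, hπe, neg_zero]
    have h2 (i) : B (π z) (x i) = 0 := by rw [← hB.neg_eq, hπx, neg_zero]
    simp only [map_sub, map_add, map_sum, map_smul, h1, h2]
    simp
  obtain ⟨z, z', hu⟩ : ∃ z z', IsUnit (B (π z) (π z')) := by
    -- otherwise the image of `π` vanishes modulo the maximal ideal, so that the vectors `e i` and
    -- `x i` span, against the count of dimensions
    by_contra! hne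
    have hm (z z') : residue R (B (π z) z') = 0 := by
      rw [hππ, residue_eq_zero_iff]
      exact hne z z'
    have hm' (z k) : residue R (π z k) = 0 := by
      have h1 : π z = (π z ᵥ* J) ᵥ* J⁻¹ := by
        rw [vecMul_vecMul, mul_nonsing_inv _ hJ, vecMul_one]
      have h2 (l) : residue R ((π z ᵥ* J) l) = 0 := by
        have := hm z (Pi.single l 1)
        rw [show B = toBilin' J from rfl, toBilin'_apply', dotProduct_mulVec,
          dotProduct_single_one] at this
        exact this
      rw [h1, vecMul, dotProduct, map_sum]
      exact Finset.sum_eq_zero fun l _ ↦ by rw [map_mul, h2, zero_mul]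
    let v : ι ⊕ ι → κ → ResidueField R :=
      Sum.elim (fun i ↦ residue R ∘ e i) (fun i ↦ residue R ∘ x i)
    have hspan : ⊤ ≤ Submodule.span (ResidueField R) (Set.range v) := by
      rintro y -
      choose z hz using fun k ↦ residue_surjective (y k)
      have h3 : y = -(∑ i, residue R (B (x i) z) • v (.inl i)) +
          ∑ i, residue R (B (e i) z) • v (.inr i) := by
        funext k
        have := hm' z k
        simp only [π, Pi.sub_apply, Pi.add_apply, Finset.sum_apply, Pi.smul_apply, map_sub, map_add,
          map_sum, smul_eq_mul, map_mul, hz] at this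
        simp only [v, Pi.add_apply, Pi.neg_apply, Finset.sum_apply, Pi.smul_apply, Sum.elim_inl,
          Sum.elim_inr, Function.comp_apply, smul_eq_mul]
        linear_combination this
      rw [h3]
      refine Submodule.add_mem _ (Submodule.neg_mem _ ?_) ?_ <;>
        exact Submodule.sum_mem _ fun i _ ↦ Submodule.smul_mem _ _ (Submodule.subset_span ⟨_, rfl⟩)
    have h4 := finrank_range_le_card (R := ResidueField R) v
    rw [Set.finrank, top_le_iff.mp hspan, finrank_top, Module.finrank_fintype_fun_eq_card,
      Fintype.card_sum] at h4
    omega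
  obtain ⟨c, hc⟩ := hu.exists_right_inv
  refine ⟨π z, c • π z', ?_, fun i ↦ hπe i z, fun i ↦ ?_, fun i ↦ hπx i z, fun i ↦ ?_⟩
  · rw [map_smul, smul_eq_mul, mul_comm]; exact hc
  · rw [map_smul]; exact (congrArg _ (hπe i z')).trans (smul_zero c)
  · rw [map_smul]; exact (congrArg _ (hπx i z')).trans (smul_zero c)

/-- If the rank of a matrix over a field is one less than maximal, then deleting a column that
occurs in a linear relation leaves independent columns. -/
lemma linearIndependent_col_of_rank_add_one [Fintype ι] [DecidableEq ι] {k : Type*} [Field k]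
    {A : Matrix κ ι k} (hrank : A.rank + 1 = Fintype.card ι) :
    ∃ (v : ι → k) (o : ι), A *ᵥ v = 0 ∧ v o ≠ 0 ∧
      LinearIndependent k fun i : {i // i ≠ o} ↦ A.col i.1 := by
  obtain ⟨v, hv, hv0⟩ : ∃ v : ι → k, A *ᵥ v = 0 ∧ v ≠ 0 := by
    by_contra! h
    have h1 : LinearMap.ker A.mulVecLin = ⊥ := LinearMap.ker_eq_bot'.mpr h
    have h2 := A.mulVecLin.finrank_range_add_finrank_ker
    rw [h1, finrank_bot, Module.finrank_fintype_fun_eq_card] at h2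
    change A.rank + 0 = _ at h2
    omega
  obtain ⟨o, ho⟩ := Function.ne_iff.mp hv0
  refine ⟨v, o, hv, ho, ?_⟩
  have hspan : Submodule.span k (Set.range fun i : {i // i ≠ o} ↦ A.col i.1) =
      Submodule.span k (Set.range A.col) := by
    refine le_antisymm (Submodule.span_mono (by rintro _ ⟨i, rfl⟩; exact ⟨i.1, rfl⟩)) ?_
    rw [Submodule.span_le]
    rintro _ ⟨i, rfl⟩
    by_cases hi : i = o
    · subst hi
      have h1 : v i • A.col i = -∑ j ∈ Finset.univ.erase i, v j • A.col j := by
        rw [eq_neg_iff_add_eq_zero, Finset.add_sum_erase _ (fun j ↦ v j • A.col j)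
          (Finset.mem_univ i), ← hv]
        funext l
        simp [mulVec, dotProduct, mul_comm]
      have h2 : A.col i = (v i)⁻¹ • -∑ j ∈ Finset.univ.erase i, v j • A.col j := by
        rw [← h1, smul_smul, inv_mul_cancel₀ ho, one_smul]
      rw [h2]
      exact Submodule.smul_mem _ _ (Submodule.neg_mem _ (Submodule.sum_mem _ fun j hj ↦
        Submodule.smul_mem _ _ (Submodule.subset_span ⟨⟨j, Finset.ne_of_mem_erase hj⟩, rfl⟩)))
    · exact Submodule.subset_span ⟨⟨i, hi⟩, rfl⟩
  rw [linearIndependent_iff_card_eq_finrank_span, Set.finrank, hspan, ← rank_eq_finrank_span_cols]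
  have h3 : Fintype.card {i // i ≠ o} = Fintype.card ι - 1 := by
    simp [Fintype.card_subtype_compl]
  omega

open IsLocalRing in
/-- An isotropic family of corank one that is independent modulo the maximal ideal is part of a
symplectic basis. -/
lemma exists_symplectic_basis [Fintype ι] [LinearOrder ι]
    (hcard : Fintype.card κ = 2 * Fintype.card ι) (hJ : IsUnit J.det) (hB : (toBilin' J).IsAlt)
    {o : ι} {e : {i // i ≠ o} → κ → R} (he : ∀ i j, toBilin' J (e i) (e j) = 0)
    (hli : LinearIndependent (ResidueField R) fun i ↦ residue R ∘ e i) :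
    ∃ Q : Matrix κ (ι ⊕ ι) R, Qᵀ * J * Q = fromBlocks 0 1 (-1) 0 ∧
      ∀ i, Q.col (.inl i.1) = e i := by
  obtain ⟨x₀, hx₀⟩ := exists_dual_family hJ e hli
  obtain ⟨x, hex, hxx⟩ := exists_isotropic_dual_family hB he hx₀
  obtain ⟨u, w, huw, heu, hew, hxu, hxw⟩ := exists_hyperbolic_pair hJ hB (by
    have h3 : Fintype.card {i // i ≠ o} = Fintype.card ι - 1 := by
      simp [Fintype.card_subtype_compl]
    have h4 : 0 < Fintype.card ι := Fintype.card_pos_iff.mpr ⟨o⟩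
    omega) he hxx hex
  have hswap {s t : κ → R} {c : R} (h : toBilin' J s t = c) : toBilin' J t s = -c := by
    rw [← h, hB.neg_eq]
  let q : ι ⊕ ι → κ → R := Sum.elim (fun i ↦ if h : i = o then u else e ⟨i, h⟩)
    (fun i ↦ if h : i = o then w else x ⟨i, h⟩)
  have hqlo : q (.inl o) = u := by simp [q]
  have hqro : q (.inr o) = w := by simp [q]
  have hql {i} (h : i ≠ o) : q (.inl i) = e ⟨i, h⟩ := by simp [q, h]
  have hqr {i} (h : i ≠ o) : q (.inr i) = x ⟨i, h⟩ := by simp [q, h]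
  have hee (i j) : toBilin' J (q (.inl i)) (q (.inl j)) = 0 := by
    by_cases hi : i = o <;> by_cases hj : j = o
    · subst hi hj; exact hB.self_eq_zero _
    · subst hi; rw [hqlo, hql hj, hswap (heu _), neg_zero]
    · subst hj; rw [hqlo, hql hi, heu]
    · rw [hql hi, hql hj]; exact he _ _
  have hrr (i j) : toBilin' J (q (.inr i)) (q (.inr j)) = 0 := by
    by_cases hi : i = o <;> by_cases hj : j = o
    · subst hi hj; exact hB.self_eq_zero _
    · subst hi; rw [hqro, hqr hj, hswap (hxw _), neg_zero]
    · subst hj; rw [hqro, hqr hi, hxw]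
    · rw [hqr hi, hqr hj, hxx]
  have her (i j) : toBilin' J (q (.inl i)) (q (.inr j)) = if i = j then 1 else 0 := by
    by_cases hi : i = o <;> by_cases hj : j = o
    · subst hi hj; rw [hqlo, hqro, huw, if_pos rfl]
    · subst hi; rw [hqlo, hqr hj, hswap (hxu _), neg_zero, if_neg (Ne.symm hj)]
    · subst hj; rw [hqro, hql hi, hew, if_neg hi]
    · rw [hql hi, hqr hj, hex]; simp
  refine ⟨(of q)ᵀ, ?_, fun i ↦ hql i.2⟩
  ext i j
  rw [← toBilin'_apply_col]
  change toBilin' J (q i) (q j) = _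
  rcases i with i | i <;> rcases j with j | j
  · rw [hee]; rfl
  · rw [her]; simp [Matrix.one_apply]
  · rw [hswap (her _ _)]; simp [Matrix.one_apply, eq_comm]
  · rw [hrr]; rfl

open IsLocalRing in
/-- Let `A` be the matrix of a Lagrangian morphism over a local ring, for the alternating form with
Gram matrix `J`, and assume that the rank of `A` at the closed point is one less than maximal. Then
there are a basis `P` of the source and a symplectic basis `Q` of the target such that `A` maps the
basis vectors other than the one with index `o` to basis vectors, and that one into a hyperbolic
plane. -/
theorem exists_adapted_bases [Fintype ι] [LinearOrder ι]
    (hcard : Fintype.card κ = 2 * Fintype.card ι) (hJ : IsUnit J.det) (hB : (toBilin' J).IsAlt)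
    (A : Matrix κ ι R) (hA : Aᵀ * J * A = 0)
    (hrank : (A.map (residue R)).rank + 1 = Fintype.card ι) :
    ∃ (o : ι) (P : Matrix ι ι R) (Q : Matrix κ (ι ⊕ ι) R) (a b : R), IsUnit P.det ∧
      Qᵀ * J * Q = fromBlocks 0 1 (-1) 0 ∧
      ∀ i, (A * P).col i =
        if i = o then a • Q.col (.inl o) + b • Q.col (.inr o) else Q.col (.inl i) := by
  obtain ⟨vk, o, -, ho, hli⟩ := linearIndependent_col_of_rank_add_one hrank
  choose v hv using fun i ↦ residue_surjective (vk i)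
  have hvo : IsUnit (v o) := by
    rw [← residue_ne_zero_iff_isUnit, hv]
    exact ho
  have hAA (i j) : toBilin' J (A.col i) (A.col j) = 0 := by
    rw [toBilin'_apply_col, hA]; rfl
  obtain ⟨Q, hQ, hQe⟩ := exists_symplectic_basis hcard hJ hB (fun i j ↦ hAA i.1 j.1) hli
  have hQe' {i} (h : i ≠ o) : Q.col (.inl i) = A.col i := hQe ⟨i, h⟩
  have hG (i j) : toBilin' J (Q.col i) (Q.col j) = fromBlocks 0 1 (-1) 0 i j := by
    rw [toBilin'_apply_col, hQ]
  -- `A v` is orthogonal to all `Q (inl j)` but need not be to the `Q (inr j)` with `j ≠ o`; adding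
  -- the columns `s j • A e_j` corrects this
  let s (i : ι) : R := if i = o then 0 else toBilin' J (Q.col (.inr i)) (A *ᵥ v)
  let c : ι → R := v + s
  let P : Matrix ι ι R := (1 : Matrix ι ι R).updateCol o c
  have hP : IsUnit P.det := by
    have : P.det = c o := by
      change ((1 : Matrix ι ι R).updateCol o c).det = c o
      rw [← cramer_apply, cramer_one]; rfl
    rw [this]
    simpa [c, s] using hvo
  have hAP (i) : (A * P).col i = A *ᵥ P.col i := rfl
  have hPi {i} (hi : i ≠ o) : P.col i = Pi.single i 1 := by
    funext j
    simp [P, hi, Matrix.one_apply, Pi.single_apply]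
  have hPo : P.col o = c := by
    funext j
    simp [P]
  have hA0 (i j) : toBilin' J (A.col i) (A *ᵥ j) = 0 := by
    rw [mulVec_eq_sum, map_sum]
    refine Finset.sum_eq_zero fun l _ ↦ ?_
    rw [op_smul_eq_smul, map_smul, smul_eq_mul]
    exact (congrArg _ (hAA i l)).trans (mul_zero _)
  have hAs : A *ᵥ c = A *ᵥ v + ∑ i, s i • A.col i := by
    rw [mulVec_add]
    congr 1
    rw [mulVec_eq_sum]
    simp [op_smul_eq_smul]
    rfl
  refine ⟨o, P, Q, -toBilin' J (Q.col (.inr o)) (A *ᵥ c), toBilin' J (Q.col (.inl o)) (A *ᵥ c), hP,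
    hQ, fun i ↦ ?_⟩
  rw [hAP]
  split_ifs with hi
  · subst hi
    rw [hPo, ← sub_eq_zero]
    refine eq_zero_of_orthogonal_symplectic_basis hcard hQ fun j ↦ ?_
    rw [map_sub, map_add, map_smul, map_smul, hG, hG]
    rcases j with j | j
    · by_cases hj : j = i
      · subst hj; simp
      · rw [hQe' hj, hA0]; simp [hj]
    · by_cases hj : j = i
      · subst hj; simp
      · have h1 : toBilin' J (Q.col (.inr j)) (A *ᵥ c) = 0 := by
          rw [hAs, map_add, map_sum]
          have h2 (l) : toBilin' J (Q.col (.inr j)) (s l • A.col l) =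
              if l = j then -s j else 0 := by
            by_cases hl : l = i
            · subst hl; simp [s, Ne.symm hj]
            · rw [map_smul, ← hQe' hl, hG]
              by_cases hlj : l = j
              · subst hlj; simp
              · simp [hlj, Ne.symm hlj]
          simp only [h2]
          simp [s, hj]
        rw [h1]
        simp [hj]
  · rw [hPi hi, hQe' hi]
    simp

end Adapted

/-! ### Normality of smooth algebras -/

section Normal

open TensorProduct nonZeroDivisors

/-- A domain that is étale over a normal domain is normal, since the formation of the integral
closure commutes with smooth base change. -/
lemma isIntegrallyClosed_of_etale (R S : Type*) [CommRing R] [IsDomain R] [IsIntegrallyClosed R]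
    [CommRing S] [IsDomain S] [Algebra R S] [Algebra.Etale R S] : IsIntegrallyClosed S := by
  let K := FractionRing R
  let L := S ⊗[R] K
  let M := Algebra.algebraMapSubmonoid S R⁰
  have hinj : Function.Injective (algebraMap R S) := by
    have : Module.IsTorsionFree R S := inferInstance
    exact FaithfulSMul.algebraMap_injective R S
  have hM : M ≤ S⁰ := by
    rintro _ ⟨r, hr, rfl⟩
    exact mem_nonZeroDivisors_iff_ne_zero.mpr ((map_ne_zero_iff _ hinj).mpr
      (nonZeroDivisors.ne_zero hr))
  have : IsLocalization M L := inferInstance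
  have : IsDomain L := IsLocalization.isDomain_of_le_nonZeroDivisors L hM
  -- `L` is a domain, finite over the field `K`
  have hfield : IsField L := by
    have e : L ≃+* K ⊗[R] S := (Algebra.TensorProduct.comm R S K).toRingEquiv
    have : IsDomain (K ⊗[R] S) := e.symm.toMulEquiv.isDomain L
    have : Module.Finite K (K ⊗[R] S) := Algebra.FormallyUnramified.finite_of_free _ _
    have h := isField_of_isIntegral_of_isField' (R := K) (S := K ⊗[R] S) (Field.toIsField K)
    exact e.toMulEquiv.isField h
  have : IsFractionRing S L := IsLocalization.of_le M _ hM fun r hr ↦ by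
    have h0 : algebraMap S L r ≠ 0 :=
      (map_ne_zero_iff _ (IsLocalization.injective L hM)).mpr (nonZeroDivisors.ne_zero hr)
    obtain ⟨b, hb⟩ := hfield.mul_inv_cancel h0
    exact .of_mul_eq_one b hb
  rw [isIntegrallyClosed_iff L]
  intro x hx
  obtain ⟨t, ht⟩ :=
    (TensorProduct.toIntegralClosure_bijective_of_smooth (R := R) (S := S) (B := K)).2 ⟨x, hx⟩
  have key (t : S ⊗[R] integralClosure R K) :
      ∃ y : S, algebraMap S L y = (TensorProduct.toIntegralClosure R S K t).1 := by
    induction t with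
    | zero => exact ⟨0, by simp⟩
    | add a b ha hb =>
      obtain ⟨a', ha'⟩ := ha
      obtain ⟨b', hb'⟩ := hb
      exact ⟨a' + b', by simp [ha', hb']⟩
    | tmul s z =>
      obtain ⟨z, hz⟩ := z
      obtain ⟨r, rfl⟩ := IsIntegrallyClosed.isIntegral_iff.mp hz
      refine ⟨s * algebraMap R S r, ?_⟩
      change (s * algebraMap R S r) ⊗ₜ[R] (1 : K) = s ⊗ₜ algebraMap R K r
      rw [mul_comm, ← Algebra.smul_def, smul_tmul, Algebra.algebraMap_eq_smul_one]
  obtain ⟨y, hy⟩ := key t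
  exact ⟨y, by rw [hy, ht]⟩

/-- A smooth algebra over a field that is a domain is normal after inverting an element that avoids
a given prime: locally it is étale over a polynomial ring. -/
lemma exists_isIntegrallyClosed_away (k S : Type*) [Field k] [CommRing S] [IsDomain S] [Algebra k S]
    [Algebra.Smooth k S] (p : Ideal S) [p.IsPrime] :
    ∃ f ∉ p, IsIntegrallyClosed (Localization.Away f) := by
  obtain ⟨f, hf, n, i, -, _⟩ :=
    Algebra.IsSmoothAt.exists_isStandardEtale_mvPolynomial (R := k) (p := p)
  have h0 : f ≠ 0 := by rintro rfl; exact hf p.zero_mem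
  have : IsDomain (Localization.Away f) :=
    IsLocalization.isDomain_localization (powers_le_nonZeroDivisors_of_noZeroDivisors h0)
  have : Algebra.Etale (MvPolynomial (Fin n) k) (Localization.Away f) := inferInstance
  exact ⟨f, hf, isIntegrallyClosed_of_etale (MvPolynomial (Fin n) k) _⟩

/-- A smooth algebra over a field that is a domain is normal. -/
lemma isIntegrallyClosed_of_smooth (k S : Type*) [Field k] [CommRing S] [IsDomain S] [Algebra k S]
    [Algebra.Smooth k S] : IsIntegrallyClosed S := by
  let K := FractionRing S
  rw [isIntegrallyClosed_iff K]
  intro x hx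
  -- the ideal of denominators of `x`
  let D : Ideal S :=
    (LinearMap.range (Algebra.linearMap S K)).comap (LinearMap.toSpanSingleton S K x)
  have hD (s : S) : s ∈ D ↔ ∃ y : S, algebraMap S K y = s • x := Iff.rfl
  have htop : D = ⊤ := by
    by_contra hne
    obtain ⟨p, hp, hDp⟩ := D.exists_le_maximal hne
    obtain ⟨f, hf, hcl⟩ := exists_isIntegrallyClosed_away k S p
    have h0 : f ≠ 0 := by rintro rfl; exact hf p.zero_mem
    have hM : Submonoid.powers f ≤ S⁰ := powers_le_nonZeroDivisors_of_noZeroDivisors h0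
    have := IsLocalization.isDomain_localization hM
    let := IsLocalization.localizationAlgebraOfSubmonoidLe (Localization.Away f) K _ _ hM
    have := IsLocalization.localization_isScalarTower_of_submonoid_le (Localization.Away f) K _ _ hM
    have : IsFractionRing (Localization.Away f) K :=
      IsFractionRing.isFractionRing_of_isLocalization (Submonoid.powers f) _ _ hM
    obtain ⟨y, hy⟩ := (isIntegrallyClosed_iff K).mp hcl (hx.tower_top (A := Localization.Away f))
    obtain ⟨n, z, hz⟩ := IsLocalization.Away.surj f y
    have hfD : f ^ n ∈ D := (hD _).mpr ⟨z, by
      rw [IsScalarTower.algebraMap_apply S (Localization.Away f) K, ← hz, map_mul, hy,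
        ← map_pow, ← IsScalarTower.algebraMap_apply, Algebra.smul_def, mul_comm]⟩
    exact hf (hp.isPrime.mem_of_pow_mem n (hDp hfD))
  have := (hD 1).mp (htop ▸ Submodule.mem_top)
  simpa using this

end Normal

/-! ### Sections and morphisms of sheaves of modules -/

section Sections

variable {X : Scheme.{u}}

lemma section_ext (M : X.Modules) {U : X.Opens} {s t : Γ(M, U)}
    (h : ∀ x ∈ U, ∃ (V : X.Opens) (hV : V ≤ U), x ∈ V ∧ res M hV s = res M hV t) : s = t := by
  let M' : TopCat.Sheaf Ab.{u} X := ⟨M.presheaf, M.isSheaf⟩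
  choose V hV hx he using fun x : U ↦ h x.1 x.2
  exact M'.eq_of_locally_eq' V U (fun i ↦ homOfLE (hV i))
    (fun x hx' ↦ Opens.mem_iSup.mpr ⟨⟨x, hx'⟩, hx _⟩) s t fun i ↦ he i

/-- A section that is determined locally by a property exists globally. -/
lemma exists_section_of_locally (M : X.Modules) {U : X.Opens}
    (P : ∀ V : X.Opens, Γ(M, V) → Prop)
    (hres : ∀ (V W : X.Opens) (h : W ≤ V) (s : Γ(M, V)), P V s → P W (res M h s))
    (huniq : ∀ (V : X.Opens) (s t : Γ(M, V)), V ≤ U → P V s → P V t → s = t)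
    (hex : ∀ x ∈ U, ∃ V : X.Opens, x ∈ V ∧ V ≤ U ∧ ∃ s, P V s) :
    ∃ s : Γ(M, U), ∀ (V : X.Opens) (h : V ≤ U) (t : Γ(M, V)), P V t → res M h s = t := by
  let M' : TopCat.Sheaf Ab.{u} X := ⟨M.presheaf, M.isSheaf⟩
  choose V hx hV s hs using fun x : U ↦ hex x.1 x.2
  obtain ⟨s', hs', -⟩ := M'.existsUnique_gluing' V U (fun i ↦ homOfLE (hV i))
    (fun x hx' ↦ Opens.mem_iSup.mpr ⟨⟨x, hx'⟩, hx _⟩) s fun i j ↦ by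
      change res M inf_le_left _ = res M inf_le_right _
      exact huniq _ _ _ (inf_le_left.trans (hV i)) (hres _ _ _ _ (hs i)) (hres _ _ _ _ (hs j))
  refine ⟨s', fun W h t ht ↦ section_ext M fun x hxW ↦
    ⟨W ⊓ V ⟨x, h hxW⟩, inf_le_left, ⟨hxW, hx _⟩, ?_⟩⟩
  refine huniq _ _ _ (inf_le_left.trans h) ?_ (hres _ _ _ _ ht)
  have : res M (hV ⟨x, h hxW⟩) s' = s ⟨x, h hxW⟩ := hs' _
  rw [res_res, ← res_res M (hV ⟨x, h hxW⟩) inf_le_right, this]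
  exact hres _ _ _ _ (hs _)

lemma section_eq_zero_of_eq_bot (M : X.Modules) {U : X.Opens} (hU : U = ⊥) (s : Γ(M, U)) :
    s = 0 :=
  section_ext M fun x hx ↦ by simp [hU] at hx

/-- A morphism of `𝒪_X`-modules given by compatible linear maps on sections. -/
def mkHom {M N : X.Modules} (f : ∀ V : X.Opens, Γ(M, V) →ₗ[Γ(X, V)] Γ(N, V))
    (hf : ∀ (V W : X.Opens) (h : W ≤ V) (m : Γ(M, V)), f W (res M h m) = res N h (f V m)) :
    M ⟶ N where
  val := PresheafOfModules.homMk (M₁ := M.val) (M₂ := N.val)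
    { app := fun V ↦ AddCommGrpCat.ofHom (f V.unop).toAddMonoidHom
      naturality := fun V W h ↦ by
        ext m
        exact hf V.unop W.unop (leOfHom h.unop) m }
    fun V r m ↦ (f V.unop).map_smul r m

lemma hom_ext_sections {M N : X.Modules} {f g : M ⟶ N}
    (h : ∀ (V : X.Opens) (m : Γ(M, V)), f.app V m = g.app V m) : f = g :=
  Scheme.Modules.hom_ext _ _ fun V ↦ by ext m; exact h V m

lemma injective_app_of_locally {M N : X.Modules} (f : M ⟶ N)
    (h : ∀ x : X, ∃ U : X.Opens, x ∈ U ∧ ∀ V ≤ U, Function.Injective (f.app V))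
    (V : X.Opens) : Function.Injective (f.app V) := by
  intro s t hst
  refine section_ext M fun x hx ↦ ?_
  obtain ⟨U, hxU, hU⟩ := h x
  refine ⟨V ⊓ U, inf_le_left, ⟨hx, hxU⟩, hU _ inf_le_right ?_⟩
  rw [app_res, app_res, hst]

lemma mono_of_injective_app {M N : X.Modules} (f : M ⟶ N)
    (h : ∀ V : X.Opens, Function.Injective (f.app V)) : Mono f where
  right_cancellation g₁ g₂ hg := hom_ext_sections fun V m ↦ h V (by
    have := congrArg (fun k ↦ Scheme.Modules.Hom.app k V) hg
    exact CategoryTheory.congr_fun this m)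

/-- A morphism that is injective and locally surjective on sections is an isomorphism. -/
lemma isIso_of_locally_bijective {M N : X.Modules} (f : M ⟶ N)
    (hinj : ∀ x : X, ∃ U : X.Opens, x ∈ U ∧ ∀ V ≤ U, Function.Injective (f.app V))
    (hsurj : ∀ (V : X.Opens) (t : Γ(N, V)), ∀ x ∈ V, ∃ (W : X.Opens) (h : W ≤ V),
      x ∈ W ∧ ∃ s : Γ(M, W), f.app W s = res N h t) : IsIso f := by
  have hinj' := injective_app_of_locally f hinj
  rw [Scheme.Modules.Hom.isIso_iff_isIso_app]
  intro V
  rw [ConcreteCategory.isIso_iff_bijective]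
  refine ⟨hinj' V, fun t ↦ ?_⟩
  obtain ⟨s, hs⟩ := exists_section_of_locally M (U := V)
    (fun W s ↦ ∃ h : W ≤ V, f.app W s = res N h t)
    (fun W W' h s ⟨hW, hs⟩ ↦ ⟨h.trans hW, by rw [app_res, hs, res_res]⟩)
    (fun W s s' hW ⟨_, h⟩ ⟨_, h'⟩ ↦ hinj' W (h.trans h'.symm))
    (fun x hx ↦ by
      obtain ⟨W, h, hxW, s, hs⟩ := hsurj V t x hx
      exact ⟨W, hxW, h, s, h, hs⟩)
  refine ⟨s, section_ext N fun x hx ↦ ?_⟩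
  obtain ⟨W, h, hxW, s', hs'⟩ := hsurj V t x hx
  refine ⟨W, h, hxW, ?_⟩
  rw [← app_res, hs W h s' ⟨h, hs'⟩, hs']

lemma injective_app_of_mono {M N : X.Modules} (f : M ⟶ N) [Mono f] (V : X.Opens) :
    Function.Injective (f.app V) := by
  have h1 : Mono (f.mapPresheaf) := inferInstanceAs (Mono ((Scheme.Modules.toPresheaf X).map f))
  have h2 : Mono (f.mapPresheaf.app (op V)) := inferInstance
  exact (AddCommGrpCat.mono_iff_injective _).mp h2

end Sections

/-! ### Associated sheaves and exactness -/

section Sheafification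

variable {X : Scheme.{u}}

/-- The sheaf of `𝒪_X`-modules associated with a presheaf of modules. -/
abbrev assocSheaf (P : PresheafOfModules.{u} X.ringCatSheaf.obj) : X.Modules :=
  (PresheafOfModules.sheafification (𝟙 X.ringCatSheaf.obj)).obj P

/-- The canonical map from sections of a presheaf of modules to sections of the associated
sheaf. -/
def toAssoc (P : PresheafOfModules.{u} X.ringCatSheaf.obj) (V : X.Opens) :
    P.presheaf.obj (op V) →+ Γ(assocSheaf P, V) :=
  (((PresheafOfModules.toPresheaf _).map
    ((PresheafOfModules.sheafificationAdjunction (𝟙 X.ringCatSheaf.obj)).unit.app P)).app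
      (op V)).hom

lemma toAssoc_locally_surjective (P : PresheafOfModules.{u} X.ringCatSheaf.obj) (V : X.Opens)
    (t : Γ(assocSheaf P, V)) (x : X) (hx : x ∈ V) : ∃ (W : X.Opens) (h : W ≤ V),
      x ∈ W ∧ ∃ s, toAssoc P W s = res (assocSheaf P) h t := by
  have h1 : Presheaf.IsLocallySurjective (Opens.grothendieckTopology X)
      (CategoryTheory.toSheafify (Opens.grothendieckTopology X) P.presheaf) := inferInstance
  have h2 := Presheaf.imageSieve_mem (Opens.grothendieckTopology X)
    (CategoryTheory.toSheafify (Opens.grothendieckTopology X) P.presheaf) (U := op V) t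
  obtain ⟨W, i, ⟨s, hs⟩, hxW⟩ := h2 x hx
  exact ⟨W, leOfHom i, hxW, s, hs⟩

/-- The morphism from the associated sheaf induced by a morphism of presheaves. -/
def assocDesc {P : PresheafOfModules.{u} X.ringCatSheaf.obj} {N : X.Modules}
    (f : P ⟶ N.val) : assocSheaf P ⟶ N :=
  ((PresheafOfModules.sheafificationAdjunction (𝟙 X.ringCatSheaf.obj)).homEquiv P N).symm f

lemma assocDesc_toAssoc {P : PresheafOfModules.{u} X.ringCatSheaf.obj} {N : X.Modules}
    (f : P ⟶ N.val) (V : X.Opens) (s : P.presheaf.obj (op V)) :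
    (assocDesc f).app V (toAssoc P V s) =
      ((PresheafOfModules.toPresheaf _).map f).app (op V) s := by
  have h := ((PresheafOfModules.sheafificationAdjunction
    (𝟙 X.ringCatSheaf.obj)).homEquiv P N).apply_symm_apply f
  erw [Adjunction.homEquiv_unit] at h
  exact CategoryTheory.congr_fun
    (congrArg (fun k ↦ ((PresheafOfModules.toPresheaf _).map k).app (op V)) h) s

/-- An epimorphism of sheaves of modules is locally surjective on sections: the sheaf associated
with the image presheaf is the whole target. -/
lemma locally_surjective_of_epi {M N : X.Modules} (f : M ⟶ N) [Epi f] (V : X.Opens)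
    (t : Γ(N, V)) (x : X) (hx : x ∈ V) : ∃ (W : X.Opens) (h : W ≤ V),
      x ∈ W ∧ ∃ s : Γ(M, W), f.app W s = res N h t := by
  let f0 : M.val ⟶ N.val := f.val
  let P := Limits.image f0
  let e : M.val ⟶ P := Limits.factorThruImage f0
  let j : P ⟶ N.val := Limits.image.ι f0
  have hje : e ≫ j = f0 := Limits.image.fac f0
  let g : assocSheaf P ⟶ N := assocDesc j
  let e' : M ⟶ assocSheaf P :=
    ⟨e ≫ (PresheafOfModules.sheafificationAdjunction (𝟙 X.ringCatSheaf.obj)).unit.app P⟩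
  have hg : e' ≫ g = f := hom_ext_sections fun W m ↦ by
    refine (assocDesc_toAssoc j W (e.app (op W) m)).trans ?_
    exact CategoryTheory.congr_fun
      (congrArg (fun k ↦ ((PresheafOfModules.toPresheaf _).map k).app (op W)) hje) m
  have hepi : Epi g := epi_of_epi_fac hg
  have hinj : ∀ W : X.Opens, Function.Injective (g.app W) := fun W ↦ by
    refine (injective_iff_map_eq_zero _).mpr fun s hs ↦ section_ext _ fun y hy ↦ ?_
    obtain ⟨W', h, hyW', u, hu⟩ := toAssoc_locally_surjective P W s y hy
    refine ⟨W', h, hyW', ?_⟩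
    have h1 : ((PresheafOfModules.toPresheaf _).map j).app (op W') u = 0 := by
      rw [← assocDesc_toAssoc, hu]
      exact (app_res g h s).trans (by rw [hs, map_zero]; rfl)
    have h2 : u = 0 := PresheafOfModules.injective_of_mono j (op W') (h1.trans (map_zero _).symm)
    rw [← hu, h2, map_zero, map_zero]
  have hmono : Mono g := mono_of_injective_app g hinj
  have hiso : IsIso g := isIso_of_mono_of_epi g
  obtain ⟨s, hs⟩ := ((ConcreteCategory.isIso_iff_bijective (g.app V)).mp inferInstance).2 t
  obtain ⟨W, h, hxW, u, hu⟩ := toAssoc_locally_surjective P V s x hx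
  obtain ⟨m, hm⟩ := PresheafOfModules.surjective_of_epi e (op W) u
  refine ⟨W, h, hxW, m, ?_⟩
  rw [← hs, ← app_res, ← hu, ← hm, ← hg]
  rfl

end Sheafification

section Exactness

variable {X : Scheme.{u}}

/-- A sequence that is left exact on sections is exact. -/
lemma exact_of_sections {M N P : X.Modules} (f : M ⟶ N) (g : N ⟶ P) (w : f ≫ g = 0)
    (hf : ∀ V, Function.Injective (f.app V))
    (h : ∀ (V : X.Opens) (s : Γ(N, V)), g.app V s = 0 → ∃ m, f.app V m = s) :
    (ShortComplex.mk f g w).Exact := by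
  have hmono := mono_of_injective_app f hf
  have hk : ∀ {A : X.Modules} (k : A ⟶ N), k ≫ g = 0 → ∃ l : A ⟶ M, l ≫ f = k := by
    intro A k hk
    have hk' (V : X.Opens) (a : Γ(A, V)) : ∃ m, f.app V m = k.app V a :=
      h V _ (CategoryTheory.congr_fun (congrArg (fun k ↦ Scheme.Modules.Hom.app k V) hk) a)
    choose l hl using hk'
    refine ⟨mkHom (fun V ↦ ⟨⟨l V, fun a b ↦ hf V ?_⟩, fun r a ↦ hf V ?_⟩) fun V W i m ↦ hf W ?_,
      hom_ext_sections fun V a ↦ hl V a⟩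
    · simp [hl]
    · simp [hl]
    · change f.app W (l W _) = f.app W (res M i (l V m))
      rw [hl, app_res, app_res, hl]
  exact ShortComplex.exact_of_f_is_kernel _ (Limits.KernelFork.IsLimit.ofι f w
    (fun k hk' ↦ (hk k hk').choose) (fun k hk' ↦ (hk k hk').choose_spec)
    fun k hk' m hm ↦ by rw [← cancel_mono f, hm, (hk k hk').choose_spec])

lemma exists_kernel_app {M N : X.Modules} (g : M ⟶ N) (V : X.Opens) (s : Γ(M, V))
    (hs : g.app V s = 0) : ∃ m, (Limits.kernel.ι g).app V m = s := by
  let F := Scheme.Modules.toPresheaf X ⋙ (evaluation _ _).obj (op V)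
  have : Limits.PreservesFiniteLimits ((evaluation X.Opensᵒᵖ Ab.{u}).obj (op V)) :=
    ⟨fun J _ _ ↦ inferInstance⟩
  have : Limits.PreservesFiniteLimits F := Limits.comp_preservesFiniteLimits _ _
  have : F.Additive := Functor.additive_of_preserves_binary_products _
  have h := ((ShortComplex.mk (Limits.kernel.ι g) g (by simp)).exact_of_f_is_kernel
    (Limits.kernelIsKernel g)).map_of_mono_of_preservesKernel F inferInstance inferInstance
  exact (ShortComplex.ab_exact_iff _).mp h s hs

/-- In an exact sequence, a section that is killed is locally an image. -/
lemma exists_locally_of_exact {M N P : X.Modules} {f : M ⟶ N} {g : N ⟶ P} {w : f ≫ g = 0}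
    (hex : (ShortComplex.mk f g w).Exact) (V : X.Opens) (s : Γ(N, V)) (hs : g.app V s = 0)
    (x : X) (hx : x ∈ V) : ∃ (W : X.Opens) (h : W ≤ V),
      x ∈ W ∧ ∃ m : Γ(M, W), f.app W m = res N h s := by
  obtain ⟨k, hk⟩ := exists_kernel_app g V s hs
  have : Epi (Limits.kernel.lift g f w) := hex.epi_kernelLift
  obtain ⟨W, h, hxW, m, hm⟩ := locally_surjective_of_epi (Limits.kernel.lift g f w) V k x hx
  refine ⟨W, h, hxW, m, ?_⟩
  rw [← hk, ← app_res, ← hm]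
  exact (CategoryTheory.congr_fun (congrArg (fun k ↦ Scheme.Modules.Hom.app k W)
    (Limits.kernel.lift_ι g f w)) m).symm

end Exactness

/-! ### Sections of sheaves of homomorphisms -/

section HomEval

variable {X : Scheme.{u}}

lemma resO_self {U : X.Opens} (r : Γ(X, U)) : resO X le_rfl r = r := by
  change X.presheaf.map (𝟙 _) r = r
  simp

/-- The value on sections over `V ≤ U` of a section over `U` of `ℋom(M, N)`. -/
def homEval {M N : X.Modules} {U V : X.Opens} (f : Γ(homSheaf M N, U)) (h : V ≤ U) :
    Γ(M, V) →ₗ[Γ(X, V)] Γ(N, V) :=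
  (show homSections M N U from f).1 ⟨V, h⟩

lemma homEval_res {M N : X.Modules} {U V W : X.Opens} (f : Γ(homSheaf M N, U)) (h : V ≤ U)
    (h' : W ≤ V) : homEval (res _ h f) h' = homEval f (h'.trans h) := rfl

lemma res_homEval {M N : X.Modules} {U V W : X.Opens} (f : Γ(homSheaf M N, U)) (h : V ≤ U)
    (h' : W ≤ V) (m : Γ(M, V)) :
    res N h' (homEval f h m) = homEval f (h'.trans h) (res M h' m) :=
  ((show homSections M N U from f).2 ⟨V, h⟩ ⟨W, h'.trans h⟩ h' m).symm

lemma homEval_smul {M N : X.Modules} {U V : X.Opens} (r : Γ(X, U)) (f : Γ(homSheaf M N, U))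
    (h : V ≤ U) (m : Γ(M, V)) : homEval (r • f) h m = resO X h r • homEval f h m := rfl

/-- `homEval` as an additive function of the homomorphism. -/
def homEvalAddHom {M N : X.Modules} {U V : X.Opens} (h : V ≤ U) (m : Γ(M, V)) :
    Γ(homSheaf M N, U) →+ Γ(N, V) where
  toFun f := homEval f h m
  map_zero' := rfl
  map_add' _ _ := rfl

lemma homEval_sum {M N : X.Modules} {U V : X.Opens} {ι : Type*} (s : Finset ι)
    (f : ι → Γ(homSheaf M N, U)) (h : V ≤ U) (m : Γ(M, V)) :
    homEval (∑ i ∈ s, f i) h m = ∑ i ∈ s, homEval (f i) h m :=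
  map_sum (homEvalAddHom h m) f s

lemma homSheaf_ext {M N : X.Modules} {U : X.Opens} {f g : Γ(homSheaf M N, U)}
    (h : ∀ (V : X.Opens) (hV : V ≤ U) (m : Γ(M, V)), homEval f hV m = homEval g hV m) :
    f = g :=
  Subtype.ext (funext fun V ↦ LinearMap.ext fun m ↦ h V.1 V.2 m)

/-- A section of `ℋom(M, N)` given by compatible linear maps. -/
def mkHomSection {M N : X.Modules} {U : X.Opens}
    (f : ∀ V : X.Opens, V ≤ U → Γ(M, V) →ₗ[Γ(X, V)] Γ(N, V))
    (hf : ∀ (V W : X.Opens) (hV : V ≤ U) (h : W ≤ V) (m : Γ(M, V)),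
      f W (h.trans hV) (res M h m) = res N h (f V hV m)) : Γ(homSheaf M N, U) :=
  show homSections M N U from ⟨fun V ↦ f V.1 V.2, fun V W h m ↦ hf V.1 W.1 V.2 h m⟩

lemma homEval_mkHomSection {M N : X.Modules} {U V : X.Opens}
    (f : ∀ V : X.Opens, V ≤ U → Γ(M, V) →ₗ[Γ(X, V)] Γ(N, V))
    (hf : ∀ (V W : X.Opens) (hV : V ≤ U) (h : W ≤ V) (m : Γ(M, V)),
      f W (h.trans hV) (res M h m) = res N h (f V hV m)) (h : V ≤ U) (m : Γ(M, V)) :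
    homEval (mkHomSection f hf) h m = f V h m := rfl

/-- The value on sections over `V ≤ U` of a section over `U` of the dual of `M`. -/
def dualEvalOn {M : X.Modules} {U V : X.Opens} (l : Γ(dual M, U)) (h : V ≤ U) :
    Γ(M, V) →ₗ[Γ(X, V)] Γ(X, V) :=
  homEval (N := structureModule X) l h

lemma resO_dualEval {M : X.Modules} {U V : X.Opens} (l : Γ(dual M, U)) (h : V ≤ U)
    (m : Γ(M, U)) : resO X h (dualEval l m) = dualEval (res _ h l) (res M h m) :=
  res_homEval (N := structureModule X) l le_rfl h m

lemma dualEval_add_right {M : X.Modules} {U : X.Opens} (l : Γ(dual M, U)) (m m' : Γ(M, U)) :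
    dualEval l (m + m') = dualEval l m + dualEval l m' := map_add (dualEvalOn l le_rfl) m m'

lemma dualEval_smul_right {M : X.Modules} {U : X.Opens} (l : Γ(dual M, U)) (r : Γ(X, U))
    (m : Γ(M, U)) : dualEval l (r • m) = r * dualEval l m :=
  map_smul (dualEvalOn l le_rfl) r m

lemma dualEval_add_left {M : X.Modules} {U : X.Opens} (l l' : Γ(dual M, U)) (m : Γ(M, U)) :
    dualEval (l + l') m = dualEval l m + dualEval l' m := rfl

lemma dualEval_smul_left {M : X.Modules} {U : X.Opens} (l : Γ(dual M, U)) (r : Γ(X, U))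
    (m : Γ(M, U)) : dualEval (r • l) m = r * dualEval l m := by
  have : dualEval (r • l) m = resO X le_rfl r * dualEval l m := rfl
  rw [this, resO_self]

/-- `dualEval` as a bilinear map. -/
def dualEvalₗ (M : X.Modules) (U : X.Opens) :
    Γ(dual M, U) →ₗ[Γ(X, U)] Γ(M, U) →ₗ[Γ(X, U)] Γ(X, U) :=
  LinearMap.mk₂ _ dualEval dualEval_add_left (fun r l m ↦ dualEval_smul_left l r m)
    dualEval_add_right (fun r l m ↦ dualEval_smul_right l r m)

@[simp]
lemma dualEvalₗ_apply {M : X.Modules} {U : X.Opens} (l : Γ(dual M, U)) (m : Γ(M, U)) :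
    dualEvalₗ M U l m = dualEval l m := rfl

end HomEval

/-! ### Frames -/

section Frame

variable {X : Scheme.{u}} {ι : Type*} [Fintype ι]

/-- A family of sections of `M` over `U` is a frame if it is a basis of the sections of `M` over
every open subset of `U`. -/
def IsFrame (M : X.Modules) (U : X.Opens) (b : ι → Γ(M, U)) : Prop :=
  ∀ (V : X.Opens) (h : V ≤ U),
    Function.Bijective fun c : ι → Γ(X, V) ↦ ∑ i, c i • res M h (b i)

lemma IsFrame.restrict {M : X.Modules} {U : X.Opens} {b : ι → Γ(M, U)} (hb : IsFrame M U b)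
    {V : X.Opens} (h : V ≤ U) : IsFrame M V fun i ↦ res M h (b i) := fun W hW ↦ by
  simpa only [res_res] using hb W (hW.trans h)

lemma IsFrame.exists_coord {M : X.Modules} {U : X.Opens} {b : ι → Γ(M, U)} (hb : IsFrame M U b)
    (m : Γ(M, U)) : ∃ c : ι → Γ(X, U), ∑ i, c i • b i = m := by
  obtain ⟨c, hc⟩ := (hb U le_rfl).2 m
  exact ⟨c, by simpa only [res_self] using hc⟩

lemma IsFrame.coord_ext {M : X.Modules} {U : X.Opens} {b : ι → Γ(M, U)} (hb : IsFrame M U b)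
    {c d : ι → Γ(X, U)} (h : ∑ i, c i • b i = ∑ i, d i • b i) : c = d :=
  (hb U le_rfl).1 (by simpa only [res_self] using h)

/-- The basis of the module of sections given by a frame. -/
def IsFrame.basis {M : X.Modules} {U : X.Opens} {b : ι → Γ(M, U)} (hb : IsFrame M U b) :
    Module.Basis ι Γ(X, U) Γ(M, U) :=
  .ofEquivFun (LinearEquiv.ofBijective (Fintype.linearCombination Γ(X, U) b) ⟨fun c d h ↦
    hb.coord_ext (by simpa [Fintype.linearCombination_apply] using h), fun m ↦ by
      obtain ⟨c, hc⟩ := hb.exists_coord m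
      exact ⟨c, by simpa [Fintype.linearCombination_apply] using hc⟩⟩).symm

@[simp]
lemma IsFrame.basis_apply {M : X.Modules} {U : X.Opens} {b : ι → Γ(M, U)} (hb : IsFrame M U b)
    (i : ι) : hb.basis i = b i := by
  classical
  simp only [IsFrame.basis, Module.Basis.coe_ofEquivFun, LinearEquiv.symm_symm]
  exact (Fintype.linearCombination_apply_single _ _ _ _).trans (one_smul _ _)

lemma isFrame_of_basis {M : X.Modules} {U : X.Opens} {b : ι → Γ(M, U)}
    (h : ∀ (V : X.Opens) (h : V ≤ U), ∃ B : Module.Basis ι Γ(X, V) Γ(M, V),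
      ∀ i, B i = res M h (b i)) : IsFrame M U b := fun V hV ↦ by
  obtain ⟨B, hB⟩ := h V hV
  convert B.equivFun.symm.bijective using 2 with c
  simp [Module.Basis.equivFun_symm_apply, hB]

/-- The basis over a smaller open set. -/
abbrev IsFrame.basisOn {M : X.Modules} {U : X.Opens} {b : ι → Γ(M, U)} (hb : IsFrame M U b)
    {V : X.Opens} (h : V ≤ U) : Module.Basis ι Γ(X, V) Γ(M, V) := (hb.restrict h).basis

lemma IsFrame.basisOn_apply {M : X.Modules} {U : X.Opens} {b : ι → Γ(M, U)}
    (hb : IsFrame M U b) {V : X.Opens} (h : V ≤ U) (i : ι) :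
    hb.basisOn h i = res M h (b i) := by simp

lemma IsFrame.repr_res {M : X.Modules} {U : X.Opens} {b : ι → Γ(M, U)}
    (hb : IsFrame M U b) {V W : X.Opens} (h : V ≤ U) (h' : W ≤ V) (m : Γ(M, V)) (i : ι) :
    (hb.basisOn (h'.trans h)).repr (res M h' m) i = resO X h' ((hb.basisOn h).repr m i) := by
  have h1 : res M h' m = ∑ j, resO X h' ((hb.basisOn h).repr m j) •
      hb.basisOn (h'.trans h) j := by
    conv_lhs => rw [← (hb.basisOn h).sum_repr m]
    simp [map_sum, res_smul, res_res]
  rw [h1]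
  classical
  simp [-IsFrame.basis_apply, map_sum, Finsupp.single_apply]

/-- A homomorphism on `U` out of a module with a frame is given by the images of the frame. -/
lemma IsFrame.exists_hom {M N : X.Modules} {U : X.Opens} {b : ι → Γ(M, U)}
    (hb : IsFrame M U b) (n : ι → Γ(N, U)) :
    ∃ f : Γ(homSheaf M N, U), ∀ i, homEval f le_rfl (b i) = n i := by
  refine ⟨mkHomSection (fun V hV ↦ (hb.basisOn hV).constr Γ(X, V) fun i ↦ res N hV (n i))
    fun V W hV h m ↦ ?_, fun i ↦ ?_⟩
  · simp only [Module.Basis.constr_apply_fintype, map_sum, res_smul, res_res,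
      Module.Basis.equivFun_apply, hb.repr_res hV h]
  · rw [homEval_mkHomSection]
    have := (hb.basisOn le_rfl).constr_basis Γ(X, U) (fun i ↦ res N le_rfl (n i)) i
    rwa [hb.basisOn_apply, res_self, res_self] at this

lemma IsFrame.hom_ext {M N : X.Modules} {U : X.Opens} {b : ι → Γ(M, U)}
    (hb : IsFrame M U b) {f g : Γ(homSheaf M N, U)}
    (h : ∀ i, homEval f le_rfl (b i) = homEval g le_rfl (b i)) : f = g := by
  refine homSheaf_ext fun V hV m ↦ ?_
  have : homEval f hV = homEval g hV := (hb.basisOn hV).ext fun i ↦ by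
    rw [hb.basisOn_apply, ← res_homEval f le_rfl hV, ← res_homEval g le_rfl hV, h]
  rw [this]

/-- The frame of `ℋom(M, N)` induced by frames of `M` and `N`, for `N` a line bundle. -/
lemma IsFrame.homFrame {M L : X.Modules} {U : X.Opens} {b : ι → Γ(M, U)}
    (hb : IsFrame M U b) [DecidableEq ι] {g : Γ(L, U)} (hg : IsFrame L U fun _ : Unit ↦ g)
    {f : ι → Γ(homSheaf M L, U)}
    (hf : ∀ i j, homEval (f i) le_rfl (b j) = if i = j then g else 0) :
    IsFrame (homSheaf M L) U f := by
  intro V hV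
  have key (c : ι → Γ(X, V)) (j : ι) :
      homEval (∑ i, c i • res _ hV (f i)) le_rfl (res M hV (b j)) = c j • res L hV g := by
    rw [homEval_sum, Finset.sum_eq_single j]
    · rw [homEval_smul, homEval_res, ← res_homEval _ le_rfl hV, hf, if_pos rfl, resO_self]
    · intro i _ hij
      rw [homEval_smul, homEval_res, ← res_homEval _ le_rfl hV, hf, if_neg hij, map_zero,
        smul_zero]
    · simp
  refine ⟨fun c d hcd ↦ funext fun j ↦ ?_, fun l ↦ ?_⟩
  · have h1 : c j • res L hV g = d j • res L hV g := by
      rw [← key c, ← key d]; exact congrArg (fun l ↦ homEval l le_rfl (res M hV (b j))) hcd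
    have h2 := (hg.restrict hV).coord_ext (c := fun _ ↦ c j) (d := fun _ ↦ d j) (by simpa using h1)
    exact congrFun h2 ()
  · choose c hc using fun j ↦ (hg.restrict hV).exists_coord (homEval l le_rfl (res M hV (b j)))
    refine ⟨fun j ↦ c j (), (hb.restrict hV).hom_ext fun j ↦ ?_⟩
    refine (key _ j).trans ?_
    rw [← hc j]
    simp

lemma isFrame_one (U : X.Opens) :
    IsFrame (structureModule X) U (fun _ : Unit ↦ (1 : Γ(X, U))) := by
  intro V hV
  have h (c : Γ(X, V)) : c • res (structureModule X) hV (1 : Γ(X, U)) = c := by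
    change c * resO X hV 1 = c
    simp
  refine ⟨fun c d hcd ↦ funext fun _ ↦ ?_, fun c ↦ ⟨fun _ ↦ c, ?_⟩⟩
  · have h1 : ∑ i : Unit, c i • res (structureModule X) hV (1 : Γ(X, U)) =
        ∑ i : Unit, d i • res (structureModule X) hV (1 : Γ(X, U)) := hcd
    rw [Fintype.sum_unique, Fintype.sum_unique] at h1
    rwa [h, h] at h1
  · exact (Fintype.sum_unique _).trans (h c)

lemma IsFrame.exists_dualFrame {M : X.Modules} {U : X.Opens} {b : ι → Γ(M, U)}
    (hb : IsFrame M U b) [DecidableEq ι] : ∃ d : ι → Γ(dual M, U), IsFrame (dual M) U d ∧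
      ∀ i j, dualEval (d i) (b j) = if i = j then 1 else 0 := by
  choose d hd using fun i ↦ hb.exists_hom (N := structureModule X)
    (fun j ↦ if i = j then (1 : Γ(X, U)) else (0 : Γ(X, U)))
  exact ⟨d, hb.homFrame (isFrame_one U) hd, hd⟩

lemma IsFrame.change {M : X.Modules} {U : X.Opens} {b : ι → Γ(M, U)} [DecidableEq ι]
    (hb : IsFrame M U b) (P : Matrix ι ι Γ(X, U)) (hP : IsUnit P.det) :
    IsFrame M U fun i ↦ ∑ j, P i j • b j := by
  intro V hV
  let P' := P.map (resO X hV)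
  have hP' : IsUnit P'.det := by
    have : P'.det = resO X hV P.det := ((resO X hV).map_det P).symm
    rw [this]
    exact hP.map _
  have h1 : Function.Bijective fun c : ι → Γ(X, V) ↦ Matrix.vecMul c P' := by
    have : Invertible P' := Matrix.invertibleOfIsUnitDet _ hP'
    exact ⟨fun c d h ↦ by simpa using congrArg (fun v ↦ Matrix.vecMul v (⅟P')) h,
      fun c ↦ ⟨Matrix.vecMul c (⅟P'), by simp⟩⟩
  have h2 : (fun c : ι → Γ(X, V) ↦ ∑ i, c i • res M hV (∑ j, P i j • b j)) =
      (fun c : ι → Γ(X, V) ↦ ∑ i, c i • res M hV (b i)) ∘ fun c ↦ Matrix.vecMul c P' := by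
    funext c
    simp only [map_sum, res_smul, Function.comp, Matrix.vecMul, dotProduct, Finset.sum_smul,
      Finset.smul_sum, smul_smul]
    rw [Finset.sum_comm]
    rfl
  rw [h2]
  exact (hb V hV).comp h1

lemma IsFrame.reindex {κ : Type*} [Fintype κ] {M : X.Modules} {U : X.Opens} {b : ι → Γ(M, U)}
    (hb : IsFrame M U b) (e : κ ≃ ι) : IsFrame M U (b ∘ e) := by
  refine isFrame_of_basis fun V hV ↦ ⟨(hb.basisOn hV).reindex e.symm, fun i ↦ ?_⟩
  simp

end Frame

/-! ### Vector bundles and frames -/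

section Restrict

variable {X : Scheme.{u}} {ι : Type*} [Fintype ι]

lemma restrict_smul (M : X.Modules) (U : X.Opens) (W : U.toScheme.Opens) (r : Γ(U.toScheme, W))
    (m : Γ(M.restrict U.ι, W)) :
    r • m = (show Γ(M, U.ι ''ᵁ W) from
      (show Γ(X, U.ι ''ᵁ W) from r) • (show Γ(M, U.ι ''ᵁ W) from m)) := by
  have h := M.smul_restrictAppIso_hom_apply U.ι W r m
  rw [Scheme.Opens.ι_appIso] at h
  exact h

lemma isFrame_restrict_iff (M : X.Modules) (U : X.Opens) (W : U.toScheme.Opens)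
    (b : ι → Γ(M.restrict U.ι, W)) :
    IsFrame (M.restrict U.ι) W b ↔ IsFrame M (U.ι ''ᵁ W) b := by
  have key (V : U.toScheme.Opens) (hV : V ≤ W) :
      (fun c : ι → Γ(U.toScheme, V) ↦ ∑ i, c i • res (M.restrict U.ι) hV (b i)) =
        fun c : ι → Γ(X, U.ι ''ᵁ V) ↦
          ∑ i, c i • res M (U.ι.image_mono hV) (b i) := by
    funext c
    exact Finset.sum_congr rfl fun i _ ↦ restrict_smul M U V _ _
  constructor
  · intro h V hV
    obtain ⟨V, rfl⟩ : ∃ V' : U.toScheme.Opens, V = U.ι ''ᵁ V' := ⟨U.ι ⁻¹ᵁ V, by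
      rw [U.ι.image_preimage_eq_opensRange_inf, Scheme.Opens.opensRange_ι]
      exact (inf_eq_right.mpr (hV.trans (U.ι_image_le _))).symm⟩
    have hV' : V ≤ W := by
      have := U.ι.preimage_mono hV
      rwa [U.ι.preimage_image_eq, U.ι.preimage_image_eq] at this
    exact (key V hV') ▸ h V hV'
  · intro h V hV
    rw [key V hV]
    exact h _ _

lemma IsFrame.of_iso {M N : X.Modules} (e : M ≅ N) {U : X.Opens} {b : ι → Γ(M, U)}
    (hb : IsFrame M U b) : IsFrame N U fun i ↦ e.hom.app U (b i) := fun V hV ↦ by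
  have h : (fun c : ι → Γ(X, V) ↦ ∑ i, c i • res N hV (e.hom.app U (b i))) =
      e.hom.app V ∘ fun c ↦ ∑ i, c i • res M hV (b i) := by
    funext c
    simp [← app_res]
  rw [h]
  exact ((ConcreteCategory.isIso_iff_bijective (e.hom.app V)).mp inferInstance).comp (hb V hV)

end Restrict

section Free

variable {X : Scheme.{0}}

/-- The basis sections of the free module `𝒪^r`. -/
def freeSec (X : Scheme.{0}) (r : ℕ) (i : Fin r) :
    Γ((SheafOfModules.free (R := X.ringCatSheaf) (Fin r) : X.Modules), ⊤) :=
  Scheme.Modules.Hom.app (X := X) (M := structureModule X) (SheafOfModules.ιFree i) ⊤ (1 : Γ(X, ⊤))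

lemma structureModule_app {M : X.Modules} (f : structureModule X ⟶ M) {V : X.Opens}
    (c : Γ(X, V)) : f.app V c = c • res M le_top (f.app ⊤ (1 : Γ(X, ⊤))) := by
  have h1 : (c : Γ(structureModule X, V)) =
      c • res (structureModule X) (le_top : V ≤ ⊤) (1 : Γ(X, ⊤)) := by
    have : c * resO X le_top (1 : Γ(X, ⊤)) = c := by rw [map_one, mul_one]
    exact this.symm
  conv_lhs => rw [h1]
  rw [Scheme.Modules.Hom.app_smul]
  congr 1
  exact app_res f (le_top : V ≤ ⊤) (1 : Γ(X, ⊤))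

lemma isFrame_freeSec (r : ℕ) : IsFrame (X := X)
    (SheafOfModules.free (R := X.ringCatSheaf) (Fin r)) ⊤ (freeSec X r) := by
  let F : X.Modules := SheafOfModules.free (R := X.ringCatSheaf) (Fin r)
  let j (i : Fin r) : structureModule X ⟶ F := SheafOfModules.ιFree i
  -- the coordinates, from the universal property of the coproduct
  let p (i : Fin r) : F ⟶ structureModule X :=
    Limits.Cofan.IsColimit.desc (SheafOfModules.isColimitFreeCofan (R := X.ringCatSheaf) (Fin r))
      fun k ↦ (if k = i then 𝟙 (structureModule X) else 0 : structureModule X ⟶ structureModule X)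
  have hjp (i k : Fin r) : j k ≫ p i = if k = i then 𝟙 _ else 0 :=
    Limits.Cofan.IsColimit.fac (SheafOfModules.isColimitFreeCofan (R := X.ringCatSheaf) (Fin r)) _ k
  have hsum : ∑ i, p i ≫ j i = 𝟙 F := by
    refine Limits.Cofan.IsColimit.hom_ext
      (SheafOfModules.isColimitFreeCofan (R := X.ringCatSheaf) (Fin r)) _ _ fun k ↦ ?_
    change j k ≫ (∑ i, p i ≫ j i) = j k ≫ 𝟙 F
    rw [Preadditive.comp_sum, Finset.sum_eq_single k]
    · rw [← Category.assoc, hjp, if_pos rfl, Category.comp_id, Category.id_comp]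
    · intro i _ hik
      rw [← Category.assoc, hjp, if_neg (Ne.symm hik), Limits.zero_comp]
    · simp
  have happ (V : X.Opens) (c : Fin r → Γ(X, V)) :
      ∑ i, c i • res F le_top (freeSec X r i) = ∑ i, (j i).app V (c i) :=
    Finset.sum_congr rfl fun i _ ↦ (structureModule_app (j i) (c i)).symm
  have happ_sum (V : X.Opens) (m : Γ(F, V)) : ∑ i, (j i).app V ((p i).app V m) = m := by
    have h1 : (∑ i, p i ≫ j i).app V m = m := by rw [hsum]; rfl
    refine Eq.trans ?_ h1
    let ev : (F ⟶ F) →+ Γ(F, V) :=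
      { toFun := fun f ↦ f.app V m, map_zero' := rfl, map_add' := fun _ _ ↦ rfl }
    exact (map_sum ev (fun i ↦ p i ≫ j i) Finset.univ).symm
  intro V hV
  constructor
  · intro c d hcd
    simp only [F] at happ
    have h2 : ∑ i, (j i).app V (c i) = ∑ i, (j i).app V (d i) := by
      rw [← happ, ← happ]; exact hcd
    have h3 (c : Fin r → Γ(X, V)) (k : Fin r) : (p k).app V (∑ i, (j i).app V (c i)) = c k := by
      rw [map_sum, Finset.sum_eq_single k]
      · have := congrArg (fun f : structureModule X ⟶ structureModule X ↦ f.app V (c k)) (hjp k k)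
        rw [if_pos rfl] at this
        exact this
      · intro i _ hik
        have := congrArg (fun f : structureModule X ⟶ structureModule X ↦ f.app V (c i)) (hjp k i)
        rw [if_neg hik] at this
        exact this
      · simp
    funext k
    rw [← h3 c k, h2, h3]
  · intro m
    exact ⟨fun i ↦ (p i).app V m, (happ V _).trans (happ_sum V m)⟩

lemma IsVectorBundle.exists_frame {M : X.Modules} {r : ℕ} (hM : IsVectorBundle M r) (x : X) :
    ∃ U : X.Opens, x ∈ U ∧ ∃ b : Fin r → Γ(M, U), IsFrame M U b := by
  obtain ⟨U, hxU, ⟨e⟩⟩ := hM x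
  have h := (isFrame_restrict_iff M U ⊤ _).mp ((isFrame_freeSec (X := U.toScheme) r).of_iso e.symm)
  exact ⟨_, by simpa using hxU, _, h⟩

lemma isVectorBundle_of_exists_frame {M : X.Modules} {r : ℕ}
    (h : ∀ x : X, ∃ U : X.Opens, x ∈ U ∧ ∃ b : Fin r → Γ(M, U), IsFrame M U b) :
    IsVectorBundle M r := by
  intro x
  obtain ⟨U, hxU, b, hb⟩ := h x
  refine ⟨U, hxU, ?_⟩
  have hU : U.ι ''ᵁ ⊤ ≤ U := by simp
  let b' (i : Fin r) : Γ(M.restrict U.ι, ⊤) := res M hU (b i)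
  have hb' : IsFrame (M.restrict U.ι) ⊤ b' :=
    (isFrame_restrict_iff M U ⊤ _).mpr (hb.restrict hU)
  let F : U.toScheme.Modules := SheafOfModules.free (R := U.toScheme.ringCatSheaf) (Fin r)
  obtain ⟨g, hg⟩ := (isFrame_freeSec (X := U.toScheme) r).exists_hom b'
  let f : F ⟶ M.restrict U.ι := mkHom (fun V ↦ homEval g le_top) fun V W hVW m ↦
    (res_homEval g le_top hVW m).symm
  have hf : IsIso f := by
    rw [Scheme.Modules.Hom.isIso_iff_isIso_app]
    intro V
    rw [ConcreteCategory.isIso_iff_bijective]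
    have h1 : (f.app V ∘ fun c : Fin r → Γ(U.toScheme, V) ↦
        ∑ i, c i • res F le_top (freeSec U.toScheme r i)) =
        fun c ↦ ∑ i, c i • res (M.restrict U.ι) le_top (b' i) := by
      funext c
      simp only [Function.comp, map_sum, Scheme.Modules.Hom.app_smul, app_res]
      exact Finset.sum_congr rfl fun i _ ↦ by rw [← hg i]; rfl
    have h2 := hb' V le_top
    rw [← h1] at h2
    exact (Function.Bijective.of_comp_iff _ (isFrame_freeSec (X := U.toScheme) r V le_top)).mp h2
  exact ⟨(asIso f).symm⟩

end Free

/-! ### Points and functions on affine open sets -/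

section Points

variable {X : Scheme.{u}}

lemma mem_asIdeal_iff_notMem_basicOpen {V : X.Opens} (hV : IsAffineOpen V)
    (y : PrimeSpectrum Γ(X, V)) (r : Γ(X, V)) :
    r ∈ y.asIdeal ↔ hV.fromSpec y ∉ X.basicOpen r := by
  have h : hV.fromSpec y ∈ X.basicOpen r ↔ y ∈ PrimeSpectrum.basicOpen r := by
    rw [← hV.fromSpec_preimage_basicOpen]; rfl
  rw [h, PrimeSpectrum.mem_basicOpen, not_not]

lemma height_eq_coheight {V : X.Opens} (hV : IsAffineOpen V) (y : PrimeSpectrum Γ(X, V)) :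
    y.asIdeal.height = Order.coheight (hV.fromSpec y) :=
  (idealHeight_eq_coheight Γ(X, V) y).trans (coheight_eq_of_isOpenImmersion hV.fromSpec).symm

lemma fromSpec_mem {V : X.Opens} (hV : IsAffineOpen V) (y : PrimeSpectrum Γ(X, V)) :
    hV.fromSpec y ∈ V := by
  have : hV.fromSpec y ∈ Set.range hV.fromSpec := ⟨y, rfl⟩
  rwa [hV.range_fromSpec] at this

/-- On a reduced scheme, a function that vanishes at all points is zero. -/
lemma eq_zero_of_evaluation_eq_zero [IsReduced X] {V : X.Opens} (r : Γ(X, V))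
    (h : ∀ (y : X) (hy : y ∈ V), X.evaluation V y hy r = 0) : r = 0 := by
  rw [← basicOpen_eq_bot_iff]
  refine le_bot_iff.mp fun y hy ↦ ?_
  have hyV := X.basicOpen_le r hy
  exact (Scheme.evaluation_eq_zero_iff_notMem_basicOpen X y hyV r).mp (h y hyV) hy

end Points

section Smooth

variable {Y : Scheme.{u}}

/-- A function ring of a smooth integral scheme over a field is normal. -/
lemma isIntegrallyClosed_of_isAffineOpen {k : Type u} [Field k] (f : Y ⟶ Spec (.of k))
    [IsIntegral Y] [Smooth f] {V : Y.Opens} (hV : IsAffineOpen V) [Nonempty V] :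
    IsIntegrallyClosed Γ(Y, V) := by
  have h := f.smooth_appLE (isAffineOpen_top (Spec (.of k))) hV le_top
  have h2 : (((Scheme.ΓSpecIso (.of k)).inv ≫ f.appLE ⊤ V le_top).hom).Smooth := by
    rw [CommRingCat.hom_comp]
    refine RingHom.Smooth.comp ?_ h
    exact RingHom.Smooth.of_bijective (ConcreteCategory.bijective_of_isIso _)
  let φ : k →+* Γ(Y, V) := ((Scheme.ΓSpecIso (.of k)).inv ≫ f.appLE ⊤ V le_top).hom
  algebraize [φ]
  have : Algebra.Smooth k Γ(Y, V) := h2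
  exact isIntegrallyClosed_of_smooth k _

end Smooth

/-! ### Stalks and the rank at a point -/

section Stalks

variable {X : Scheme.{u}}

lemma exists_common_nhd {ι : Type*} [Finite ι] {x : X} {U : X.Opens} (hx : x ∈ U)
    (p : ι → X.Opens → Prop) (hp : ∀ i V W, x ∈ W → W ≤ V → p i V → p i W)
    (h : ∀ i, ∃ V, x ∈ V ∧ p i V) : ∃ V, x ∈ V ∧ V ≤ U ∧ ∀ i, p i V := by
  cases nonempty_fintype ι
  choose V hxV hV using h
  have hmem : x ∈ U ⊓ Finset.univ.inf V := ⟨hx, Finset.inf_induction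
    (p := fun W : X.Opens ↦ x ∈ W) (Opens.mem_top x) (fun _ h₁ _ h₂ ↦ ⟨h₁, h₂⟩) fun i _ ↦ hxV i⟩
  exact ⟨_, hmem, inf_le_left, fun i ↦
    hp i _ _ hmem (inf_le_right.trans (Finset.inf_le (Finset.mem_univ i))) (hV i)⟩

lemma germ_resO {U V : X.Opens} (h : V ≤ U) (x : X) (hx : x ∈ V) (r : Γ(X, U)) :
    X.presheaf.germ V x hx (resO X h r) = X.presheaf.germ U x (h hx) r :=
  X.presheaf.germ_res_apply (homOfLE h) x hx r

/-- The germ of a section of an `𝒪_X`-module. -/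
def germM (M : X.Modules) {U : X.Opens} (x : X) (hx : x ∈ U) : Γ(M, U) →+ stalk M x :=
  (M.presheaf.germ U x hx).hom

lemma germM_res (M : X.Modules) {U V : X.Opens} (h : V ≤ U) (x : X) (hx : x ∈ V) (m : Γ(M, U)) :
    germM M x hx (res M h m) = germM M x (h hx) m :=
  M.presheaf.germ_res_apply (homOfLE h) x hx m

lemma germM_smul (M : X.Modules) {U : X.Opens} (x : X) (hx : x ∈ U) (r : Γ(X, U)) (m : Γ(M, U)) :
    germM M x hx (r • m) = X.presheaf.germ U x hx r • germM M x hx m := germ_smul M x hx r m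

lemma stalkMap_germM {M N : X.Modules} (φ : M ⟶ N) {U : X.Opens} (x : X) (hx : x ∈ U)
    (m : Γ(M, U)) : stalkMap φ x (germM M x hx m) = germM N x hx (φ.app U m) :=
  TopCat.Presheaf.stalkFunctor_map_germ_apply U x hx φ.mapPresheaf m

/-- Finitely many germs of functions come from functions on a common neighbourhood. -/
lemma exists_germ_family {ι : Type*} [Finite ι] {x : X} {U : X.Opens} (hx : x ∈ U)
    (g : ι → X.presheaf.stalk x) : ∃ (V : X.Opens) (hV : x ∈ V), V ≤ U ∧
      ∃ c : ι → Γ(X, V), ∀ i, X.presheaf.germ V x hV (c i) = g i := by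
  obtain ⟨V, hV, hVU, h⟩ := exists_common_nhd hx
    (fun i V ↦ ∃ (hV : x ∈ V) (c : Γ(X, V)), X.presheaf.germ V x hV c = g i) (ι := ι)
    (fun i V W hxW hWV ⟨hV, c, hc⟩ ↦ ⟨hxW, resO X hWV c, by rw [germ_resO, hc]⟩)
    fun i ↦ by
      obtain ⟨V, hV, c, hc⟩ := X.presheaf.exists_germ_eq (g i)
      exact ⟨V, hV, hV, c, hc⟩
  choose _ c hc using h
  exact ⟨V, hV, hVU, c, hc⟩

/-- Finitely many pairs of functions with equal germs agree on a common neighbourhood. -/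
lemma exists_resO_eq_family {ι : Type*} [Finite ι] {x : X} {U : X.Opens} (hx : x ∈ U)
    (c d : ι → Γ(X, U)) (h : ∀ i, X.presheaf.germ U x hx (c i) = X.presheaf.germ U x hx (d i)) :
    ∃ (V : X.Opens) (hV : V ≤ U), x ∈ V ∧ ∀ i, resO X hV (c i) = resO X hV (d i) := by
  obtain ⟨V, hV, hVU, h⟩ := exists_common_nhd hx
    (fun i V ↦ ∃ hV : V ≤ U, resO X hV (c i) = resO X hV (d i)) (ι := ι)
    (fun i V W hxW hWV ⟨hV, hc⟩ ↦ ⟨hWV.trans hV, by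
      rw [← resO_resO hV hWV, ← resO_resO hV hWV, hc]⟩)
    fun i ↦ by
      obtain ⟨V, hV, i₁, i₂, hc⟩ := X.presheaf.germ_eq x hx hx _ _ (h i)
      exact ⟨V, hV, leOfHom i₁, hc⟩
  exact ⟨V, hVU, hV, fun i ↦ (h i).2⟩

lemma exists_res_eq_of_germ {M : X.Modules} {x : X} {U : X.Opens} (hx : x ∈ U) (s t : Γ(M, U))
    (h : germM M x hx s = germM M x hx t) :
    ∃ (V : X.Opens) (hV : V ≤ U), x ∈ V ∧ res M hV s = res M hV t := by
  obtain ⟨V, hV, i₁, i₂, hc⟩ := M.presheaf.germ_eq x hx hx s t h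
  exact ⟨V, leOfHom i₁, hV, hc⟩

/-- The germs of a frame are a basis of the stalk. -/
lemma IsFrame.exists_stalk_basis {ι : Type*} [Fintype ι] {M : X.Modules} {U : X.Opens}
    {b : ι → Γ(M, U)} (hb : IsFrame M U b) {x : X} (hx : x ∈ U) :
    ∃ B : Module.Basis ι (X.presheaf.stalk x) (stalk M x), ∀ i, B i = germM M x hx (b i) := by
  have hli : LinearIndependent (X.presheaf.stalk x) fun i ↦ germM M x hx (b i) := by
    rw [Fintype.linearIndependent_iff]
    intro g hg
    obtain ⟨V, hxV, hVU, c, hc⟩ := exists_germ_family hx g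
    have h1 : germM M x hxV (∑ i, c i • res M hVU (b i)) = germM M x hxV 0 := by
      rw [map_sum, map_zero, ← hg]
      refine Finset.sum_congr rfl fun i _ ↦ ?_
      rw [germM_smul, germM_res, hc]
    obtain ⟨W, hW, hxW, h2⟩ := exists_res_eq_of_germ hxV _ _ h1
    have h3 : (fun i ↦ resO X hW (c i)) = 0 := by
      refine (hb.restrict (hW.trans hVU)).coord_ext ?_
      simpa [res_smul, res_res] using h2
    intro i
    rw [← hc, ← germ_resO hW x hxW, congrFun h3 i]
    exact map_zero _
  have hspan : ⊤ ≤ Submodule.span (X.presheaf.stalk x) (Set.range fun i ↦ germM M x hx (b i)) := by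
    rintro m -
    obtain ⟨V, hVU, hxV, m, rfl⟩ := M.presheaf.exists_le_germ_eq m hx
    obtain ⟨c, hc⟩ := (hb.restrict hVU).exists_coord m
    have h1 : germM M x hxV m = ∑ i, X.presheaf.germ V x hxV (c i) • germM M x hx (b i) := by
      rw [← hc, map_sum]
      refine Finset.sum_congr rfl fun i _ ↦ ?_
      rw [germM_smul, germM_res]
    change germM M x hxV m ∈ _
    rw [h1]
    exact Submodule.sum_mem _ fun i _ ↦ Submodule.smul_mem _ _ (Submodule.subset_span ⟨i, rfl⟩)
  exact ⟨.mk hli hspan, fun i ↦ Module.Basis.mk_apply hli hspan i⟩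

/-- The matrix of a morphism with respect to frames. -/
def frameMatrix {ι κ : Type*} [Fintype κ] {F E : X.Modules} (φ : F ⟶ E) {U : X.Opens}
    (f : ι → Γ(F, U)) {e : κ → Γ(E, U)} (he : IsFrame E U e) : Matrix κ ι Γ(X, U) :=
  he.basis.toMatrix fun i ↦ φ.app U (f i)

lemma sum_frameMatrix {ι κ : Type*} [Fintype κ] {F E : X.Modules} (φ : F ⟶ E) {U : X.Opens}
    (f : ι → Γ(F, U)) {e : κ → Γ(E, U)} (he : IsFrame E U e) (i : ι) :
    φ.app U (f i) = ∑ k, frameMatrix φ f he k i • e k := by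
  have := he.basis.sum_repr (φ.app U (f i))
  simpa [frameMatrix, Module.Basis.toMatrix_apply] using this.symm

/-- The rank at a point is the rank of the matrix of values. -/
lemma rankAt_eq_rank {ι κ : Type*} [Fintype ι] [Fintype κ] [DecidableEq ι]
    {F E : X.Modules} (φ : F ⟶ E) {U : X.Opens} {f : ι → Γ(F, U)} (hf : IsFrame F U f)
    {e : κ → Γ(E, U)} (he : IsFrame E U e) {x : X} (hx : x ∈ U) :
    rankAt φ x = (((frameMatrix φ f he).map (X.presheaf.germ U x hx)).map
      (IsLocalRing.residue (X.presheaf.stalk x))).rank := by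
  obtain ⟨BF, hBF⟩ := hf.exists_stalk_basis hx
  obtain ⟨BE, hBE⟩ := he.exists_stalk_basis hx
  have h1 : LinearMap.toMatrix BF BE (stalkMap φ x) =
      (frameMatrix φ f he).map (X.presheaf.germ U x hx) := by
    ext k i
    have h2 : stalkMap φ x (BF i) =
        ∑ k, X.presheaf.germ U x hx (frameMatrix φ f he k i) • BE k := by
      rw [hBF, stalkMap_germM, sum_frameMatrix φ f he, map_sum]
      exact Finset.sum_congr rfl fun k _ ↦ by rw [germM_smul, hBE]
    classical
    rw [LinearMap.toMatrix_apply, h2, map_sum]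
    simp [Finsupp.single_apply]
  have h2 := LinearMap.toMatrix_baseChange (A := IsLocalRing.ResidueField (X.presheaf.stalk x))
    (stalkMap φ x) BF BE
  rw [h1] at h2
  have h3 := Matrix.rank_eq_finrank_range_toLin (((frameMatrix φ f he).map
    (X.presheaf.germ U x hx)).map (algebraMap _ (IsLocalRing.ResidueField (X.presheaf.stalk x))))
    (Algebra.TensorProduct.basis _ BE) (Algebra.TensorProduct.basis _ BF)
  rw [← h2, Matrix.toLin_toMatrix] at h3
  exact h3.symm.trans (congrArg Matrix.rank h2)

end Stalks

/-! ### Symplectic forms and adapted frames -/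

section Symplectic

open Matrix

variable {Y : Scheme.{u}} {E F : Y.Modules}

/-- The form `ω` on sections over an open set. -/
def formOn (ω : E ⟶ dual E) (U : Y.Opens) : LinearMap.BilinForm Γ(Y, U) Γ(E, U) :=
  dualEvalₗ E U ∘ₗ appLinear ω U

lemma formOn_apply (ω : E ⟶ dual E) (U : Y.Opens) (s t : Γ(E, U)) :
    formOn ω U s t = pairing ω s t := rfl

lemma resO_pairing (ω : E ⟶ dual E) {U V : Y.Opens} (h : V ≤ U) (s t : Γ(E, U)) :
    resO Y h (pairing ω s t) = pairing ω (res E h s) (res E h t) := by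
  simp only [pairing, resO_dualEval, app_res]

lemma pairing_neg {ω : E ⟶ dual E} (hω : IsSymplecticForm ω) {U : Y.Opens} (s t : Γ(E, U)) :
    pairing ω s t = -pairing ω t s := by
  have h : (formOn ω U).IsAlt := hω.alternating U
  exact (h.neg_eq t s).symm

/-- Every functional is the pairing with a section. -/
lemma exists_pairing_eq {ω : E ⟶ dual E} (hω : IsSymplecticForm ω) {U : Y.Opens}
    (l : Γ(dual E, U)) : ∃ s : Γ(E, U), ω.app U s = l := by
  have := hω.nondegenerate
  refine ⟨(inv ω).app U l, ?_⟩
  have h : inv ω ≫ ω = 𝟙 _ := IsIso.inv_hom_id ω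
  exact CategoryTheory.congr_fun (congrArg (fun k ↦ Scheme.Modules.Hom.app k U) h) l

variable {ι κ : Type} [Fintype ι] [DecidableEq ι] [Fintype κ] [DecidableEq κ]

/-- The Gram matrix of a family of sections. -/
def gram (ω : E ⟶ dual E) {U : Y.Opens} {κ : Type} (e : κ → Γ(E, U)) : Matrix κ κ Γ(Y, U) :=
  of fun k l ↦ pairing ω (e k) (e l)

lemma pairing_sum (ω : E ⟶ dual E) {U : Y.Opens} (e : κ → Γ(E, U)) (x y : κ → Γ(Y, U)) :
    pairing ω (∑ k, x k • e k) (∑ k, y k • e k) = toBilin' (gram ω e) x y := by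
  rw [← formOn_apply, toBilin'_apply]
  simp only [map_sum, LinearMap.sum_apply, map_smul, LinearMap.smul_apply, formOn_apply, gram,
    of_apply, smul_eq_mul]
  simp only [Finset.mul_sum]
  rw [Finset.sum_comm]
  exact Finset.sum_congr rfl fun i _ ↦ Finset.sum_congr rfl fun j _ ↦ by ring

/-- The Gram matrix of a frame is invertible, since the dual frame consists of functionals of the
form `⟨s, ·⟩`. -/
lemma isUnit_det_gram {ω : E ⟶ dual E} (hω : IsSymplecticForm ω) {U : Y.Opens} {e : κ → Γ(E, U)}
    (he : IsFrame E U e) : IsUnit (gram ω e).det := by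
  obtain ⟨d, hd, hde⟩ := he.exists_dualFrame
  choose s hs using fun k ↦ exists_pairing_eq hω (d k)
  choose K hK using fun k ↦ he.exists_coord (s k)
  have h : of K * gram ω e = 1 := by
    ext k l
    rw [one_apply, ← hde, ← hs, ← hK]
    change _ = formOn ω U _ _
    simp [Matrix.mul_apply, gram, formOn_apply]
  exact (isUnit_iff_exists_inv'.mpr ⟨_, by rw [← det_mul, h, det_one]⟩)

/-- A family of the cardinality of a frame is a frame if its Gram matrix is invertible. -/
lemma IsFrame.of_gram {ω : E ⟶ dual E} {U : Y.Opens} {e : κ → Γ(E, U)}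
    (he : IsFrame E U e) {q : κ → Γ(E, U)} (hq : IsUnit (gram ω q).det) : IsFrame E U q := by
  choose P hP using fun k ↦ he.exists_coord (q k)
  have h : gram ω q = of P * gram ω e * (of P)ᵀ := by
    ext k l
    rw [gram, of_apply, ← hP, ← hP, pairing_sum, toBilin'_apply']
    rw [Matrix.mul_assoc, Matrix.mul_apply]
    simp only [dotProduct, mulVec, Matrix.mul_apply, transpose_apply, of_apply]
  rw [h, det_mul] at hq
  have := he.change (of P) (isUnit_of_mul_isUnit_right hq |> fun h ↦ by rwa [det_transpose] at h)
  convert this using 2 with k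
  exact (hP k).symm

end Symplectic

section Lagrangian

open Matrix

variable {Y : Scheme.{u}} {E F : Y.Modules} {n : ℕ}

/-- On a reduced scheme isotropy at all points is isotropy on sections. -/
lemma IsLagrangian.pairing_eq_zero [IsIntegral Y] {ω : E ⟶ dual E} {φ : F ⟶ E}
    (hφ : IsLagrangian n ω φ) {U : Y.Opens} (s t : Γ(F, U)) :
    pairing ω (φ.app U s) (φ.app U t) = 0 :=
  eq_zero_of_evaluation_eq_zero _ fun y hy ↦ hφ.isotropic y U hy s t

variable {ι κ : Type} [Fintype ι] [DecidableEq ι] [Fintype κ] [DecidableEq κ]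

lemma pairing_frameMatrix (ω : E ⟶ dual E) (φ : F ⟶ E) {U : Y.Opens} (f : ι → Γ(F, U))
    {e : κ → Γ(E, U)} (he : IsFrame E U e) (i j : ι) :
    pairing ω (φ.app U (f i)) (φ.app U (f j)) =
      ((frameMatrix φ f he)ᵀ * gram ω e * frameMatrix φ f he) i j := by
  rw [sum_frameMatrix φ f he, sum_frameMatrix φ f he, pairing_sum, ← toBilin'_apply_col]
  rfl

/-- Frames `f` of `F` and `q` of `E` over `W` such that `q` is symplectic, and such that `φ` maps
`f i` to `q (inl i)` for all indices `i` but one, `o`, and `f o` to `a q (inl o) + b q (inr o)`. -/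
structure IsAdapted (ω : E ⟶ dual E) (φ : F ⟶ E) (W : Y.Opens) (o : ι) (f : ι → Γ(F, W))
    (q : ι ⊕ ι → Γ(E, W)) (a b : Γ(Y, W)) : Prop where
  frame_source : IsFrame F W f
  frame_target : IsFrame E W q
  gram_eq : gram ω q = fromBlocks 0 1 (-1) 0
  app_of_ne : ∀ i, i ≠ o → φ.app W (f i) = q (.inl i)
  app_self : φ.app W (f o) = a • q (.inl o) + b • q (.inr o)

lemma gram_res (ω : E ⟶ dual E) {U V : Y.Opens} (h : V ≤ U) (e : κ → Γ(E, U)) :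
    gram ω (fun k ↦ res E h (e k)) = (gram ω e).map (resO Y h) := by
  ext k l
  exact (resO_pairing ω h _ _).symm

lemma IsAdapted.restrict {ω : E ⟶ dual E} {φ : F ⟶ E} {W : Y.Opens} {o : ι} {f : ι → Γ(F, W)}
    {q : ι ⊕ ι → Γ(E, W)} {a b : Γ(Y, W)} (h : IsAdapted ω φ W o f q a b) {V : Y.Opens}
    (hV : V ≤ W) : IsAdapted ω φ V o (fun i ↦ res F hV (f i)) (fun k ↦ res E hV (q k))
      (resO Y hV a) (resO Y hV b) where
  frame_source := h.frame_source.restrict hV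
  frame_target := h.frame_target.restrict hV
  gram_eq := by
    rw [gram_res, h.gram_eq, fromBlocks_map]
    congr 1 <;> ext i j <;> rcases eq_or_ne i j with rfl | hij <;> simp [*]
  app_of_ne i hi := by rw [app_res, h.app_of_ne i hi]
  app_self := by rw [app_res, h.app_self, map_add, res_smul, res_smul]

lemma frameMatrix_res (φ : F ⟶ E) {U V : Y.Opens} (h : V ≤ U) (f : ι → Γ(F, U))
    {e : κ → Γ(E, U)} (he : IsFrame E U e) :
    frameMatrix φ (fun i ↦ res F h (f i)) (he.restrict h) =
      (frameMatrix φ f he).map (resO Y h) := by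
  ext k i
  refine congrFun ((he.restrict h).coord_ext (c := fun k ↦ frameMatrix φ _ (he.restrict h) k i)
    (d := fun k ↦ resO Y h (frameMatrix φ f he k i)) ?_) k
  rw [← sum_frameMatrix, app_res, sum_frameMatrix φ f he, map_sum]
  exact Finset.sum_congr rfl fun k _ ↦ res_smul _ _ _ _

lemma frameMatrix_eq_of_sum (φ : F ⟶ E) {U : Y.Opens} (f : ι → Γ(F, U))
    {e : κ → Γ(E, U)} (he : IsFrame E U e) {i : ι} {c : κ → Γ(Y, U)}
    (h : φ.app U (f i) = ∑ k, c k • e k) (k : κ) : frameMatrix φ f he k i = c k :=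
  congrFun (he.coord_ext (c := fun k ↦ frameMatrix φ f he k i)
    (by rw [← sum_frameMatrix, h])) k

lemma map_standard {R S : Type*} [CommRing R] [CommRing S] (g : R →+* S) :
    (fromBlocks 0 1 (-1) 0 : Matrix (ι ⊕ ι) (ι ⊕ ι) R).map g = fromBlocks 0 1 (-1) 0 := by
  rw [fromBlocks_map]
  congr 1 <;> ext i j <;> rcases eq_or_ne i j with rfl | hij <;> simp [*]

lemma isUnit_det_standard {R : Type*} [CommRing R] :
    IsUnit (fromBlocks 0 1 (-1) 0 : Matrix (ι ⊕ ι) (ι ⊕ ι) R).det := by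
  refine isUnit_iff_exists_inv'.mpr ⟨(fromBlocks 0 (-1) 1 0 : Matrix (ι ⊕ ι) (ι ⊕ ι) R).det, ?_⟩
  rw [← det_mul, fromBlocks_multiply]
  simp

lemma isAdapted_of_matrices {ω : E ⟶ dual E} {φ : F ⟶ E} {U : Y.Opens}
    {f : ι → Γ(F, U)} (hf : IsFrame F U f) {e : κ → Γ(E, U)} (he : IsFrame E U e)
    (hcard : Fintype.card κ = 2 * Fintype.card ι)
    {o : ι} {P : Matrix ι ι Γ(Y, U)} {Q : Matrix κ (ι ⊕ ι) Γ(Y, U)} {a b : Γ(Y, U)}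
    (hP : IsUnit P.det) (hQ : Qᵀ * gram ω e * Q = fromBlocks 0 1 (-1) 0)
    (hAP : ∀ i, (frameMatrix φ f he * P).col i =
        if i = o then a • Q.col (.inl o) + b • Q.col (.inr o) else Q.col (.inl i)) :
    IsAdapted ω φ U o (fun i ↦ ∑ j, P j i • f j) (fun k ↦ ∑ l, Q l k • e l) a b := by
  have hgram : gram ω (fun k ↦ ∑ l, Q l k • e l) = fromBlocks 0 1 (-1) 0 := by
    ext k l
    rw [gram, of_apply, pairing_sum, ← hQ, ← toBilin'_apply_col]
    rfl
  have happ (i) : φ.app U (∑ j, P j i • f j) = ∑ k, (frameMatrix φ f he * P).col i k • e k := by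
    simp only [map_sum, Scheme.Modules.Hom.app_smul, col_apply, Matrix.mul_apply, Finset.sum_smul]
    rw [Finset.sum_comm]
    refine Finset.sum_congr rfl fun j _ ↦ ?_
    rw [sum_frameMatrix φ f he, Finset.smul_sum]
    exact Finset.sum_congr rfl fun k _ ↦ by rw [smul_smul, mul_comm]
  let σ : κ ≃ ι ⊕ ι := Fintype.equivOfCardEq (by rw [hcard, Fintype.card_sum, two_mul])
  refine ⟨?_, ?_, hgram, fun i hi ↦ ?_, ?_⟩
  · have := hf.change Pᵀ (by rwa [det_transpose])
    exact this
  · refine IsFrame.of_gram (ω := ω) (he.reindex σ.symm) ?_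
    rw [hgram]
    exact isUnit_det_standard
  · rw [happ, hAP, if_neg hi]; rfl
  · rw [happ, hAP, if_pos rfl]
    simp only [Pi.add_apply, Pi.smul_apply, smul_eq_mul, add_smul, Finset.sum_add_distrib,
      Finset.smul_sum, smul_smul, col_apply]

/-- Near a point where the rank is one less than maximal there are adapted frames. -/
theorem exists_isAdapted [IsIntegral Y] {ω : E ⟶ dual E} (hω : IsSymplecticForm ω)
    {φ : F ⟶ E} (hφ : IsLagrangian n ω φ) {U : Y.Opens} {f : Fin n → Γ(F, U)} (hf : IsFrame F U f)
    {e : Fin (2 * n) → Γ(E, U)} (he : IsFrame E U e) {y : Y} (hy : y ∈ U)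
    (hrank : rankAt φ y + 1 = n) :
    ∃ (W : Y.Opens) (o : Fin n) (f' : Fin n → Γ(F, W)) (q : Fin n ⊕ Fin n → Γ(E, W))
      (a b : Γ(Y, W)), y ∈ W ∧ W ≤ U ∧ IsAdapted ω φ W o f' q a b := by
  let R := Y.presheaf.stalk y
  let γ : Γ(Y, U) →+* R := (Y.presheaf.germ U y hy).hom
  -- over the local ring at `y` this is a statement on matrices
  let A := frameMatrix φ f he
  let J := gram ω e
  obtain ⟨o, P, Q, a, b, hP, hQ, hAP⟩ := exists_adapted_bases (R := R) (J := J.map γ)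
    (ι := Fin n) (by simp)
    (by
      have : (J.map γ).det = γ J.det := (γ.map_det J).symm
      rw [this]
      exact (isUnit_det_gram hω he).map γ)
    (isAlt_toBilin' (fun i j ↦ by
        rw [map_apply, map_apply, ← map_neg]
        exact congrArg γ (pairing_neg hω _ _))
      fun i ↦ (congrArg γ (hω.alternating U (e i))).trans (map_zero γ))
    (A.map γ) (by
      rw [← transpose_map, ← Matrix.map_mul, ← Matrix.map_mul]
      ext i j
      rw [map_apply, ← pairing_frameMatrix, hφ.pairing_eq_zero, map_zero]; rfl)
    (by
      have := rankAt_eq_rank φ hf he hy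
      rw [Fintype.card_fin]
      exact (congrArg (· + 1) this).symm.trans hrank)
  -- the matrices come from a neighbourhood `V` of `y`, their relations hold on a smaller one, `W`,
  -- and `P` is invertible on `W'`
  obtain ⟨V, hyV, hVU, c, hc⟩ := exists_germ_family hy
    (Sum.elim (fun p : Fin n × Fin n ↦ P p.1 p.2)
      (Sum.elim (fun p : Fin (2 * n) × (Fin n ⊕ Fin n) ↦ Q p.1 p.2) ![a, b]))
  let γV : Γ(Y, V) →+* R := (Y.presheaf.germ V y hyV).hom
  let P' : Matrix (Fin n) (Fin n) Γ(Y, V) := of fun i j ↦ c (.inl (i, j))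
  let Q' : Matrix (Fin (2 * n)) (Fin n ⊕ Fin n) Γ(Y, V) := of fun i j ↦ c (.inr (.inl (i, j)))
  let a' := c (.inr (.inr 0))
  let b' := c (.inr (.inr 1))
  let A' := A.map (resO Y hVU)
  let J' := J.map (resO Y hVU)
  have hP' : P'.map γV = P := by ext i j; exact hc _
  have hQ' : Q'.map γV = Q := by ext i j; exact hc _
  have ha' : γV a' = a := hc _
  have hb' : γV b' = b := hc _
  have hA' : A'.map γV = A.map γ := by ext i j; exact germ_resO hVU y hyV _
  have hJ' : J'.map γV = J.map γ := by ext i j; exact germ_resO hVU y hyV _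
  let T (i : Fin n) (k : Fin (2 * n)) : Γ(Y, V) :=
    if i = o then a' * Q' k (.inl o) + b' * Q' k (.inr o) else Q' k (.inl i)
  obtain ⟨W, hW, hyW, hres⟩ := exists_resO_eq_family hyV
    (Sum.elim (fun p : (Fin n ⊕ Fin n) × (Fin n ⊕ Fin n) ↦ (Q'ᵀ * J' * Q') p.1 p.2)
      (fun p : Fin n × Fin (2 * n) ↦ (A' * P') p.2 p.1))
    (Sum.elim (fun p : (Fin n ⊕ Fin n) × (Fin n ⊕ Fin n) ↦
      (fromBlocks 0 1 (-1) 0 : Matrix (Fin n ⊕ Fin n) (Fin n ⊕ Fin n) Γ(Y, V)) p.1 p.2)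
      (fun p : Fin n × Fin (2 * n) ↦ T p.1 p.2)) (by
    rintro (⟨i, j⟩ | ⟨i, k⟩)
    · have h1 : (Q'ᵀ * J' * Q').map γV = (fromBlocks 0 1 (-1) 0 : Matrix _ _ Γ(Y, V)).map γV := by
        rw [Matrix.map_mul, Matrix.map_mul, transpose_map, hQ', hJ', hQ, map_standard]
      exact congrFun (congrFun h1 i) j
    · have h1 := congrFun (hAP i) k
      rw [← hP', ← hA', ← Matrix.map_mul] at h1
      refine Eq.trans h1 ?_
      change _ = γV (T i k)
      simp only [T, ← ha', ← hb', ← hQ']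
      split_ifs <;> simp)
  let W' : Y.Opens := Y.basicOpen (resO Y hW P'.det)
  have hW' : W' ≤ W := Y.basicOpen_le _
  have hyW' : y ∈ W' := by
    refine (Scheme.mem_basicOpen _ _ y hyW).mpr ?_
    rw [germ_resO hW y hyW]
    have : γV P'.det = P.det := by rw [← hP']; exact γV.map_det P'
    exact this ▸ hP
  let r : Γ(Y, V) →+* Γ(Y, W') := resO Y (hW'.trans hW)
  have hr (x : Γ(Y, V)) : r x = resO Y hW' (resO Y hW x) := (resO_resO hW hW' x).symm
  have hfr : frameMatrix φ (fun i ↦ res F (hW'.trans (hW.trans hVU)) (f i))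
      (he.restrict (hW'.trans (hW.trans hVU))) = A'.map r := by
    rw [frameMatrix_res]
    ext i j
    exact (resO_resO hVU (hW'.trans hW) _).symm
  refine ⟨W', o, _, _, r a', r b', hyW', hW'.trans (hW.trans hVU), isAdapted_of_matrices
    (hf.restrict (hW'.trans (hW.trans hVU))) (he.restrict (hW'.trans (hW.trans hVU))) (by simp)
    (P := P'.map r) (Q := Q'.map r) ?_ ?_ fun i ↦ ?_⟩
  · have h1 : (P'.map r).det = r P'.det := (r.map_det P').symm
    rw [h1, hr]
    exact RingedSpace.isUnit_res_basicOpen _ _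
  · rw [gram_res]
    have h1 : (gram ω e).map (resO Y (hW'.trans (hW.trans hVU))) = J'.map r := by
      ext i j
      exact (resO_resO hVU (hW'.trans hW) _).symm
    rw [h1, ← transpose_map, ← Matrix.map_mul, ← Matrix.map_mul, ← map_standard r]
    ext i j
    rw [map_apply, map_apply, hr, hr]
    exact congrArg _ (hres (.inl (i, j)))
  · rw [hfr, ← Matrix.map_mul]
    funext k
    have h1 := congrArg (resO Y hW') (hres (.inr (i, k)))
    rw [resO_resO, resO_resO] at h1
    refine Eq.trans h1 ?_
    change r (T i k) = _
    simp only [T]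
    split_ifs <;> simp

end Lagrangian

/-! ### The ideal sheaf of minors -/

section Extension

variable {X : Scheme.{u}}

/-- `M` has frames of cardinality `r` locally. -/
def HasLocalFrames (M : X.Modules) (r : ℕ) : Prop :=
  ∀ x : X, ∃ U : X.Opens, x ∈ U ∧ ∃ b : Fin r → Γ(M, U), IsFrame M U b

lemma HasLocalFrames.exists_le {M : X.Modules} {r : ℕ} (hM : HasLocalFrames M r) {x : X}
    {V : X.Opens} (hx : x ∈ V) :
    ∃ U ≤ V, x ∈ U ∧ ∃ b : Fin r → Γ(M, U), IsFrame M U b := by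
  obtain ⟨U, hxU, b, hb⟩ := hM x
  exact ⟨V ⊓ U, inf_le_left, ⟨hx, hxU⟩, _, hb.restrict inf_le_right⟩

lemma HasLocalFrames.dual {M : X.Modules} {r : ℕ} (hM : HasLocalFrames M r) :
    HasLocalFrames (dual M) r := fun x ↦ by
  obtain ⟨U, hxU, b, hb⟩ := hM x
  obtain ⟨d, hd, -⟩ := hb.exists_dualFrame
  exact ⟨U, hxU, d, hd⟩

lemma HasLocalFrames.exists_affine {M : X.Modules} {r : ℕ} (hM : HasLocalFrames M r) {x : X}
    {V : X.Opens} (hx : x ∈ V) :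
    ∃ U ≤ V, IsAffineOpen U ∧ x ∈ U ∧ ∃ b : Fin r → Γ(M, U), IsFrame M U b := by
  obtain ⟨U, hUV, hxU, b, hb⟩ := hM.exists_le hx
  obtain ⟨_, ⟨W, hW, rfl⟩, hxW, hWU⟩ := X.isBasis_affineOpens.exists_subset_of_mem_open hxU U.2
  exact ⟨W, hWU.trans hUV, hW, hxW, _, hb.restrict hWU⟩

lemma resO_injective [IsIntegral X] {U V : X.Opens} (h : V ≤ U) (hV : ∃ x, x ∈ V) :
    Function.Injective (resO X h) := by
  have : Nonempty V := ⟨⟨_, hV.choose_spec⟩⟩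
  exact map_injective_of_isIntegral X (homOfLE h)

/-- A section of a vector bundle on an integral scheme that vanishes on a nonempty open set is
zero. -/
lemma HasLocalFrames.eq_zero_of_res_eq_zero [IsIntegral X] {M : X.Modules} {r : ℕ}
    (hM : HasLocalFrames M r) {U D : X.Opens} (hD : ∃ x, x ∈ D) (s : Γ(M, U))
    (hs : res M (inf_le_left : U ⊓ D ≤ U) s = 0) : s = 0 := by
  refine section_ext M fun x hx ↦ ?_
  obtain ⟨W, hWU, hxW, b, hb⟩ := hM.exists_le hx
  refine ⟨W, hWU, hxW, ?_⟩
  obtain ⟨c, hc⟩ := hb.exists_coord (res M hWU s)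
  have hne : ∃ x, x ∈ W ⊓ D := by
    obtain ⟨z, hz⟩ := hD
    exact nonempty_preirreducible_inter W.2 D.2 ⟨x, hxW⟩ ⟨z, hz⟩
  have h0 : (fun k ↦ resO X (inf_le_left : W ⊓ D ≤ W) (c k)) = 0 := by
    refine (hb.restrict inf_le_left).coord_ext ?_
    have h1 : res M (inf_le_left : W ⊓ D ≤ W) (res M hWU s) = 0 := by
      rw [res_res, ← res_res M inf_le_left (inf_le_inf_right D hWU), hs, map_zero]
    rw [← hc, map_sum] at h1
    simpa [res_smul] using h1
  have hc0 : c = 0 := funext fun k ↦ resO_injective inf_le_left hne (by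
    rw [Pi.zero_apply, map_zero]; exact congrFun h0 k)
  rw [← hc, hc0]
  simp

lemma exists_resO_eq_pow_mul {V W : X.Opens} (hW : IsAffineOpen W) (hWV : W ≤ V) (g : Γ(X, V))
    (c : Γ(X, W ⊓ X.basicOpen g)) :
    ∃ (n : ℕ) (y : Γ(X, W)), resO X inf_le_left y =
      resO X (inf_le_left.trans hWV : W ⊓ X.basicOpen g ≤ V) g ^ n * c := by
  have key : ∀ (D : X.Opens) (hD : D = X.basicOpen (resO X hWV g)) (c : Γ(X, D)) (h : D ≤ W),
      ∃ (n : ℕ) (y : Γ(X, W)), resO X h y = resO X (h.trans hWV) g ^ n * c := by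
    rintro _ rfl c h
    obtain ⟨n, y, hy⟩ := exists_eq_pow_mul_of_isAffineOpen X W hW (resO X hWV g) c
    refine ⟨n, y, Eq.trans hy ?_⟩
    congr 2
    exact resO_resO hWV h g
  exact key _ (Scheme.basicOpen_res X g (homOfLE hWV).op).symm c inf_le_left

/-- Sections of a vector bundle over a principal open subset of an affine open set extend after
multiplication by a power of the function that defines it. -/
lemma HasLocalFrames.exists_extension [IsIntegral X] {M : X.Modules} {r : ℕ}
    (hM : HasLocalFrames M r) {V : X.Opens} (hV : IsAffineOpen V) (g : Γ(X, V))
    (s : Γ(M, X.basicOpen g)) : ∃ (N : ℕ) (t : Γ(M, V)), res M (X.basicOpen_le g) t =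
      resO X (X.basicOpen_le g) g ^ N • s := by
  by_cases hD : ∃ x, x ∈ X.basicOpen g
  swap
  · refine ⟨0, 0, section_ext M fun x hx ↦ (hD ⟨x, hx⟩).elim⟩
  let D := X.basicOpen g
  have hDV : D ≤ V := X.basicOpen_le g
  -- the section extends locally, after multiplication by a power that does not depend on the point
  let p (S : Set X) : Prop := ∃ N : ℕ, ∀ x ∈ S, ∃ (W : X.Opens) (hWV : W ≤ V) (t : Γ(M, W)), x ∈ W ∧
    res M inf_le_left t = res M (inf_le_right : W ⊓ D ≤ D) (resO X hDV g ^ N • s)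
  have hmono {N N' : ℕ} (h : N ≤ N') {W : X.Opens} (hWV : W ≤ V) {t : Γ(M, W)}
      (ht : res M inf_le_left t = res M (inf_le_right : W ⊓ D ≤ D) (resO X hDV g ^ N • s)) :
      res M inf_le_left (resO X hWV g ^ (N' - N) • t) =
        res M (inf_le_right : W ⊓ D ≤ D) (resO X hDV g ^ N' • s) := by
    obtain ⟨d, rfl⟩ := Nat.exists_eq_add_of_le h
    rw [res_smul, ht, Nat.add_sub_cancel_left, pow_add, mul_comm, mul_smul]
    conv_rhs => rw [res_smul]
    simp only [map_pow, resO_resO]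
  obtain ⟨N, hN⟩ : p V := by
    refine hV.isCompact.induction_on (p := p) ⟨0, fun x hx ↦ hx.elim⟩
      (fun S T hST ⟨N, hN⟩ ↦ ⟨N, fun x hx ↦ hN x (hST hx)⟩) ?_ fun x hx ↦ ?_
    · rintro S T ⟨N, hN⟩ ⟨N', hN'⟩
      refine ⟨max N N', fun x hx ↦ ?_⟩
      rcases hx with hx | hx
      · obtain ⟨W, hWV, t, hxW, ht⟩ := hN x hx
        exact ⟨W, hWV, _, hxW, hmono (le_max_left _ _) hWV ht⟩
      · obtain ⟨W, hWV, t, hxW, ht⟩ := hN' x hx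
        exact ⟨W, hWV, _, hxW, hmono (le_max_right _ _) hWV ht⟩
    · obtain ⟨W, hWV, hW, hxW, b, hb⟩ := hM.exists_affine hx
      obtain ⟨c, hc⟩ := (hb.restrict (inf_le_left : W ⊓ D ≤ W)).exists_coord (res M inf_le_right s)
      choose n y hy using fun k ↦ exists_resO_eq_pow_mul hW hWV g (c k)
      let N := Finset.univ.sup n
      have hn (k) : n k ≤ N := Finset.le_sup (Finset.mem_univ k)
      refine ⟨W, mem_nhdsWithin_of_mem_nhds (W.2.mem_nhds hxW), N, fun z hz ↦
        ⟨W, hWV, ∑ k, (resO X hWV g ^ (N - n k) * y k) • b k, hz, ?_⟩⟩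
      rw [res_smul, ← hc, map_sum, Finset.smul_sum]
      refine Finset.sum_congr rfl fun k _ ↦ ?_
      rw [res_smul, smul_smul]
      congr 1
      have h1 : resO X (inf_le_left : W ⊓ D ≤ W) (y k) = _ := hy k
      rw [map_mul, h1, map_pow, map_pow, resO_resO, resO_resO, ← mul_assoc, ← pow_add,
        Nat.sub_add_cancel (hn k)]
  obtain ⟨t, ht⟩ := exists_section_of_locally M (U := V)
    (fun W t ↦ res M inf_le_left t = res M (inf_le_right : W ⊓ D ≤ D) (resO X hDV g ^ N • s))
    (fun W W' h t ht ↦ by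
      rw [res_res, ← res_res M inf_le_left (inf_le_inf_right D h), ht, res_res])
    (fun W t t' _ h h' ↦ sub_eq_zero.mp (hM.eq_zero_of_res_eq_zero hD _ (by
      rw [map_sub, h, h', sub_self])))
    fun x hx ↦ by
      obtain ⟨W, hWV, t, hxW, ht⟩ := hN x hx
      exact ⟨W, hxW, hWV, t, ht⟩
  exact ⟨N, t, ht D hDV _ rfl⟩

end Extension

section Minors

open Matrix

/-- The determinant of a product of rectangular matrices lies in the ideal of maximal minors of the
second factor. -/
lemma det_mul_mem_span_minors {R κ ι : Type*} [CommRing R] [Fintype κ] [Fintype ι] [DecidableEq κ]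
    [DecidableEq ι] (L : Matrix ι κ R) (A : Matrix κ ι R) :
    (L * A).det ∈ Ideal.span (Set.range fun s : ι → κ ↦ (A.submatrix s id).det) := by
  have h1 : (L * A) = fun j ↦ ∑ k, L j k • A.row k := by
    funext j i
    simp [Matrix.mul_apply]
  have h2 : (L * A).det = detRowAlternating.toMultilinearMap fun j ↦ ∑ k, L j k • A.row k :=
    congrArg det h1
  rw [h2, MultilinearMap.map_sum]
  refine Ideal.sum_mem _ fun s _ ↦ ?_
  rw [MultilinearMap.map_smul_univ, smul_eq_mul]
  exact Ideal.mul_mem_left _ _ (Ideal.subset_span ⟨s, rfl⟩)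

variable {X : Scheme.{u}} {F E : X.Modules} {n : ℕ} {κ : Type} [Fintype κ] [DecidableEq κ]

/-- On an open set with frames the ideal of minors is generated by the minors of the matrix of the
morphism. -/
lemma minorIdeal_eq_span (φ : F ⟶ E) {U : X.Opens} {f : Fin n → Γ(F, U)} (hf : IsFrame F U f)
    {e : κ → Γ(E, U)} (he : IsFrame E U e) : minorIdeal φ n U =
      Ideal.span (Set.range fun s : Fin n → κ ↦ ((frameMatrix φ f he).submatrix s id).det) := by
  obtain ⟨d, hd, hde⟩ := he.exists_dualFrame
  let A := frameMatrix φ f he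
  have hdual (k) (i) : dualEval (d k) (φ.app U (f i)) = A k i := by
    rw [sum_frameMatrix φ f he]
    change dualEvalₗ E U (d k) _ = _
    simp [hde, A]
  refine le_antisymm (Ideal.span_le.mpr ?_) (Ideal.span_le.mpr ?_)
  · rintro _ ⟨f', l, rfl⟩
    choose C hC using fun i ↦ hf.exists_coord (f' i)
    choose L hL using fun j ↦ hd.exists_coord (l j)
    have h1 : (of fun i j ↦ dualEval (l j) (φ.app U (f' i))) = (of L * A * (of C)ᵀ)ᵀ := by
      ext i j
      rw [of_apply, ← hL, ← hC, map_sum]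
      change dualEvalₗ E U _ _ = _
      simp only [map_sum, Scheme.Modules.Hom.app_smul, map_smul, LinearMap.sum_apply,
        LinearMap.smul_apply, dualEvalₗ_apply, hdual, smul_eq_mul, transpose_apply,
        Matrix.mul_apply, of_apply]
      exact Finset.sum_congr rfl fun k _ ↦ mul_comm _ _
    rw [SetLike.mem_coe, h1, det_transpose, det_mul]
    exact Ideal.mul_mem_right _ _ (det_mul_mem_span_minors _ _)
  · rintro _ ⟨s, rfl⟩
    refine Ideal.subset_span ⟨f, fun j ↦ d (s j), ?_⟩
    change (A.submatrix s id).det = _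
    rw [← det_transpose]
    refine congrArg det ?_
    ext i j
    rw [of_apply, hdual]
    rfl

lemma map_minorIdeal_le (φ : F ⟶ E) {U V : X.Opens} (h : V ≤ U) :
    (minorIdeal φ n U).map (resO X h) ≤ minorIdeal φ n V := by
  rw [minorIdeal, Ideal.map_span, Ideal.span_le]
  rintro _ ⟨_, ⟨f, l, rfl⟩, rfl⟩
  refine Ideal.subset_span ⟨fun i ↦ res F h (f i), fun j ↦ res _ h (l j), ?_⟩
  rw [RingHom.map_det]
  congr 1
  ext i j
  simp [resO_dualEval, app_res]

/-- The ideals of minors over affine open sets form a quasi-coherent ideal sheaf: sections over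
principal open sets extend after multiplication by powers of the defining function. -/
lemma map_minorIdeal_basicOpen [IsIntegral X] {r : ℕ} (hF : HasLocalFrames F n)
    (hE : HasLocalFrames E r) (φ : F ⟶ E) {V : X.Opens} (hV : IsAffineOpen V) (g : Γ(X, V)) :
    (minorIdeal φ n V).map (resO X (X.basicOpen_le g)) = minorIdeal φ n (X.basicOpen g) := by
  let D := X.basicOpen g
  let ρ := resO X (X.basicOpen_le g)
  have hg : IsUnit (ρ g) := RingedSpace.isUnit_res_basicOpen _ g
  refine le_antisymm (map_minorIdeal_le φ _) (Ideal.span_le.mpr ?_)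
  rintro _ ⟨f, l, rfl⟩
  choose Nf f' hf' using fun i ↦ hF.exists_extension hV g (f i)
  choose Nl l' hl' using fun i ↦ hE.dual.exists_extension hV g (l i)
  have h1 : ρ (of fun i j ↦ dualEval (l' j) (φ.app V (f' i))).det =
      (∏ i, ρ g ^ Nf i) * (∏ j, ρ g ^ Nl j) *
        (of fun i j ↦ dualEval (l j) (φ.app D (f i))).det := by
    rw [mul_assoc, ← det_mul_row, ← det_mul_column, RingHom.map_det]
    congr 1
    ext i j
    rw [RingHom.mapMatrix_apply, map_apply, of_apply, of_apply, of_apply, of_apply, resO_dualEval,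
      ← app_res, hf', hl', Scheme.Modules.Hom.app_smul, dualEval_smul_left, dualEval_smul_right]
    ring
  have h2 : IsUnit ((∏ i, ρ g ^ Nf i) * ∏ j, ρ g ^ Nl j) := by
    refine IsUnit.mul ?_ ?_ <;>
    · rw [Finset.prod_pow_eq_pow_sum]
      exact hg.pow _
  rw [SetLike.mem_coe, ← Ideal.unit_mul_mem_iff_mem _ h2, ← h1]
  exact Ideal.mem_map_of_mem _ (Ideal.subset_span ⟨f', l', rfl⟩)

lemma degeneracyIdeal_ideal [IsIntegral X] {r : ℕ} (hF : HasLocalFrames F n)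
    (hE : HasLocalFrames E r) (φ : F ⟶ E) (V : X.affineOpens) :
    (degeneracyIdeal φ n).ideal V = minorIdeal φ n V.1 := by
  let J : X.IdealSheafData :=
    { ideal := fun V ↦ minorIdeal φ n V.1
      map_ideal_basicOpen := fun V g ↦ map_minorIdeal_basicOpen hF hE φ V.2 g }
  refine le_antisymm (Scheme.IdealSheafData.ideal_ofIdeals_le _ V) ?_
  have : J ≤ degeneracyIdeal φ n := Scheme.IdealSheafData.le_ofIdeals_iff.mpr le_rfl
  exact this V

end Minors

/-! ### Degeneracy loci of Lagrangian morphisms -/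

section Loci

open Matrix

variable {Y : Scheme.{u}} {E F : Y.Modules} {n : ℕ} {ω : E ⟶ dual E} {φ : F ⟶ E}

/-- A Lagrangian morphism of vector bundles on a normal Noetherian integral scheme that degenerates
in codimension at least `2`. -/
structure IsNormalLagrangian [IsIntegral Y] (n : ℕ) (ω : E ⟶ dual E) (φ : F ⟶ E) : Prop where
  frames_source : HasLocalFrames F n
  frames_target : HasLocalFrames E (2 * n)
  symplectic : IsSymplecticForm ω
  lagrangian : IsLagrangian n ω φ
  noetherian : IsLocallyNoetherian Y
  normal : ∀ V : Y.Opens, IsAffineOpen V → Nonempty V → IsIntegrallyClosed Γ(Y, V)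
  two_le_codim : 2 ≤ codim (degeneracyLocus φ n)

section AdaptedFrames

variable {W : Y.Opens} {o : Fin n} {f : Fin n → Γ(F, W)} {q : Fin n ⊕ Fin n → Γ(E, W)}
  {a b : Γ(Y, W)}

/-- The matrix of `φ` in adapted frames. -/
lemma IsAdapted.frameMatrix_apply (h : IsAdapted ω φ W o f q a b) (k : Fin n ⊕ Fin n) (i : Fin n) :
    frameMatrix φ f h.frame_target k i = if i = o then
      (if k = .inl o then a else 0) + (if k = .inr o then b else 0) else
      if k = .inl i then 1 else 0 := by
  by_cases hi : i = o
  · subst hi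
    rw [if_pos rfl]
    refine frameMatrix_eq_of_sum φ f h.frame_target (c := fun k ↦
      (if k = .inl i then a else 0) + (if k = .inr i then b else 0)) ?_ k
    rw [h.app_self]
    simp [add_smul, Finset.sum_add_distrib]
  · rw [if_neg hi]
    refine frameMatrix_eq_of_sum φ f h.frame_target (c := fun k ↦ if k = .inl i then 1 else 0) ?_ k
    rw [h.app_of_ne i hi]
    simp

/-- In adapted frames the ideal of minors is generated by the two remaining coefficients. -/
lemma IsAdapted.minorIdeal_eq (h : IsAdapted ω φ W o f q a b) :
    minorIdeal φ n W = Ideal.span {a, b} := by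
  rw [minorIdeal_eq_span φ h.frame_source h.frame_target]
  let A := frameMatrix φ f h.frame_target
  refine le_antisymm (Ideal.span_le.mpr ?_) (Ideal.span_le.mpr ?_)
  · rintro _ ⟨s, rfl⟩
    rw [SetLike.mem_coe, ← Ideal.Quotient.eq_zero_iff_mem, RingHom.map_det]
    refine det_eq_zero_of_column_eq_zero o fun j ↦ ?_
    rw [RingHom.mapMatrix_apply, map_apply, submatrix_apply, id, h.frameMatrix_apply, if_pos rfl,
      Ideal.Quotient.eq_zero_iff_mem]
    refine Ideal.add_mem _ ?_ ?_ <;> split_ifs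
    · exact Ideal.subset_span (by simp)
    · exact Ideal.zero_mem _
    · exact Ideal.subset_span (by simp)
    · exact Ideal.zero_mem _
  -- the rows `inl` give a diagonal minor with value `a`; replacing `inl o` by `inr o` gives `b`
  · have hdiag (s : Fin n → Fin n ⊕ Fin n) (c : Γ(Y, W))
        (hs : A.submatrix s id = diagonal (Function.update 1 o c)) :
        c ∈ Ideal.span (Set.range fun s : Fin n → Fin n ⊕ Fin n ↦ (A.submatrix s id).det) := by
      refine Ideal.subset_span ⟨s, ?_⟩
      change (A.submatrix s id).det = c
      rw [hs, det_diagonal, Finset.prod_update_of_mem (Finset.mem_univ o)]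
      simp
    have hA (k) (i) : A k i = if i = o then (if k = .inl o then a else 0) +
        (if k = .inr o then b else 0) else if k = .inl i then 1 else 0 := h.frameMatrix_apply k i
    rintro x (hx | hx) <;> rw [hx]
    · refine hdiag .inl _ ?_
      ext j i
      rw [submatrix_apply, id, hA]
      by_cases hi : i = o
      · subst hi
        by_cases hj : j = i
        · subst hj; simp
        · simp [hj]
      · by_cases hj : j = i
        · subst hj; simp [hi]
        · simp [hi, hj]
    · refine hdiag (fun j ↦ if j = o then .inr o else .inl j) _ ?_
      ext j i
      rw [submatrix_apply, id, hA]
      by_cases hi : i = o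
      · subst hi
        by_cases hj : j = i
        · subst hj; simp
        · simp [hj]
      · by_cases hj : j = i
        · subst hj; simp [hi]
        · by_cases hj' : j = o
          · subst hj'; simp [hi, hj]
          · simp [hi, hj, hj']

end AdaptedFrames

lemma IsNormalLagrangian.exists_frames [IsIntegral Y] (h : IsNormalLagrangian n ω φ) {y : Y}
    {V : Y.Opens} (hy : y ∈ V) :
    ∃ U ≤ V, IsAffineOpen U ∧ y ∈ U ∧ (∃ f : Fin n → Γ(F, U), IsFrame F U f) ∧
      ∃ e : Fin (2 * n) → Γ(E, U), IsFrame E U e := by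
  obtain ⟨U, hUV, hyU, f, hf⟩ := h.frames_source.exists_le hy
  obtain ⟨U', hUU', hU', hyU', e, he⟩ := h.frames_target.exists_affine hyU
  exact ⟨U', hUU'.trans hUV, hU', hyU', ⟨_, hf.restrict hUU'⟩, _, he⟩

section Rank

variable {κ : Type} [Fintype κ] [DecidableEq κ] {U : Y.Opens} {f : Fin n → Γ(F, U)}
  {e : κ → Γ(E, U)}

/-- The rank is less than maximal exactly at the common zeros of the minors. -/
lemma rankAt_lt_iff (hf : IsFrame F U f) (he : IsFrame E U e) {y : Y} (hy : y ∈ U) :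
    rankAt φ y < n ↔ ∀ r ∈ minorIdeal φ n U, y ∉ Y.basicOpen r := by
  let ε : Γ(Y, U) →+* IsLocalRing.ResidueField (Y.presheaf.stalk y) :=
    (IsLocalRing.residue (Y.presheaf.stalk y)).comp (Y.presheaf.germ U y hy).hom
  have hε (r : Γ(Y, U)) : y ∉ Y.basicOpen r ↔ r ∈ RingHom.ker ε :=
    (Scheme.evaluation_eq_zero_iff_notMem_basicOpen Y y hy r).symm
  have h1 : (∀ r ∈ minorIdeal φ n U, y ∉ Y.basicOpen r) ↔
      ∀ s : Fin n → κ, (((frameMatrix φ f he).map ε).submatrix s id).det = 0 := by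
    simp only [hε]
    rw [← SetLike.le_def, minorIdeal_eq_span φ hf he, Ideal.span_le, Set.range_subset_iff]
    refine forall_congr' fun s ↦ ?_
    rw [SetLike.mem_coe, RingHom.mem_ker, RingHom.map_det]
    rfl
  have h2 := rank_eq_card_iff_exists_minor ((frameMatrix φ f he).map ε)
  have h3 : rankAt φ y = ((frameMatrix φ f he).map ε).rank := rankAt_eq_rank φ hf he hy
  have h4 := rank_le_card_width ((frameMatrix φ f he).map ε)
  rw [Fintype.card_fin] at h2 h4
  rw [h1, h3]
  refine ⟨fun hlt s ↦ ?_, fun h ↦ lt_of_le_of_ne h4 fun heq ↦ ?_⟩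
  · by_contra hs
    exact hlt.ne (h2.mpr ⟨s, hs⟩)
  · obtain ⟨s, hs⟩ := h2.mp heq
    exact hs (h s)

/-- Where an adapted frame exists the rank drops by at most one. -/
lemma IsAdapted.le_rankAt {W : Y.Opens} {o : Fin n} {f : Fin n → Γ(F, W)}
    {q : Fin n ⊕ Fin n → Γ(E, W)} {a b : Γ(Y, W)} (h : IsAdapted ω φ W o f q a b) {y : Y}
    (hy : y ∈ W) : n ≤ rankAt φ y + 1 := by
  let ε : Γ(Y, W) →+* IsLocalRing.ResidueField (Y.presheaf.stalk y) :=
    (IsLocalRing.residue (Y.presheaf.stalk y)).comp (Y.presheaf.germ W y hy).hom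
  let A := (frameMatrix φ f h.frame_target).map ε
  have h3 : rankAt φ y = A.rank := rankAt_eq_rank φ h.frame_source h.frame_target hy
  have hcol (i : {i // i ≠ o}) : A.col i.1 = Pi.single (.inl i.1) 1 := by
    funext k
    change ε (frameMatrix φ f h.frame_target k i) = _
    rw [h.frameMatrix_apply, if_neg i.2, Pi.single_apply]
    split_ifs <;> simp
  have hli : LinearIndependent (IsLocalRing.ResidueField (Y.presheaf.stalk y))
      fun i : {i // i ≠ o} ↦ A.col i.1 := by
    have := (Pi.basisFun (IsLocalRing.ResidueField (Y.presheaf.stalk y))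
      (Fin n ⊕ Fin n)).linearIndependent.comp (fun i : {i // i ≠ o} ↦ Sum.inl i.1)
      (fun i j hij ↦ Subtype.ext (Sum.inl_injective hij))
    convert this using 2 with i
    rw [hcol, Function.comp_apply, Pi.basisFun_apply]
  have h4 := finrank_span_eq_card hli
  have h5 : Submodule.span (IsLocalRing.ResidueField (Y.presheaf.stalk y))
        (Set.range fun i : {i // i ≠ o} ↦ A.col i.1) ≤
      Submodule.span (IsLocalRing.ResidueField (Y.presheaf.stalk y)) (Set.range A.col) :=
    Submodule.span_mono (by rintro _ ⟨i, rfl⟩; exact ⟨i.1, rfl⟩)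
  have h6 := Submodule.finrank_mono h5
  rw [h4, ← rank_eq_finrank_span_cols] at h6
  have h7 : Fintype.card {i // i ≠ o} = n - 1 := by simp [Fintype.card_subtype_compl]
  omega

end Rank

variable [IsIntegral Y]

lemma IsNormalLagrangian.two_le_coheight (h : IsNormalLagrangian n ω φ) {y : Y}
    (hy : rankAt φ y < n) : 2 ≤ Order.coheight y :=
  h.two_le_codim.trans (iInf₂_le y hy)

/-- The ideal of minors has height at least two. -/
lemma IsNormalLagrangian.two_le_height (h : IsNormalLagrangian n ω φ) {V : Y.Opens}
    (hV : IsAffineOpen V) {κ : Type} [Fintype κ] [DecidableEq κ] {f : Fin n → Γ(F, V)}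
    (hf : IsFrame F V f) {e : κ → Γ(E, V)} (he : IsFrame E V e)
    (P : Ideal Γ(Y, V)) (hP : P.IsPrime) (hle : minorIdeal φ n V ≤ P) : 2 ≤ P.height := by
  let z : PrimeSpectrum Γ(Y, V) := ⟨P, hP⟩
  have h1 : P.height = Order.coheight (hV.fromSpec z) := height_eq_coheight hV z
  rw [h1]
  refine h.two_le_coheight ((rankAt_lt_iff hf he (fromSpec_mem hV z)).mpr fun r hr ↦ ?_)
  exact (mem_asIdeal_iff_notMem_basicOpen hV z r).mp (hle hr)

/-- The locus of corank one has codimension two everywhere: locally it is defined by two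
functions, so that Krull's height theorem bounds the codimension from above. -/
lemma IsNormalLagrangian.hasPureCodim (h : IsNormalLagrangian n ω φ) :
    HasPureCodim (corankOneLocus φ n) 2 := by
  have := h.noetherian
  intro x hx hgen
  have hx' : rankAt φ x + 1 = n := hx
  refine le_antisymm ?_ (h.two_le_coheight (by omega))
  obtain ⟨V, -, -, hxV, ⟨f, hf⟩, e, he⟩ := h.exists_frames (Opens.mem_top x)
  obtain ⟨W₀, o, f', q, a, b, hxW₀, -, hA₀⟩ :=
    exists_isAdapted h.symplectic h.lagrangian hf he hxV hx
  obtain ⟨_, ⟨W, hW, rfl⟩, hxW, hWW₀⟩ :=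
    Y.isBasis_affineOpens.exists_subset_of_mem_open hxW₀ W₀.2
  replace hW : IsAffineOpen W := hW
  have hA := hA₀.restrict hWW₀
  have hlt {y : Y} (hy : y ∈ W) := rankAt_lt_iff (φ := φ) hA.frame_source hA.frame_target hy
  let z := hW.primeIdealOf ⟨x, hxW⟩
  have hz : hW.fromSpec z = x := hW.fromSpec_primeIdealOf ⟨x, hxW⟩
  have : IsNoetherianRing Γ(Y, W) := IsLocallyNoetherian.component_noetherian ⟨W, hW⟩
  -- the generic points of the locus in `W` are the minimal primes of the ideal of minors
  have hmin : z.asIdeal ∈ (minorIdeal φ n W).minimalPrimes := by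
    refine ⟨⟨z.isPrime, fun r hr ↦ ?_⟩, fun Q ⟨hQ, hle⟩ hQz ↦ ?_⟩
    · rw [mem_asIdeal_iff_notMem_basicOpen hW, hz]
      exact (hlt hxW).mp (by omega) r hr
    · let z' : PrimeSpectrum Γ(Y, W) := ⟨Q, hQ⟩
      have h1 : z' ⤳ z := (PrimeSpectrum.le_iff_specializes z' z).mp hQz
      have h2 : hW.fromSpec z' ⤳ x := by
        rw [← hz]
        exact h1.map hW.fromSpec.continuous
      have hz'W := fromSpec_mem hW z'
      have h3 : rankAt φ (hW.fromSpec z') < n := (hlt hz'W).mpr fun r hr ↦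
        (mem_asIdeal_iff_notMem_basicOpen hW z' r).mp (hle hr)
      have h4 : hW.fromSpec z' = x := hgen _ (le_antisymm h3 (hA.le_rankAt hz'W)) h2
      have h5 : z' = z := hW.fromSpec.isOpenEmbedding.injective (h4.trans hz.symm)
      exact (congrArg PrimeSpectrum.asIdeal h5).ge
  have h6 : z.asIdeal.height = Order.coheight x := by rw [height_eq_coheight hW, hz]
  rw [← h6]
  rw [hA.minorIdeal_eq] at hmin
  refine (Ideal.height_le_card_of_mem_minimalPrimes_span (Set.toFinite _) hmin).trans ?_
  have h7 := Set.ncard_insert_le (resO Y hWW₀ a) {resO Y hWW₀ b}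
  rw [Set.ncard_singleton] at h7
  exact_mod_cast h7

lemma IsNormalLagrangian.isOpen_rank (h : IsNormalLagrangian n ω φ) :
    IsOpen {y | n ≤ rankAt φ y + 1} := by
  rw [isOpen_iff_forall_mem_open]
  intro y hy
  obtain ⟨V, -, hV, hyV, ⟨f, hf⟩, e, he⟩ := h.exists_frames (Opens.mem_top y)
  by_cases hlt : rankAt φ y < n
  · have hrank : rankAt φ y + 1 = n := le_antisymm hlt hy
    obtain ⟨W, o, f', q, a, b, hyW, -, hW⟩ :=
      exists_isAdapted h.symplectic h.lagrangian hf he hyV hrank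
    exact ⟨W, fun z hz ↦ hW.le_rankAt hz, W.2, hyW⟩
  · rw [rankAt_lt_iff hf he hyV] at hlt
    push Not at hlt
    obtain ⟨r, hr, hyr⟩ := hlt
    refine ⟨Y.basicOpen r, fun z hz ↦ ?_, (Y.basicOpen r).2, hyr⟩
    by_contra hlt'
    have h1 : rankAt φ z < n := by
      rw [Set.mem_ofPred_eq] at hlt'
      omega
    exact (rankAt_lt_iff hf he (Y.basicOpen_le r hz)).mp h1 r hr hz

end Loci

/-! ### The cokernel of the transpose -/

section Resolution

open Matrix

variable {Y : Scheme.{u}} {E F : Y.Modules} {n : ℕ} {ω : E ⟶ dual E} {φ : F ⟶ E}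

lemma dualEval_transpose (ω : E ⟶ dual E) (φ : F ⟶ E) {U : Y.Opens} (e : Γ(E, U)) (f : Γ(F, U)) :
    dualEval ((transpose ω φ).app U e) f = pairing ω e (φ.app U f) := rfl

lemma dual_ext {ι : Type*} [Fintype ι] {M : Y.Modules} {U : Y.Opens} {b : ι → Γ(M, U)}
    (hb : IsFrame M U b) {l l' : Γ(dual M, U)} (h : ∀ i, dualEval l (b i) = dualEval l' (b i)) :
    l = l' := hb.hom_ext (N := structureModule Y) h

/-- The cokernel of the transpose. -/
def cokernelSheaf (ω : E ⟶ dual E) (φ : F ⟶ E) : Y.Modules := Limits.cokernel (transpose ω φ)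

/-- The projection to the cokernel of the transpose. -/
def cokernelProj (ω : E ⟶ dual E) (φ : F ⟶ E) : dual F ⟶ cokernelSheaf ω φ :=
  Limits.cokernel.π (transpose ω φ)

instance : Epi (cokernelProj ω φ) := inferInstanceAs (Epi (Limits.cokernel.π _))

lemma transpose_comp_cokernelProj (ω : E ⟶ dual E) (φ : F ⟶ E) :
    transpose ω φ ≫ cokernelProj ω φ = 0 := Limits.cokernel.condition _

lemma exact_cokernelProj (ω : E ⟶ dual E) (φ : F ⟶ E) :
    (ShortComplex.mk (transpose ω φ) (cokernelProj ω φ) (transpose_comp_cokernelProj ω φ)).Exact :=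
  ShortComplex.exact_cokernel _

lemma cokernelProj_transpose (ω : E ⟶ dual E) (φ : F ⟶ E) {V : Y.Opens} (s : Γ(E, V)) :
    (cokernelProj ω φ).app V ((transpose ω φ).app V s) = 0 :=
  CategoryTheory.congr_fun
    (congrArg (fun k ↦ Scheme.Modules.Hom.app k V) (transpose_comp_cokernelProj ω φ)) s

variable [IsIntegral Y]

lemma IsNormalLagrangian.comp_transpose (h : IsNormalLagrangian n ω φ) :
    φ ≫ transpose ω φ = 0 := by
  refine hom_ext_sections fun V m ↦ homSheaf_ext fun V' hV' m' ↦ ?_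
  have h1 : dualEval ((transpose ω φ).app V' (φ.app V' (res F hV' m))) m' = 0 := by
    rw [dualEval_transpose, h.lagrangian.pairing_eq_zero]
  rw [app_res, app_res] at h1
  exact h1

section Affine

variable {V : Y.Opens} {f : Fin n → Γ(F, V)} {e : Fin (2 * n) → Γ(E, V)}

lemma IsNormalLagrangian.minor_height (h : IsNormalLagrangian n ω φ) (hV : IsAffineOpen V)
    (hf : IsFrame F V f) (he : IsFrame E V e) (P : Ideal Γ(Y, V)) (hP : P.IsPrime)
    (hle : ∀ s : Fin n → Fin (2 * n), ((frameMatrix φ f he).submatrix s id).det ∈ P) :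
    2 ≤ P.height := by
  refine h.two_le_height hV hf he P hP ?_
  rw [minorIdeal_eq_span φ hf he, Ideal.span_le]
  rintro _ ⟨s, rfl⟩
  exact hle s

lemma app_sum_smul (φ : F ⟶ E) (f : Fin n → Γ(F, V)) (he : IsFrame E V e) (x : Fin n → Γ(Y, V)) :
    φ.app V (∑ i, x i • f i) = ∑ k, (frameMatrix φ f he *ᵥ x) k • e k := by
  simp only [map_sum, Scheme.Modules.Hom.app_smul, mulVec, dotProduct, Finset.sum_smul]
  rw [Finset.sum_comm]
  refine Finset.sum_congr rfl fun i _ ↦ ?_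
  rw [sum_frameMatrix φ f he, Finset.smul_sum]
  exact Finset.sum_congr rfl fun k _ ↦ by rw [smul_smul, mul_comm]

lemma IsNormalLagrangian.injective_app_affine (h : IsNormalLagrangian n ω φ) (hV : IsAffineOpen V)
    [Nonempty V] (hf : IsFrame F V f) (he : IsFrame E V e) : Function.Injective (φ.app V) := by
  rw [injective_iff_map_eq_zero]
  intro m hm
  obtain ⟨s, hs⟩ := exists_minor_ne_zero (h.minor_height hV hf he)
  obtain ⟨x, rfl⟩ := hf.exists_coord m
  rw [app_sum_smul φ f he] at hm
  have h1 : frameMatrix φ f he *ᵥ x = 0 := he.coord_ext (by simpa using hm)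
  rw [mulVec_injective_of_minor_ne_zero hs h1]
  simp

lemma IsNormalLagrangian.exists_app_eq_affine (h : IsNormalLagrangian n ω φ) (hV : IsAffineOpen V)
    [Nonempty V] (hf : IsFrame F V f) (he : IsFrame E V e) (s : Γ(E, V))
    (hs : (transpose ω φ).app V s = 0) : ∃ m, φ.app V m = s := by
  have := h.noetherian
  have : IsNoetherianRing Γ(Y, V) := IsLocallyNoetherian.component_noetherian ⟨V, hV⟩
  have := h.normal V hV inferInstance
  obtain ⟨x, rfl⟩ := he.exists_coord s
  have hiso : (frameMatrix φ f he)ᵀ * gram ω e * frameMatrix φ f he = 0 := by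
    ext i j
    rw [← pairing_frameMatrix, h.lagrangian.pairing_eq_zero]
    rfl
  obtain ⟨y, hy⟩ := exists_mulVec_eq_of_two_le_height (A := frameMatrix φ f he) (J := gram ω e)
    (by simp) (isUnit_det_gram h.symplectic he) hiso (h.minor_height hV hf he) (e := x) (by
      funext i
      have h1 : pairing ω (∑ k, x k • e k) (φ.app V (f i)) = 0 := by
        rw [← dualEval_transpose, hs]; rfl
      rw [sum_frameMatrix φ f he, pairing_sum, toBilin'_apply', dotProduct_mulVec] at h1
      rw [← vecMul_vecMul]
      exact h1)
  exact ⟨∑ i, y i • f i, by rw [app_sum_smul φ f he, hy]⟩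

end Affine

lemma IsNormalLagrangian.injective_app (h : IsNormalLagrangian n ω φ) (V : Y.Opens) :
    Function.Injective (φ.app V) := by
  intro s t hst
  refine section_ext F fun x hx ↦ ?_
  obtain ⟨U, hUV, hU, hxU, ⟨f, hf⟩, e, he⟩ := h.exists_frames hx
  have : Nonempty U := ⟨⟨x, hxU⟩⟩
  exact ⟨U, hUV, hxU, h.injective_app_affine hU hf he (by rw [app_res, app_res, hst])⟩

/-- `F` is the kernel of the transpose: local preimages are unique, so they glue. -/
lemma IsNormalLagrangian.exact_left (h : IsNormalLagrangian n ω φ) :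
    (ShortComplex.mk φ (transpose ω φ) h.comp_transpose).Exact := by
  refine exact_of_sections _ _ _ h.injective_app fun V s hs ↦ ?_
  obtain ⟨m, hm⟩ := exists_section_of_locally F (U := V)
    (fun W m ↦ ∃ hW : W ≤ V, φ.app W m = res E hW s)
    (fun W W' hW' m ⟨hW, hm⟩ ↦ ⟨hW'.trans hW, by rw [app_res, hm, res_res]⟩)
    (fun W m m' _ ⟨_, hm⟩ ⟨_, hm'⟩ ↦ h.injective_app W (hm.trans hm'.symm))
    fun x hx ↦ by
      obtain ⟨U, hUV, hU, hxU, ⟨f, hf⟩, e, he⟩ := h.exists_frames hx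
      have : Nonempty U := ⟨⟨x, hxU⟩⟩
      obtain ⟨m, hm⟩ := h.exists_app_eq_affine hU hf he (res E hUV s) (by
        rw [app_res, hs, map_zero])
      exact ⟨U, hxU, hUV, m, hUV, hm⟩
  refine ⟨m, section_ext E fun x hx ↦ ?_⟩
  obtain ⟨U, hUV, hU, hxU, ⟨f, hf⟩, e, he⟩ := h.exists_frames hx
  have : Nonempty U := ⟨⟨x, hxU⟩⟩
  obtain ⟨m', hm'⟩ := h.exists_app_eq_affine hU hf he (res E hUV s) (by
    rw [app_res, hs, map_zero])
  refine ⟨U, hUV, hxU, ?_⟩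
  rw [← app_res, hm U hUV m' ⟨hUV, hm'⟩, hm']

/-- The ideal of minors annihilates the cokernel, by Cramer's rule. -/
lemma IsNormalLagrangian.minor_smul_eq_zero (h : IsNormalLagrangian n ω φ) {V : Y.Opens}
    {r : Γ(Y, V)} (hr : r ∈ minorIdeal φ n V) (s : Γ(cokernelSheaf ω φ, V)) : r • s = 0 := by
  refine section_ext _ fun x hx ↦ ?_
  obtain ⟨W, hWV, hxW, t, ht⟩ := locally_surjective_of_epi (cokernelProj ω φ) V s x hx
  obtain ⟨U, hUW, hU, hxU, ⟨f, hf⟩, e, he⟩ := h.exists_frames hxW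
  refine ⟨U, hUW.trans hWV, hxU, ?_⟩
  rw [map_zero, res_smul, ← res_res _ hWV hUW, ← ht, ← app_res]
  have hr' : resO Y (hUW.trans hWV) r ∈ minorIdeal φ n U :=
    map_minorIdeal_le φ _ (Ideal.mem_map_of_mem _ hr)
  generalize resO Y (hUW.trans hWV) r = r' at hr'
  generalize res (dual F) hUW t = t'
  rw [minorIdeal_eq_span φ hf he] at hr'
  induction hr' using Submodule.span_induction with
  | zero => exact zero_smul _ _
  | add a b _ _ ha hb => rw [add_smul, ha, hb, add_zero]
  | smul c a _ ha => rw [smul_eq_mul, mul_smul, ha, smul_zero]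
  | mem a ha =>
    obtain ⟨s, rfl⟩ := ha
    let A := frameMatrix φ f he
    -- the functional on `E` that solves the linear system by Cramer's rule
    obtain ⟨d, hd, hde⟩ := he.exists_dualFrame
    let τ : Fin n → Γ(Y, U) := fun i ↦ dualEval t' (f i)
    let l : Γ(dual E, U) := ∑ j, (τ ᵥ* (A.submatrix s id).adjugate) j • d (s j)
    obtain ⟨v, hv⟩ := exists_pairing_eq h.symplectic l
    have h1 : (A.submatrix s id).det • t' = (transpose ω φ).app U v := by
      refine dual_ext hf fun i ↦ ?_
      rw [dualEval_transpose, pairing, hv, dualEval_smul_left]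
      have h2 (k) : dualEval (d k) (φ.app U (f i)) = A k i := by
        rw [sum_frameMatrix φ f he]
        change dualEvalₗ E U (d k) _ = _
        simp [hde, A]
      have h3 : dualEval l (φ.app U (f i)) =
          ((τ ᵥ* (A.submatrix s id).adjugate) ᵥ* A.submatrix s id) i := by
        change dualEvalₗ E U l _ = _
        simp only [l, map_sum, LinearMap.sum_apply, map_smul, LinearMap.smul_apply,
          dualEvalₗ_apply, h2, smul_eq_mul]
        rfl
      rw [h3, vecMul_vecMul, adjugate_mul]
      simp [τ, vecMul_smul]
    change (A.submatrix s id).det • _ = 0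
    rw [← Scheme.Modules.Hom.app_smul, h1, cokernelProj_transpose]

/-- The ideal of minors is nonzero over every nonempty affine open set, so its elements exhibit
the sections of the cokernel as torsion. -/
lemma IsNormalLagrangian.isTorsionSheaf (h : IsNormalLagrangian n ω φ) :
    IsTorsionSheaf (cokernelSheaf ω φ) := by
  intro V s
  by_cases hne : ∃ y, y ∈ V.1
  swap
  · have hs : s = 0 := section_ext _ fun x hx ↦ (hne ⟨x, hx⟩).elim
    exact ⟨1, by rw [hs, smul_zero]⟩
  obtain ⟨y, hy⟩ := hne
  obtain ⟨U, hUV, hU, hyU, ⟨f, hf⟩, e, he⟩ := h.exists_frames hy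
  obtain ⟨g, hgU, hyg⟩ := V.2.exists_basicOpen_le ⟨y, hyU⟩ hy
  have hf' := hf.restrict hgU
  have he' := he.restrict hgU
  have : Nonempty (Y.basicOpen g) := ⟨⟨y, hyg⟩⟩
  obtain ⟨σ, hσ⟩ := exists_minor_ne_zero (h.minor_height (V.2.basicOpen g) hf' he')
  have hmem : ((frameMatrix φ (fun i ↦ res F hgU (f i)) he').submatrix σ id).det ∈
      minorIdeal φ n (Y.basicOpen g) := by
    rw [minorIdeal_eq_span φ hf' he']
    exact Ideal.subset_span ⟨σ, rfl⟩
  rw [← map_minorIdeal_basicOpen h.frames_source h.frames_target φ V.2 g] at hmem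
  obtain ⟨r, hr, hr0⟩ : ∃ r ∈ minorIdeal φ n V.1, r ≠ 0 := by
    by_contra! hall
    have hbot : minorIdeal φ n V.1 = ⊥ := (Submodule.eq_bot_iff _).mpr hall
    rw [hbot, Ideal.map_bot] at hmem
    exact hσ hmem
  have : Nonempty V.1 := ⟨⟨y, hy⟩⟩
  exact ⟨⟨r, mem_nonZeroDivisors_of_ne_zero hr0⟩, h.minor_smul_eq_zero hr s⟩

lemma IsNormalLagrangian.isSupportedOn (h : IsNormalLagrangian n ω φ) :
    IsSupportedOn (cokernelSheaf ω φ) (degeneracyLocus φ n) := by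
  intro y hy
  obtain ⟨U, -, -, hyU, ⟨f, hf⟩, e, he⟩ := h.exists_frames (Opens.mem_top y)
  have hy' : ¬ ∀ r ∈ minorIdeal φ n U, y ∉ Y.basicOpen r := fun h' ↦
    hy ((rankAt_lt_iff hf he hyU).mpr h')
  push Not at hy'
  obtain ⟨r, hr, hyr⟩ := hy'
  refine subsingleton_of_forall_eq 0 fun m ↦ ?_
  obtain ⟨V, hVU, hyV, s, rfl⟩ := (cokernelSheaf ω φ).presheaf.exists_le_germ_eq m hyU
  have hunit : IsUnit (Y.presheaf.germ V y hyV (resO Y hVU r)) := by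
    rw [germ_resO]
    exact (Y.mem_basicOpen r y hyU).mp hyr
  have h1 : Y.presheaf.germ V y hyV (resO Y hVU r) • germM (cokernelSheaf ω φ) y hyV s = 0 := by
    rw [← germM_smul, h.minor_smul_eq_zero (map_minorIdeal_le φ hVU (Ideal.mem_map_of_mem _ hr)),
      map_zero]
  exact hunit.smul_eq_zero.mp h1

end Resolution

/-! ### The cokernel in adapted frames -/

section LocalModel

open Matrix

variable {Y : Scheme.{u}} {E F : Y.Modules} {n : ℕ} {ω : E ⟶ dual E} {φ : F ⟶ E}

section Gram

variable {ι : Type} [Fintype ι] [DecidableEq ι] {W : Y.Opens} {q : ι ⊕ ι → Γ(E, W)}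

lemma pairing_sum_left (ω : E ⟶ dual E) {U : Y.Opens} {κ : Type*} [Fintype κ] (x : κ → Γ(Y, U))
    (s : κ → Γ(E, U)) (t : Γ(E, U)) :
    pairing ω (∑ k, x k • s k) t = ∑ k, x k * pairing ω (s k) t := by
  change formOn ω U _ t = _
  simp [formOn_apply]

/-- The value of a symplectic form in terms of a symplectic frame. -/
lemma pairing_eq_sum_of_gram (hω : IsSymplecticForm ω) (hq : IsFrame E W q)
    (hg : gram ω q = fromBlocks 0 1 (-1) 0) (s t : Γ(E, W)) :
    pairing ω s t = ∑ k, (pairing ω s (q (.inl k)) * pairing ω t (q (.inr k)) -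
      pairing ω s (q (.inr k)) * pairing ω t (q (.inl k))) := by
  have hg' (k l) : pairing ω (q k) (q l) = (fromBlocks 0 1 (-1) 0 : Matrix (ι ⊕ ι) (ι ⊕ ι) _) k l :=
    congrFun (congrFun hg k) l
  obtain ⟨x, rfl⟩ := hq.exists_coord s
  have h1 (k) : pairing ω (∑ j, x j • q j) (q (.inl k)) = - x (.inr k) := by
    rw [pairing_sum_left]
    simp [hg', Matrix.one_apply]
  have h2 (k) : pairing ω (∑ j, x j • q j) (q (.inr k)) = x (.inl k) := by
    rw [pairing_sum_left]
    simp [hg', Matrix.one_apply]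
  simp only [h1, h2]
  rw [pairing_sum_left, Fintype.sum_sum_type, ← Finset.sum_add_distrib]
  refine Finset.sum_congr rfl fun k _ ↦ ?_
  rw [pairing_neg hω (q (.inl k)) t, pairing_neg hω (q (.inr k)) t]
  ring

end Gram

section Adapted

variable {W : Y.Opens} {o : Fin n} {f : Fin n → Γ(F, W)} {q : Fin n ⊕ Fin n → Γ(E, W)}
  {a b : Γ(Y, W)}

lemma IsAdapted.pairing_inl_inl (h : IsAdapted ω φ W o f q a b) (i j : Fin n) :
    pairing ω (q (.inl i)) (q (.inl j)) = 0 :=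
  congrFun (congrFun h.gram_eq (.inl i)) (.inl j)

lemma IsAdapted.pairing_inl_inr (h : IsAdapted ω φ W o f q a b) (i j : Fin n) :
    pairing ω (q (.inl i)) (q (.inr j)) = if i = j then 1 else 0 :=
  (congrFun (congrFun h.gram_eq (.inl i)) (.inr j)).trans (Matrix.one_apply ..)

lemma IsAdapted.pairing_inr_inl (h : IsAdapted ω φ W o f q a b) (i j : Fin n) :
    pairing ω (q (.inr i)) (q (.inl j)) = if i = j then -1 else 0 := by
  refine (congrFun (congrFun h.gram_eq (.inr i)) (.inl j)).trans ?_
  simp only [fromBlocks_apply₂₁, Matrix.neg_apply, Matrix.one_apply]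
  split_ifs <;> simp

lemma IsAdapted.pairing_inr_inr (h : IsAdapted ω φ W o f q a b) (i j : Fin n) :
    pairing ω (q (.inr i)) (q (.inr j)) = 0 :=
  congrFun (congrFun h.gram_eq (.inr i)) (.inr j)

lemma pairing_add_right (ω : E ⟶ dual E) {U : Y.Opens} (s t t' : Γ(E, U)) :
    pairing ω s (t + t') = pairing ω s t + pairing ω s t' := dualEval_add_right _ _ _

lemma pairing_smul_right (ω : E ⟶ dual E) {U : Y.Opens} (r : Γ(Y, U)) (s t : Γ(E, U)) :
    pairing ω s (r • t) = r * pairing ω s t := dualEval_smul_right _ _ _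

lemma IsAdapted.pairing_app_self (h : IsAdapted ω φ W o f q a b) (s : Γ(E, W)) :
    pairing ω s (φ.app W (f o)) =
      pairing ω s (q (.inl o)) * a + pairing ω s (q (.inr o)) * b := by
  rw [h.app_self, pairing_add_right, pairing_smul_right, pairing_smul_right, mul_comm, mul_comm b]

lemma IsAdapted.pairing_inl_app (h : IsAdapted ω φ W o f q a b) (i : Fin n) :
    pairing ω (q (.inl o)) (φ.app W (f i)) = if i = o then b else 0 := by
  split_ifs with hi
  · subst hi
    simp [h.pairing_app_self, h.pairing_inl_inl, h.pairing_inl_inr]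
  · rw [h.app_of_ne i hi, h.pairing_inl_inl]

lemma IsAdapted.pairing_inr_app (h : IsAdapted ω φ W o f q a b) (i : Fin n) :
    pairing ω (q (.inr o)) (φ.app W (f i)) = if i = o then -a else 0 := by
  split_ifs with hi
  · subst hi
    simp [h.pairing_app_self, h.pairing_inr_inl, h.pairing_inr_inr]
  · rw [h.app_of_ne i hi, h.pairing_inr_inl, if_neg (Ne.symm hi)]

/-- The family `d` is the dual frame of `f`. -/
def IsDualFrame {ι : Type*} [DecidableEq ι] {M : Y.Modules} {U : Y.Opens} (f : ι → Γ(M, U))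
    (d : ι → Γ(dual M, U)) : Prop :=
  ∀ i j, dualEval (d i) (f j) = if i = j then 1 else 0

lemma IsDualFrame.restrict {ι : Type*} [DecidableEq ι] {M : Y.Modules} {U V : Y.Opens}
    {f : ι → Γ(M, U)} {d : ι → Γ(dual M, U)} (h : IsDualFrame f d) (hV : V ≤ U) :
    IsDualFrame (fun i ↦ res M hV (f i)) fun i ↦ res (dual M) hV (d i) := fun i j ↦ by
  rw [← resO_dualEval, h i j]
  split_ifs <;> simp

lemma IsDualFrame.eq_sum {ι : Type*} [DecidableEq ι] [Fintype ι] {M : Y.Modules} {U : Y.Opens}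
    {f : ι → Γ(M, U)} {d : ι → Γ(dual M, U)} (h : IsDualFrame f d) (hf : IsFrame M U f)
    (l : Γ(dual M, U)) : l = ∑ i, dualEval l (f i) • d i := by
  refine dual_ext hf fun j ↦ ?_
  change _ = dualEvalₗ M U _ _
  simp [h _ j]

variable {d : Fin n → Γ(dual F, W)}

/-- All members but one of the dual frame of an adapted frame are killed in the cokernel. -/
lemma IsAdapted.proj_dual_of_ne (h : IsAdapted ω φ W o f q a b) (hd : IsDualFrame f d)
    {i : Fin n} (hi : i ≠ o) : (cokernelProj ω φ).app W (d i) = 0 := by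
  have h1 : d i = (transpose ω φ).app W (-q (.inr i)) := by
    refine dual_ext h.frame_source fun j ↦ ?_
    rw [map_neg, hd]
    change _ = -dualEval ((transpose ω φ).app W (q (.inr i))) (f j)
    rw [dualEval_transpose]
    by_cases hj : j = o
    · subst hj
      rw [h.pairing_app_self, h.pairing_inr_inl, h.pairing_inr_inr, if_neg hi, if_neg hi]
      simp
    · rw [h.app_of_ne j hj, h.pairing_inr_inl]
      split_ifs <;> simp
  rw [h1, cokernelProj_transpose]

/-- The cokernel is generated by the class of the remaining member of the dual frame. -/
lemma IsAdapted.proj_eq (h : IsAdapted ω φ W o f q a b) (hd : IsDualFrame f d)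
    (l : Γ(dual F, W)) : (cokernelProj ω φ).app W l =
      dualEval l (f o) • (cokernelProj ω φ).app W (d o) := by
  conv_lhs => rw [hd.eq_sum h.frame_source l]
  rw [map_sum, Finset.sum_eq_single o]
  · rw [Scheme.Modules.Hom.app_smul]
  · intro i _ hi
    rw [Scheme.Modules.Hom.app_smul, h.proj_dual_of_ne hd hi, smul_zero]
  · simp

lemma IsAdapted.exists_smul_eq (h : IsAdapted ω φ W o f q a b) (hd : IsDualFrame f d)
    (s : Γ(cokernelSheaf ω φ, W)) (x : Y) (hx : x ∈ W) : ∃ (V : Y.Opens) (hV : V ≤ W),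
      x ∈ V ∧ ∃ c : Γ(Y, V), c • res _ hV ((cokernelProj ω φ).app W (d o)) = res _ hV s := by
  obtain ⟨V, hV, hxV, t, ht⟩ := locally_surjective_of_epi (cokernelProj ω φ) W s x hx
  refine ⟨V, hV, hxV, dualEval t (res F hV (f o)), ?_⟩
  rw [← ht, (h.restrict hV).proj_eq (hd.restrict hV) t, app_res]

/-- The annihilator of the generator of the cokernel is the ideal of minors: if `c d_o` is the
transpose of `v`, then `c = ⟨v, φ f_o⟩` is a combination of the two coefficients. -/
lemma IsAdapted.mem_minorIdeal_of_smul_eq_zero (h : IsAdapted ω φ W o f q a b)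
    (hd : IsDualFrame f d) {c : Γ(Y, W)} (hc : c • (cokernelProj ω φ).app W (d o) = 0) (x : Y)
    (hx : x ∈ W) : ∃ (V : Y.Opens) (hV : V ≤ W), x ∈ V ∧ resO Y hV c ∈ minorIdeal φ n V := by
  rw [← Scheme.Modules.Hom.app_smul] at hc
  obtain ⟨V, hV, hxV, v, hv⟩ := exists_locally_of_exact (exact_cokernelProj ω φ) W _ hc x hx
  refine ⟨V, hV, hxV, ?_⟩
  have hA := h.restrict hV
  have h1 : resO Y hV c = pairing ω v (φ.app V (res F hV (f o))) := by
    rw [← dualEval_transpose, hv, ← resO_dualEval, dualEval_smul_left, hd, if_pos rfl, mul_one]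
  rw [h1, hA.minorIdeal_eq, hA.pairing_app_self, Ideal.mem_span_pair]
  exact ⟨_, _, rfl⟩

variable [IsIntegral Y]

/-- The two coefficients of an adapted frame satisfy only the trivial relations. -/
lemma IsAdapted.mem_minorIdeal_of_relation (hN : IsNormalLagrangian n ω φ)
    (h : IsAdapted ω φ W o f q a b) (hW : IsAffineOpen W) {c c' : Γ(Y, W)}
    (hc : c * a + c' * b = 0) : c ∈ minorIdeal φ n W ∧ c' ∈ minorIdeal φ n W := by
  by_cases hne : Nonempty W
  swap
  · have hbot : W = ⊥ := by
      ext x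
      exact ⟨fun hx ↦ (hne ⟨⟨x, hx⟩⟩).elim, fun hx ↦ hx.elim⟩
    have : ∀ r : Γ(Y, W), r = 0 := section_eq_zero_of_eq_bot (structureModule Y) hbot
    rw [this c, this c']
    exact ⟨Ideal.zero_mem _, Ideal.zero_mem _⟩
  have := hN.noetherian
  have : IsNoetherianRing Γ(Y, W) := IsLocallyNoetherian.component_noetherian ⟨W, hW⟩
  have := hN.normal W hW hne
  have hI (P : Ideal Γ(Y, W)) (hP : P.IsPrime) (hle : Ideal.span {a, b} ≤ P) : 2 ≤ P.height :=
    hN.two_le_height hW h.frame_source h.frame_target P hP (by rwa [h.minorIdeal_eq])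
  rw [h.minorIdeal_eq]
  -- off the common zeros of `a` and `b` there is nothing to show
  by_cases htop : Ideal.span {a, b} = ⊤
  · rw [htop]
    exact ⟨Submodule.mem_top, Submodule.mem_top⟩
  have hI' (P : Ideal Γ(Y, W)) (hP : P.IsPrime) (hle : Ideal.span {b, a} ≤ P) : 2 ≤ P.height :=
    hI P hP (by rwa [Ideal.span_pair_comm])
  have htop' : Ideal.span {b, a} ≠ ⊤ := by rwa [Ideal.span_pair_comm]
  have h1 : a ∣ c' := dvd_of_dvd_mul_of_two_le_height (ne_zero_of_two_le_height hI htop) hI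
    ⟨-c, by linear_combination hc⟩
  have h2 : b ∣ c := dvd_of_dvd_mul_of_two_le_height (ne_zero_of_two_le_height hI' htop') hI'
    ⟨-c', by linear_combination hc⟩
  exact ⟨Ideal.mem_of_dvd _ h2 (Ideal.subset_span (by simp)),
    Ideal.mem_of_dvd _ h1 (Ideal.subset_span (by simp))⟩

end Adapted

section Transition

variable {W : Y.Opens} {o o' : Fin n} {f f' : Fin n → Γ(F, W)} {q q' : Fin n ⊕ Fin n → Γ(E, W)}
  {a b a' b' : Γ(Y, W)} {d d' : Fin n → Γ(dual F, W)}

/-- For a section `e` of `E` the element `∑ ⟨e, φ f_j⟩ ⊗ f_j^*` does not depend on the frame `f`.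
In an adapted frame only the term with `j = o` survives in the cokernel. The tensors are tested on
pairs of semilinear maps. -/
lemma IsAdapted.sum_pairing_smul (h : IsAdapted ω φ W o f q a b) (hd : IsDualFrame f d)
    (h' : IsAdapted ω φ W o' f' q' a' b') (hd' : IsDualFrame f' d') {J : Ideal Γ(Y, W)}
    (ha : a ∈ J) (hb : b ∈ J) {e : Γ(E, W)}
    (he : ∀ j, pairing ω e (φ.app W (f' j)) ∈ J) {S Q : Type*} [CommRing S] [AddCommGroup Q]
    [Module S Q] (ρ : Γ(Y, W) →+* S) (ν : J →ₛₗ[ρ] S) (η : Γ(cokernelSheaf ω φ, W) →ₛₗ[ρ] Q) :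
    ν ⟨_, he o'⟩ • η ((cokernelProj ω φ).app W (d' o')) =
      (ρ (pairing ω e (q (.inl o))) * ν ⟨a, ha⟩ + ρ (pairing ω e (q (.inr o))) * ν ⟨b, hb⟩) •
        η ((cokernelProj ω φ).app W (d o)) := by
  choose P hP using fun j ↦ h'.frame_source.exists_coord (f j)
  have hev (j : Fin n) : pairing ω e (φ.app W (f j)) =
      ∑ k, P j k * pairing ω e (φ.app W (f' k)) := by
    rw [← hP j, map_sum]
    change dualEvalₗ E W (ω.app W e) _ = _
    rw [map_sum]
    refine Finset.sum_congr rfl fun k _ ↦ ?_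
    rw [Scheme.Modules.Hom.app_smul]
    exact dualEval_smul_right _ _ _
  have hf (j : Fin n) : pairing ω e (φ.app W (f j)) ∈ J := by
    rw [hev]
    exact Ideal.sum_mem _ fun k _ ↦ Ideal.mul_mem_left _ _ (he k)
  have hdd (k : Fin n) : d' k = ∑ j, P j k • d j := by
    rw [hd.eq_sum h.frame_source (d' k)]
    refine Finset.sum_congr rfl fun j _ ↦ ?_
    congr 1
    rw [← hP j]
    change dualEvalₗ F W (d' k) _ = _
    simp [hd' k _]
  let γ (j : Fin n) := η ((cokernelProj ω φ).app W (d j))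
  let γ' (j : Fin n) := η ((cokernelProj ω φ).app W (d' j))
  have hγ (j : Fin n) (hj : j ≠ o) : γ j = 0 := by
    simp only [γ]
    rw [h.proj_dual_of_ne hd hj, map_zero]
  have hγ' (j : Fin n) (hj : j ≠ o') : γ' j = 0 := by
    simp only [γ']
    rw [h'.proj_dual_of_ne hd' hj, map_zero]
  have h1 : ∑ k, ν ⟨_, he k⟩ • γ' k = ∑ j, ν ⟨_, hf j⟩ • γ j := by
    have h2 (k : Fin n) : γ' k = ∑ j, ρ (P j k) • γ j := by
      simp only [γ', γ]
      rw [hdd k, map_sum, map_sum]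
      refine Finset.sum_congr rfl fun j _ ↦ ?_
      rw [Scheme.Modules.Hom.app_smul, map_smulₛₗ]
    have h3 (j : Fin n) : ν ⟨_, hf j⟩ = ∑ k, ρ (P j k) * ν ⟨_, he k⟩ := by
      have h4 : (⟨_, hf j⟩ : J) = ∑ k, P j k • (⟨_, he k⟩ : J) := by
        refine Subtype.ext ?_
        refine (hev j).trans ?_
        simp
      rw [h4, map_sum]
      exact Finset.sum_congr rfl fun k _ ↦ map_smulₛₗ ν _ _
    simp only [h2, h3, Finset.smul_sum, Finset.sum_smul, smul_smul]
    rw [Finset.sum_comm]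
    exact Finset.sum_congr rfl fun j _ ↦ Finset.sum_congr rfl fun k _ ↦ by rw [mul_comm]
  rw [Finset.sum_eq_single o' (fun k _ hk ↦ by rw [hγ' k hk, smul_zero]) (by simp),
    Finset.sum_eq_single o (fun k _ hk ↦ by rw [hγ k hk, smul_zero]) (by simp)] at h1
  refine h1.trans ?_
  congr 1
  have h5 : (⟨_, hf o⟩ : J) = pairing ω e (q (.inl o)) • (⟨a, ha⟩ : J) +
      pairing ω e (q (.inr o)) • (⟨b, hb⟩ : J) := Subtype.ext (h.pairing_app_self e)
  rw [h5, map_add, map_smulₛₗ, map_smulₛₗ, smul_eq_mul, smul_eq_mul]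

/-- The components of `q' (inl o')` and `q' (inr o')` in the hyperbolic plane of `q (inl o)` and
`q (inr o)` form a matrix of determinant one modulo the ideal of minors: the pairings of the two
vectors with `q (inl j) = φ f_j` lie in this ideal for `j ≠ o`, so that the other hyperbolic planes
do not contribute to `⟨q' (inl o'), q' (inr o')⟩ = 1`. -/
lemma IsAdapted.transition_det (hω : IsSymplecticForm ω) (h : IsAdapted ω φ W o f q a b)
    (h' : IsAdapted ω φ W o' f' q' a' b') {J : Ideal Γ(Y, W)} (ha' : a' ∈ J) (hb' : b' ∈ J) :
    pairing ω (q' (.inl o')) (q (.inl o)) * pairing ω (q' (.inr o')) (q (.inr o)) -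
      pairing ω (q' (.inl o')) (q (.inr o)) * pairing ω (q' (.inr o')) (q (.inl o)) - 1 ∈ J := by
  choose P hP using fun j ↦ h'.frame_source.exists_coord (f j)
  have hev (e : Γ(E, W)) (he : ∀ k, pairing ω e (φ.app W (f' k)) ∈ J) (j : Fin n) :
      pairing ω e (φ.app W (f j)) ∈ J := by
    rw [← hP j, map_sum]
    change dualEvalₗ E W (ω.app W e) _ ∈ _
    rw [map_sum]
    refine Ideal.sum_mem _ fun k _ ↦ ?_
    rw [Scheme.Modules.Hom.app_smul, map_smul, smul_eq_mul]
    exact Ideal.mul_mem_left _ _ (he k)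
  have h1 (j : Fin n) (hj : j ≠ o) : pairing ω (q' (.inl o')) (q (.inl j)) ∈ J := by
    rw [← h.app_of_ne j hj]
    refine hev _ (fun k ↦ ?_) j
    rw [h'.pairing_inl_app]
    split_ifs
    exacts [hb', Ideal.zero_mem _]
  have h2 (j : Fin n) (hj : j ≠ o) : pairing ω (q' (.inr o')) (q (.inl j)) ∈ J := by
    rw [← h.app_of_ne j hj]
    refine hev _ (fun k ↦ ?_) j
    rw [h'.pairing_inr_app]
    split_ifs
    exacts [neg_mem ha', Ideal.zero_mem _]
  have h3 : pairing ω (q' (.inl o')) (q' (.inr o')) = 1 := by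
    rw [h'.pairing_inl_inr, if_pos rfl]
  rw [pairing_eq_sum_of_gram hω h.frame_target h.gram_eq,
    ← Finset.add_sum_erase _ _ (Finset.mem_univ o)] at h3
  have h4 := Ideal.sum_mem J (t := Finset.univ.erase o) (f := fun k ↦
    pairing ω (q' (.inl o')) (q (.inl k)) * pairing ω (q' (.inr o')) (q (.inr k)) -
      pairing ω (q' (.inl o')) (q (.inr k)) * pairing ω (q' (.inr o')) (q (.inl k))) fun k hk ↦ by
    have hk := Finset.ne_of_mem_erase hk
    exact sub_mem (Ideal.mul_mem_right _ _ (h1 k hk)) (Ideal.mul_mem_left _ _ (h2 k hk))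
  convert neg_mem h4 using 1
  linear_combination h3

end Transition

end LocalModel

/-! ### Homomorphisms out of locally generated modules -/

section Generation

variable {X : Scheme.{u}} {ι : Type*} [Fintype ι]

/-- The sections `b` of `M` over `W` generate `M` locally on `W`. -/
def LocallyGenerate (M : X.Modules) (W : X.Opens) (b : ι → Γ(M, W)) : Prop :=
  ∀ (V : X.Opens) (hV : V ≤ W) (m : Γ(M, V)), ∀ x ∈ V, ∃ (V' : X.Opens) (h : V' ≤ V), x ∈ V' ∧
    ∃ c : ι → Γ(X, V'), ∑ k, c k • res M (h.trans hV) (b k) = res M h m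

/-- A homomorphism out of a locally generated module is given by the images of the generators,
if the coefficients of all relations act as zero on the target. -/
lemma LocallyGenerate.exists_hom {M N : X.Modules} {W : X.Opens} {b : ι → Γ(M, W)}
    (hb : LocallyGenerate M W b)
    (hrel : ∀ (V : X.Opens) (hV : V ≤ W) (c : ι → Γ(X, V)), ∑ k, c k • res M hV (b k) = 0 →
      ∀ (k : ι) (t : Γ(N, V)), c k • t = 0) (n : ι → Γ(N, W)) :
    ∃ f : Γ(homSheaf M N, W), ∀ k, homEval f le_rfl (b k) = n k := by
  -- `t` is the value on `m|_V'` computed from an expression of `m|_V'` in the generators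
  let P (V : X.Opens) (m : Γ(M, V)) (V' : X.Opens) (t : Γ(N, V')) : Prop :=
    ∃ (hV' : V' ≤ W) (h : V' ≤ V) (c : ι → Γ(X, V')),
      ∑ k, c k • res M hV' (b k) = res M h m ∧ t = ∑ k, c k • res N hV' (n k)
  have hPres (V : X.Opens) (m : Γ(M, V)) (V₁ V₂ : X.Opens) (h : V₂ ≤ V₁) (s : Γ(N, V₁))
      (hs : P V m V₁ s) : P V m V₂ (res N h s) := by
    obtain ⟨h1, h2, c, hc, rfl⟩ := hs
    refine ⟨h.trans h1, h.trans h2, fun k ↦ resO X h (c k), ?_, ?_⟩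
    · rw [← res_res M h2 h, ← hc, map_sum]
      exact Finset.sum_congr rfl fun k _ ↦ by rw [res_smul, res_res]
    · rw [map_sum]
      exact Finset.sum_congr rfl fun k _ ↦ by rw [res_smul, res_res]
  have huniq (V : X.Opens) (m : Γ(M, V)) (V' : X.Opens) (s t : Γ(N, V')) (hs : P V m V' s)
      (ht : P V m V' t) : s = t := by
    obtain ⟨h1, h2, c, hc, rfl⟩ := hs
    obtain ⟨_, _, c', hc', rfl⟩ := ht
    rw [← sub_eq_zero, ← Finset.sum_sub_distrib]
    refine Finset.sum_eq_zero fun k _ ↦ ?_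
    rw [← sub_smul]
    refine hrel V' h1 (fun k ↦ c k - c' k) ?_ k _
    simp only [sub_smul, Finset.sum_sub_distrib, hc, hc', sub_self]
  have hex (V : X.Opens) (hV : V ≤ W) (m : Γ(M, V)) : ∀ x ∈ V, ∃ V' : X.Opens, x ∈ V' ∧ V' ≤ V ∧
      ∃ s, P V m V' s := fun x hx ↦ by
    obtain ⟨V', h, hxV', c, hc⟩ := hb V hV m x hx
    exact ⟨V', hxV', h, _, h.trans hV, h, c, hc, rfl⟩
  choose g hg using fun (V : X.Opens) (hV : V ≤ W) (m : Γ(M, V)) ↦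
    exists_section_of_locally N (P V m) (hPres V m) (fun V' s t _ ↦ huniq V m V' s t)
      (hex V hV m)
  have hcomb (V : X.Opens) (hV : V ≤ W) (m : Γ(M, V)) (V' : X.Opens) (h : V' ≤ V)
      (c : ι → Γ(X, V')) (hc : ∑ k, c k • res M (h.trans hV) (b k) = res M h m) :
      res N h (g V hV m) = ∑ k, c k • res N (h.trans hV) (n k) :=
    hg V hV m V' h _ ⟨h.trans hV, h, c, hc, rfl⟩
  have hadd (V : X.Opens) (hV : V ≤ W) (m m' : Γ(M, V)) :
      g V hV (m + m') = g V hV m + g V hV m' := by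
    refine section_ext N fun x hx ↦ ?_
    obtain ⟨V₁, h₁, hx₁, c₁, hc₁⟩ := hb V hV m x hx
    obtain ⟨V₂, h₂, hx₂, c₂, hc₂⟩ := hb V₁ (h₁.trans hV) (res M h₁ m') x hx₁
    have h12 := h₂.trans h₁
    have hc₁' : ∑ k, resO X h₂ (c₁ k) • res M (h12.trans hV) (b k) = res M h12 m := by
      rw [← res_res M h₁ h₂, ← hc₁, map_sum]
      exact Finset.sum_congr rfl fun k _ ↦ by rw [res_smul, res_res]
    rw [res_res] at hc₂
    refine ⟨V₂, h12, hx₂, ?_⟩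
    rw [map_add, hcomb V hV m V₂ h12 _ hc₁', hcomb V hV m' V₂ h12 _ hc₂,
      hcomb V hV _ V₂ h12 (fun k ↦ resO X h₂ (c₁ k) + c₂ k), ← Finset.sum_add_distrib]
    · exact Finset.sum_congr rfl fun k _ ↦ add_smul _ _ _
    · simp only [add_smul, Finset.sum_add_distrib, hc₁', hc₂, map_add]
  have hsmul (V : X.Opens) (hV : V ≤ W) (r : Γ(X, V)) (m : Γ(M, V)) :
      g V hV (r • m) = r • g V hV m := by
    refine section_ext N fun x hx ↦ ?_
    obtain ⟨V', h, hxV', c, hc⟩ := hb V hV m x hx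
    refine ⟨V', h, hxV', ?_⟩
    rw [res_smul, hcomb V hV m V' h c hc, hcomb V hV _ V' h (fun k ↦ resO X h r * c k),
      Finset.smul_sum]
    · exact Finset.sum_congr rfl fun k _ ↦ mul_smul _ _ _
    · simp only [mul_smul, ← Finset.smul_sum, hc, res_smul]
  have hres (V V' : X.Opens) (hV : V ≤ W) (h : V' ≤ V) (m : Γ(M, V)) :
      g V' (h.trans hV) (res M h m) = res N h (g V hV m) := by
    refine section_ext N fun x hx ↦ ?_
    obtain ⟨V'', h', hxV'', c, hc⟩ := hb V' (h.trans hV) (res M h m) x hx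
    refine ⟨V'', h', hxV'', ?_⟩
    rw [hcomb V' _ _ V'' h' c hc, res_res, hcomb V hV m V'' (h'.trans h) c]
    rw [hc, res_res]
  refine ⟨mkHomSection (fun V hV ↦ ⟨⟨g V hV, hadd V hV⟩, hsmul V hV⟩) hres, fun k ↦ ?_⟩
  classical
  have h1 := hcomb W le_rfl (b k) W le_rfl (fun j ↦ if j = k then 1 else 0) (by
    simp [res_self])
  rw [res_self] at h1
  refine h1.trans ?_
  simp [res_self]

end Generation

/-! ### Inverse images -/

section Pullback

variable {Z X : Scheme.{u}} (i : Z ⟶ X)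

/-- The unit `M ⟶ i_* i^* M` on sections. -/
def pull (M : X.Modules) (V : X.Opens) :
    Γ(M, V) →+ Γ((Scheme.Modules.pullback i).obj M, i ⁻¹ᵁ V) :=
  (((Scheme.Modules.pullbackPushforwardAdjunction i).unit.app M).app V).hom

lemma pushforward_smul (N : Z.Modules) (V : X.Opens) (r : Γ(X, V))
    (m : Γ((Scheme.Modules.pushforward i).obj N, V)) :
    r • m = (show Γ(N, i ⁻¹ᵁ V) from i.app V r • (show Γ(N, i ⁻¹ᵁ V) from m)) := rfl

lemma app_resO {U V : X.Opens} (h : V ≤ U) (r : Γ(X, U)) :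
    i.app V (resO X h r) = resO Z (i.preimage_mono h) (i.app U r) :=
  CategoryTheory.congr_fun (i.naturality (homOfLE h).op) r

lemma pull_smul (M : X.Modules) (V : X.Opens) (r : Γ(X, V)) (m : Γ(M, V)) :
    pull i M V (r • m) = i.app V r • pull i M V m :=
  ((Scheme.Modules.pullbackPushforwardAdjunction i).unit.app M).app_smul r m

lemma pull_res (M : X.Modules) {U V : X.Opens} (h : V ≤ U) (m : Γ(M, U)) :
    pull i M V (res M h m) = res _ (i.preimage_mono h) (pull i M U m) :=
  app_res ((Scheme.Modules.pullbackPushforwardAdjunction i).unit.app M) h m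

variable {M : X.Modules} {N : Z.Modules}

/-- The adjunction, on sections. -/
lemma exists_pullback_hom (α : M ⟶ (Scheme.Modules.pushforward i).obj N) :
    ∃ g : (Scheme.Modules.pullback i).obj M ⟶ N, ∀ (V : X.Opens) (m : Γ(M, V)),
      g.app (i ⁻¹ᵁ V) (pull i M V m) = α.app V m := by
  let adj := Scheme.Modules.pullbackPushforwardAdjunction i
  refine ⟨(adj.homEquiv M N).symm α, fun V m ↦ ?_⟩
  have h := (adj.homEquiv M N).apply_symm_apply α
  rw [Adjunction.homEquiv_unit] at h
  exact CategoryTheory.congr_fun (congrArg (fun k ↦ Scheme.Modules.Hom.app k V) h) m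

lemma pullback_hom_ext {g g' : (Scheme.Modules.pullback i).obj M ⟶ N}
    (h : ∀ (V : X.Opens) (m : Γ(M, V)),
      g.app (i ⁻¹ᵁ V) (pull i M V m) = g'.app (i ⁻¹ᵁ V) (pull i M V m)) : g = g' := by
  let adj := Scheme.Modules.pullbackPushforwardAdjunction i
  refine (adj.homEquiv M N).injective ?_
  rw [Adjunction.homEquiv_unit, Adjunction.homEquiv_unit]
  exact hom_ext_sections h

end Pullback

section Extension

variable {Z : Scheme.{u}}

/-- The sheaf `V ↦ Γ(N, V ⊓ T)`, that is, `j_* j^* N` for the inclusion `j` of the open set `T`. -/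
def restrictExtend (N : Z.Modules) (T : Z.Opens) : Z.Modules :=
  (Scheme.Modules.pushforward T.ι).obj (N.restrict T.ι)

lemma image_preimage_le (T V : Z.Opens) : T.ι ''ᵁ T.ι ⁻¹ᵁ V ≤ V := T.ι.image_preimage_le V

lemma image_preimage_le' (T V : Z.Opens) : T.ι ''ᵁ T.ι ⁻¹ᵁ V ≤ T := T.ι_image_le _

lemma le_image_preimage {T V V' : Z.Opens} (h : V' ≤ T) (h' : V' ≤ V) : V' ≤ T.ι ''ᵁ T.ι ⁻¹ᵁ V := by
  rw [T.ι.image_preimage_eq_opensRange_inf, Scheme.Opens.opensRange_ι]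
  exact le_inf h h'

/-- A section of `restrictExtend N T` over `V`, as a section of `N`. -/
def unextend (N : Z.Modules) (T V : Z.Opens) :
    Γ(restrictExtend N T, V) ≃+ Γ(N, T.ι ''ᵁ T.ι ⁻¹ᵁ V) := AddEquiv.refl _

lemma unextend_smul (N : Z.Modules) (T V : Z.Opens) (r : Γ(Z, V)) (m : Γ(restrictExtend N T, V)) :
    unextend N T V (r • m) = resO Z (image_preimage_le T V) r • unextend N T V m :=
  restrict_smul N T (T.ι ⁻¹ᵁ V) (T.ι.app V r) m

lemma unextend_res (N : Z.Modules) (T : Z.Opens) {V V' : Z.Opens} (h : V' ≤ V)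
    (m : Γ(restrictExtend N T, V)) : unextend N T V' (res _ h m) =
      res N (T.ι.image_mono (T.ι.preimage_mono h)) (unextend N T V m) := rfl

end Extension

section PullbackHom

variable {Z X : Scheme.{u}} (i : Z ⟶ X) {M : X.Modules} {N : Z.Modules}

lemma res_pushforward {U V : X.Opens} (h : V ≤ U)
    (m : Γ((Scheme.Modules.pushforward i).obj N, U)) :
    res ((Scheme.Modules.pushforward i).obj N) h m =
      res N (i.preimage_mono h) (show Γ(N, i ⁻¹ᵁ U) from m) := rfl

/-- A homomorphism `A|_T ⟶ N|_T`, as a morphism `A ⟶ j_* j^* N`. -/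
def toExtend {A N : Z.Modules} {T : Z.Opens} (f : Γ(homSheaf A N, T)) : A ⟶ restrictExtend N T :=
  mkHom (fun V ↦
    { toFun := fun s ↦ (unextend N T V).symm
        (homEval f (image_preimage_le' T V) (res A (image_preimage_le T V) s))
      map_add' := fun s t ↦ by rw [map_add, map_add, map_add]
      map_smul' := fun r s ↦ by
        rw [res_smul, map_smul]
        exact ((unextend N T V).symm_apply_eq.mpr (unextend_smul N T V r _).symm) })
    fun V V' h s ↦ (unextend N T V').injective <| by
      rw [unextend_res]
      refine Eq.trans ?_ (res_homEval f (image_preimage_le' T V) _ _).symm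
      rw [res_res]
      refine (AddEquiv.apply_symm_apply _ _).trans ?_
      rw [res_res]

lemma unextend_toExtend {A N : Z.Modules} {T : Z.Opens} (f : Γ(homSheaf A N, T)) (V : Z.Opens)
    (s : Γ(A, V)) : unextend N T V ((toExtend f).app V s) =
      homEval f (image_preimage_le' T V) (res A (image_preimage_le T V) s) := rfl

/-- The homomorphism `A|_T ⟶ N|_T` given by a morphism `A ⟶ j_* j^* N`. -/
def ofExtend {A N : Z.Modules} {T : Z.Opens} (g : A ⟶ restrictExtend N T) :
    Γ(homSheaf A N, T) :=
  mkHomSection (fun V hV ↦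
    { toFun := fun s ↦ res N (le_image_preimage hV le_rfl) (unextend N T V (g.app V s))
      map_add' := fun s t ↦ by rw [map_add, map_add, map_add]
      map_smul' := fun r s ↦ by
        rw [Scheme.Modules.Hom.app_smul, unextend_smul, res_smul, resO_resO, resO_self]
        rfl }) fun V V' hV h s ↦ by
      refine Eq.trans ?_ (res_res N _ h _).symm
      refine (congrArg (fun t ↦ res N (le_image_preimage (h.trans hV) le_rfl)
        (unextend N T V' t)) (app_res g h s)).trans ?_
      rw [unextend_res, res_res]

lemma homEval_ofExtend {A N : Z.Modules} {T : Z.Opens} (g : A ⟶ restrictExtend N T) {V : Z.Opens}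
    (hV : V ≤ T) (s : Γ(A, V)) : homEval (ofExtend g) hV s =
      res N (le_image_preimage hV le_rfl) (unextend N T V (g.app V s)) := rfl

lemma ofExtend_toExtend {A N : Z.Modules} {T : Z.Opens} (f : Γ(homSheaf A N, T)) :
    ofExtend (toExtend f) = f :=
  homSheaf_ext fun V hV s ↦ by
    rw [homEval_ofExtend, unextend_toExtend, res_homEval, res_res, res_self]

lemma image_preimage_le_inf (W V : X.Opens) :
    (i ⁻¹ᵁ W).ι ''ᵁ (i ⁻¹ᵁ W).ι ⁻¹ᵁ i ⁻¹ᵁ V ≤ i ⁻¹ᵁ (V ⊓ W) :=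
  le_inf (image_preimage_le _ _) (image_preimage_le' _ _)

/-- For `T` the inverse image of `W`, a section of `j_* j^* N` over the inverse image of `V`. -/
def extendPreimage (N : Z.Modules) (W V : X.Opens) :
    Γ(N, i ⁻¹ᵁ (V ⊓ W)) →+ Γ(restrictExtend N (i ⁻¹ᵁ W), i ⁻¹ᵁ V) :=
  (unextend N (i ⁻¹ᵁ W) (i ⁻¹ᵁ V)).symm.toAddMonoidHom.comp (res N (image_preimage_le_inf i W V))

lemma unextend_extendPreimage (W V : X.Opens) (m : Γ(N, i ⁻¹ᵁ (V ⊓ W))) :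
    unextend N (i ⁻¹ᵁ W) (i ⁻¹ᵁ V) (extendPreimage i N W V m) =
      res N (image_preimage_le_inf i W V) m := rfl

lemma extendPreimage_smul (W V : X.Opens) (r : Γ(Z, i ⁻¹ᵁ V)) (m : Γ(N, i ⁻¹ᵁ (V ⊓ W))) :
    extendPreimage i N W V (resO Z (i.preimage_mono (inf_le_left : V ⊓ W ≤ V)) r • m) =
      r • extendPreimage i N W V m := by
  refine (unextend N (i ⁻¹ᵁ W) (i ⁻¹ᵁ V)).injective ?_
  rw [unextend_smul, unextend_extendPreimage, unextend_extendPreimage, res_smul, resO_resO]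

lemma extendPreimage_res (W : X.Opens) {V V' : X.Opens} (h : V' ≤ V)
    (m : Γ(N, i ⁻¹ᵁ (V ⊓ W))) :
    extendPreimage i N W V' (res N (i.preimage_mono (inf_le_inf_right W h)) m) =
      res _ (i.preimage_mono h) (extendPreimage i N W V m) := by
  refine (unextend N (i ⁻¹ᵁ W) (i ⁻¹ᵁ V')).injective ?_
  rw [unextend_res, unextend_extendPreimage, unextend_extendPreimage, res_res, res_res]

/-- The morphism `M ⟶ i_* j_* j^* N` given by a homomorphism `M|_W ⟶ (i_* N)|_W`. -/
def toPushforwardExtend {W : X.Opens}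
    (α : Γ(homSheaf M ((Scheme.Modules.pushforward i).obj N), W)) :
    M ⟶ (Scheme.Modules.pushforward i).obj (restrictExtend N (i ⁻¹ᵁ W)) :=
  mkHom (fun V ↦
    { toFun := fun m ↦ extendPreimage i N W V (homEval α inf_le_right (res M inf_le_left m))
      map_add' := fun m m' ↦ by
        rw [map_add, map_add]
        exact map_add (extendPreimage i N W V) _ _
      map_smul' := fun r m ↦ by
        rw [res_smul, map_smul, pushforward_smul, app_resO]
        exact extendPreimage_smul i W V _ _ })
    fun V V' h m ↦ by
      have h1 : homEval α inf_le_right (res M (inf_le_left : V' ⊓ W ≤ V') (res M h m)) =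
          res _ (inf_le_inf_right W h) (homEval α inf_le_right (res M inf_le_left m)) := by
        rw [res_homEval, res_res, res_res]
      exact (congrArg (extendPreimage i N W V') h1).trans (extendPreimage_res i W h _)

/-- A homomorphism `M|_W ⟶ (i_* N)|_W` has an adjoint `(i^* M)|_T ⟶ N|_T`, where `T` is the
inverse image of `W`. -/
lemma exists_pullback_homSection {W : X.Opens}
    (α : Γ(homSheaf M ((Scheme.Modules.pushforward i).obj N), W)) :
    ∃ f : Γ(homSheaf ((Scheme.Modules.pullback i).obj M) N, i ⁻¹ᵁ W),
      ∀ (V : X.Opens) (hV : V ≤ W) (m : Γ(M, V)),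
        homEval f (i.preimage_mono hV) (pull i M V m) = homEval α hV m := by
  obtain ⟨g, hg⟩ := exists_pullback_hom i (toPushforwardExtend i α)
  refine ⟨ofExtend g, fun V hV m ↦ ?_⟩
  rw [homEval_ofExtend, hg]
  refine (res_res N (image_preimage_le_inf i W V) _
    (show Γ(N, i ⁻¹ᵁ (V ⊓ W)) from homEval α inf_le_right (res M inf_le_left m))).trans ?_
  have h1 : homEval α inf_le_right (res M (inf_le_left : V ⊓ W ≤ V) m) =
    res _ inf_le_left (homEval α hV m) := by rw [res_homEval]
  refine (congrArg (res N (i.preimage_mono (le_inf le_rfl hV))) h1).trans ?_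
  rw [res_pushforward]
  exact (res_res N _ _ _).trans (res_self N _)

/-- A homomorphism out of `i^* M` is determined by its values on sections pulled back from `M`. -/
lemma pullback_homSection_ext {W : X.Opens}
    {f f' : Γ(homSheaf ((Scheme.Modules.pullback i).obj M) N, i ⁻¹ᵁ W)}
    (h : ∀ (V : X.Opens) (hV : V ≤ W) (m : Γ(M, V)),
      homEval f (i.preimage_mono hV) (pull i M V m) =
        homEval f' (i.preimage_mono hV) (pull i M V m)) : f = f' := by
  rw [← ofExtend_toExtend f, ← ofExtend_toExtend f']
  congr 1
  refine pullback_hom_ext i fun V m ↦ (unextend N (i ⁻¹ᵁ W) _).injective ?_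
  rw [unextend_toExtend, unextend_toExtend]
  have h1 : res _ (image_preimage_le (i ⁻¹ᵁ W) (i ⁻¹ᵁ V)) (pull i M V m) =
      res _ (image_preimage_le_inf i W V) (pull i M (V ⊓ W) (res M inf_le_left m)) := by
    rw [pull_res, res_res]
  rw [h1, ← res_homEval f (i.preimage_mono inf_le_right),
    ← res_homEval f' (i.preimage_mono inf_le_right), h _ inf_le_right]

end PullbackHom

section PullbackFrame

variable {Z X : Scheme.{u}} (i : Z ⟶ X) {M : X.Modules} {ι : Type*} [Fintype ι]

/-- If the sections `b` generate `M` over `W` and the coefficients of their relations vanish on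
`Z`, then their pullbacks are a frame of `i^* M`. -/
lemma LocallyGenerate.isFrame_pull {W : X.Opens} {b : ι → Γ(M, W)} (hb : LocallyGenerate M W b)
    (hrel : ∀ (V : X.Opens) (hV : V ≤ W) (c : ι → Γ(X, V)), ∑ k, c k • res M hV (b k) = 0 →
      ∀ k, i.app V (c k) = 0) :
    IsFrame ((Scheme.Modules.pullback i).obj M) (i ⁻¹ᵁ W) fun k ↦ pull i M W (b k) := by
  classical
  let A := (Scheme.Modules.pullback i).obj M
  have hrel' (N : Z.Modules) (V : X.Opens) (hV : V ≤ W) (c : ι → Γ(X, V))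
      (hc : ∑ k, c k • res M hV (b k) = 0) (k : ι)
      (t : Γ((Scheme.Modules.pushforward i).obj N, V)) : c k • t = 0 := by
    rw [pushforward_smul, hrel V hV c hc k]
    exact zero_smul Γ(Z, i ⁻¹ᵁ V) (show Γ(N, i ⁻¹ᵁ V) from t)
  -- the coordinate functions, adjoint to functions on `M` with values in `i_* 𝒪_Z`
  have hex (k : ι) : ∃ d : Γ(homSheaf A (structureModule Z), i ⁻¹ᵁ W), ∀ l,
      homEval d le_rfl (pull i M W (b l)) =
        if k = l then (1 : Γ(Z, i ⁻¹ᵁ W)) else (0 : Γ(Z, i ⁻¹ᵁ W)) := by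
    obtain ⟨α, hα⟩ := hb.exists_hom (N := (Scheme.Modules.pushforward i).obj (structureModule Z))
      (hrel' _) (fun l ↦ if k = l then (1 : Γ(Z, i ⁻¹ᵁ W)) else (0 : Γ(Z, i ⁻¹ᵁ W)))
    obtain ⟨f, hf⟩ := exists_pullback_homSection i α
    exact ⟨f, fun l ↦ (hf W le_rfl (b l)).trans (hα l)⟩
  choose d hd using hex
  let a (k : ι) : Γ(A, i ⁻¹ᵁ W) := pull i M W (b k)
  -- the coordinates of a section of `i^* M` with respect to the pullbacks
  let coord (k : ι) {V : Z.Opens} (hV : V ≤ i ⁻¹ᵁ W) : Γ(A, V) →ₗ[Γ(Z, V)] Γ(Z, V) :=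
    homEval (N := structureModule Z) (d k) hV
  have hcoord (k l : ι) {V : Z.Opens} (hV : V ≤ i ⁻¹ᵁ W) :
      coord k hV (res A hV (a l)) = if k = l then 1 else 0 := by
    refine (res_homEval (N := structureModule Z) (d k) le_rfl hV (a l)).symm.trans ?_
    rw [hd]
    split_ifs
    · exact map_one (resO Z hV)
    · exact map_zero (resO Z hV)
  -- the identity of `i^* M` is recovered from the coordinates
  let σ : Γ(homSheaf A A, i ⁻¹ᵁ W) := mkHomSection
    (fun V hV ↦ ∑ k, (coord k hV).smulRight (res A hV (a k))) fun V V' hV h s ↦ by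
      simp only [LinearMap.sum_apply, LinearMap.smulRight_apply, map_sum, res_smul, res_res]
      refine Finset.sum_congr rfl fun k _ ↦ ?_
      congr 1
      exact (res_homEval (N := structureModule Z) (d k) hV h s).symm
  let τ : Γ(homSheaf A A, i ⁻¹ᵁ W) := mkHomSection (fun V hV ↦ LinearMap.id) fun _ _ _ _ _ ↦ rfl
  have hστ : σ = τ := by
    refine pullback_homSection_ext i fun V hV m ↦ section_ext A fun z hz ↦ ?_
    obtain ⟨V', h, hxV', c, hc⟩ := hb V hV m (i z) hz
    refine ⟨i ⁻¹ᵁ V', i.preimage_mono h, hxV', ?_⟩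
    rw [res_homEval, res_homEval, ← pull_res i M h m, ← hc, map_sum, map_sum, map_sum]
    refine Finset.sum_congr rfl fun l _ ↦ ?_
    rw [pull_smul, pull_res, map_smul, map_smul]
    congr 1
    change (∑ k, (coord k _).smulRight (res A (i.preimage_mono (h.trans hV)) (a k)))
      (res A _ (a l)) = res A _ (a l)
    simp only [LinearMap.sum_apply, LinearMap.smulRight_apply, hcoord]
    simp
  intro V hV
  refine ⟨fun c c' hcc ↦ funext fun k ↦ ?_, fun s ↦ ⟨fun k ↦ coord k hV s, ?_⟩⟩
  · have h1 (c : ι → Γ(Z, V)) : coord k hV (∑ l, c l • res A hV (a l)) = c k := by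
      simp [hcoord]
    rw [← h1 c, ← h1 c']
    exact congrArg (coord k hV) hcc
  · have h1 : homEval σ hV s = homEval τ hV s := by rw [hστ]
    change (∑ k, (coord k hV).smulRight (res A hV (a k))) s = s at h1
    simpa only [LinearMap.sum_apply, LinearMap.smulRight_apply] using h1

end PullbackFrame

/-! ### Modules on a closed subscheme -/

section FrameIso

variable {X : Scheme.{u}} {ι : Type*} [Fintype ι]

/-- A morphism that takes frames to frames locally is an isomorphism. -/
lemma isIso_of_frames {M N : X.Modules} (f : M ⟶ N) (h : ∀ x : X, ∃ (U : X.Opens)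
    (b : ι → Γ(M, U)), x ∈ U ∧ IsFrame M U b ∧ IsFrame N U fun k ↦ f.app U (b k)) : IsIso f := by
  have key (U : X.Opens) (b : ι → Γ(M, U)) (hM : IsFrame M U b)
      (hN : IsFrame N U fun k ↦ f.app U (b k)) (V : X.Opens) (hV : V ≤ U) :
      Function.Bijective (f.app V) := by
    have h1 : (f.app V ∘ fun c : ι → Γ(X, V) ↦ ∑ k, c k • res M hV (b k)) =
        fun c ↦ ∑ k, c k • res N hV (f.app U (b k)) := by
      funext c
      simp [← app_res]
    have h2 := hN V hV
    rw [← h1] at h2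
    exact (Function.Bijective.of_comp_iff _ (hM V hV)).mp h2
  refine isIso_of_locally_bijective f (fun x ↦ ?_) fun V t x hx ↦ ?_
  · obtain ⟨U, b, hx, hM, hN⟩ := h x
    exact ⟨U, hx, fun V hV ↦ (key U b hM hN V hV).1⟩
  · obtain ⟨U, b, hxU, hM, hN⟩ := h x
    obtain ⟨s, hs⟩ := (key U b hM hN (V ⊓ U) inf_le_right).2 (res N inf_le_left t)
    exact ⟨V ⊓ U, inf_le_left, ⟨hx, hxU⟩, s, hs⟩

end FrameIso

section Unit

variable {Z X : Scheme.{u}} (i : Z ⟶ X)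

/-- The section `g` generates `M` over `W`, and its annihilator is the ideal of `Z`. -/
structure IsPrincipal (M : X.Modules) (W : X.Opens) (g : Γ(M, W)) : Prop where
  generate : LocallyGenerate M W fun _ : Unit ↦ g
  smul_eq_zero_iff : ∀ (V : X.Opens) (hV : V ≤ W) (c : Γ(X, V)),
    c • res M hV g = 0 ↔ i.app V c = 0

variable {i} {M : X.Modules}

lemma IsPrincipal.exists_smul_eq {W : X.Opens} {g : Γ(M, W)} (h : IsPrincipal i M W g)
    {V : X.Opens} (hV : V ≤ W) (m : Γ(M, V)) (x : X) (hx : x ∈ V) : ∃ (V' : X.Opens) (h : V' ≤ V),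
      x ∈ V' ∧ ∃ c : Γ(X, V'), c • res M (h.trans hV) g = res M h m := by
  obtain ⟨V', h', hxV', c, hc⟩ := h.generate V hV m x hx
  exact ⟨V', h', hxV', c (), by rw [← hc, Fintype.sum_unique]⟩

lemma IsPrincipal.isFrame_pull {W : X.Opens} {g : Γ(M, W)} (h : IsPrincipal i M W g) :
    IsFrame ((Scheme.Modules.pullback i).obj M) (i ⁻¹ᵁ W) fun _ : Unit ↦ pull i M W g :=
  h.generate.isFrame_pull i fun V hV c hc _ ↦ (h.smul_eq_zero_iff V hV _).mp (by
    rw [Fintype.sum_unique] at hc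
    exact hc)

/-- A module that is locally `𝒪_X / ℐ` is the direct image of its restriction to the closed
subscheme `Z`. The hypothesis `hi` says that functions on `Z` lift locally to `X`. -/
lemma isIso_unit_of_isPrincipal (hM : ∀ x : X, ∃ (W : X.Opens) (g : Γ(M, W)), x ∈ W ∧
      IsPrincipal i M W g)
    (hi : ∀ (V : X.Opens) (t : Γ(Z, i ⁻¹ᵁ V)), ∀ x ∈ V, ∃ (V' : X.Opens) (h : V' ≤ V), x ∈ V' ∧
      ∃ c : Γ(X, V'), i.app V' c = resO Z (i.preimage_mono h) t) :
    IsIso ((Scheme.Modules.pullbackPushforwardAdjunction i).unit.app M) := by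
  refine isIso_of_locally_bijective _ (fun x ↦ ?_) fun V t x hx ↦ ?_
  · obtain ⟨W, g, hxW, hg⟩ := hM x
    refine ⟨W, hxW, fun V hV ↦ (injective_iff_map_eq_zero _).mpr fun m hm ↦
      section_ext M fun y hy ↦ ?_⟩
    obtain ⟨V', h, hyV', c, hc⟩ := hg.exists_smul_eq hV m y hy
    refine ⟨V', h, hyV', ?_⟩
    have h1 : pull i M V' (res M h m) = 0 := by
      rw [pull_res]
      exact (congrArg (res _ (i.preimage_mono h)) hm).trans (map_zero _)
    rw [map_zero, ← hc, hg.smul_eq_zero_iff]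
    rw [← hc, pull_smul, pull_res] at h1
    have h2 := (hg.isFrame_pull.restrict (i.preimage_mono (h.trans hV))).coord_ext
      (c := fun _ ↦ i.app V' c) (d := 0) (by simpa using h1)
    exact congrFun h2 ()
  · obtain ⟨W, g, hxW, hg⟩ := hM x
    obtain ⟨c', hc'⟩ := (hg.isFrame_pull.restrict
      (i.preimage_mono (inf_le_right : V ⊓ W ≤ W))).exists_coord
        (res _ (i.preimage_mono (inf_le_left : V ⊓ W ≤ V)) t)
    rw [Fintype.sum_unique] at hc'
    obtain ⟨V', h, hxV', c, hc⟩ := hi (V ⊓ W) (c' ()) x ⟨hx, hxW⟩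
    refine ⟨V', h.trans inf_le_left, hxV', c • res M (h.trans inf_le_right) g, ?_⟩
    change pull i M V' (c • res M _ g) = res _ (i.preimage_mono (h.trans inf_le_left)) t
    rw [pull_smul, hc, pull_res, ← res_res _ (i.preimage_mono inf_le_left) (i.preimage_mono h) t]
    have h1 := congrArg (res _ (i.preimage_mono h)) hc'
    rw [res_smul] at h1
    refine Eq.trans ?_ h1
    rw [res_res]

end Unit

/-! ### Triviality of the determinant -/

section Det

variable {X : Scheme.{u}} {E : X.Modules} {r : ℕ}

lemma IsFrame.repr_restrict {ι : Type*} [Fintype ι] {U V : X.Opens} {e : ι → Γ(E, U)}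
    (he : IsFrame E U e) (h : V ≤ U) (m : Γ(E, U)) (k : ι) :
    (he.restrict h).basis.repr (res E h m) k = resO X h (he.basis.repr m k) := by
  refine congrFun ((he.restrict h).coord_ext (c := fun k ↦ (he.restrict h).basis.repr (res E h m) k)
    (d := fun k ↦ resO X h (he.basis.repr m k)) ?_) k
  have h1 := (he.restrict h).basis.sum_repr (res E h m)
  have h2 := congrArg (res E h) (he.basis.sum_repr m)
  simp only [map_sum, res_smul, IsFrame.basis_apply] at h1 h2
  rw [h1, h2]

lemma IsFrame.det_restrict {ι : Type*} [Fintype ι] [DecidableEq ι] {U V : X.Opens}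
    {e : ι → Γ(E, U)} (he : IsFrame E U e) (h : V ≤ U) (m : ι → Γ(E, U)) :
    (he.restrict h).basis.det (fun k ↦ res E h (m k)) = resO X h (he.basis.det m) := by
  rw [Module.Basis.det_apply, Module.Basis.det_apply, RingHom.map_det]
  congr 1
  ext k l
  exact he.repr_restrict h (m l) k

/-- A volume form on a module: an alternating form on sections, compatible with restriction. -/
structure VolumeForm (E : X.Modules) (r : ℕ) where
  toFun : ∀ V : X.Opens, Γ(E, V) [⋀^Fin r]→ₗ[Γ(X, V)] Γ(X, V)
  res_apply : ∀ (V V' : X.Opens) (h : V' ≤ V) (m : Fin r → Γ(E, V)),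
    toFun V' (fun k ↦ res E h (m k)) = resO X h (toFun V m)

/-- The linear form on the exterior power of the module of sections given by a volume form. -/
def VolumeForm.lin (β : VolumeForm E r) (V : X.Opens) :
    ⋀[Γ(X, V)]^r Γ(E, V) →ₗ[Γ(X, V)] Γ(X, V) :=
  exteriorPower.alternatingMapLinearEquiv (β.toFun V)

lemma VolumeForm.lin_ιMulti (β : VolumeForm E r) (V : X.Opens) (m : Fin r → Γ(E, V)) :
    β.lin V (exteriorPower.ιMulti Γ(X, V) r m) = β.toFun V m :=
  exteriorPower.alternatingMapLinearEquiv_apply_ιMulti _ m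

lemma VolumeForm.lin_extRes (β : VolumeForm E r) {U V : X.Opens} (h : V ≤ U)
    (x : ⋀[Γ(X, U)]^r Γ(E, U)) : β.lin V (extRes E r h x) = resO X h (β.lin U x) := by
  have hx := exteriorPower.ιMulti_span Γ(X, U) r Γ(E, U) ▸ Submodule.mem_top (x := x)
  induction hx using Submodule.span_induction with
  | mem x hx => obtain ⟨m, rfl⟩ := hx; rw [extRes_ιMulti, lin_ιMulti, lin_ιMulti, β.res_apply]
  | zero => simp
  | add x y _ _ h₁ h₂ => simp [h₁, h₂]
  | smul c x _ h =>
    rw [LinearMap.map_smulₛₗ, map_smul, map_smul, h, smul_eq_mul, smul_eq_mul, map_mul]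

/-- The presheaf of modules `V ↦ ⋀^r Γ(E, V)`. -/
abbrev extPresheafOfModules (E : X.Modules) (r : ℕ) :
    PresheafOfModules.{u} X.ringCatSheaf.obj :=
  PresheafOfModules.ofPresheaf (R := X.ringCatSheaf.obj) (extPresheaf E r)
    fun _ _ i c x ↦ (extRes E r (leOfHom i.unop)).map_smulₛₗ c x

/-- The morphism `⋀^r E ⟶ 𝒪` given by a volume form. -/
def VolumeForm.hom (β : VolumeForm E r) : sheafExteriorPower E r ⟶ structureModule X :=
  assocDesc (PresheafOfModules.homMk
    { app := fun V ↦ AddCommGrpCat.ofHom (β.lin V.unop).toAddMonoidHom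
      naturality := fun V V' h ↦ by
        ext x
        exact β.lin_extRes (leOfHom h.unop) x }
    fun V c x ↦ (β.lin V.unop).map_smul c x)

/-- The section of `⋀^r E` given by an element of the exterior power of the module of sections. -/
def toExteriorPower (E : X.Modules) (r : ℕ) (V : X.Opens) :
    ⋀[Γ(X, V)]^r Γ(E, V) →+ Γ(sheafExteriorPower E r, V) :=
  toAssoc (extPresheafOfModules E r) V

lemma VolumeForm.hom_app (β : VolumeForm E r) (V : X.Opens) (x : ⋀[Γ(X, V)]^r Γ(E, V)) :
    β.hom.app V (toExteriorPower E r V x) = β.lin V x :=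
  assocDesc_toAssoc (P := extPresheafOfModules E r) _ V x

lemma toExteriorPower_locally_surjective (V : X.Opens) (t : Γ(sheafExteriorPower E r, V)) (x : X)
    (hx : x ∈ V) : ∃ (W : X.Opens) (h : W ≤ V),
      x ∈ W ∧ ∃ s, toExteriorPower E r W s = res _ h t := toAssoc_locally_surjective _ V t x hx

/-- The determinant of a module that has a volume form and, locally, frames of volume one is
trivial. -/
lemma VolumeForm.hasTrivialDet (β : VolumeForm E r) (h : ∀ x : X, ∃ (U : X.Opens)
    (e : Fin r → Γ(E, U)), x ∈ U ∧ IsFrame E U e ∧ β.toFun U e = 1) : HasTrivialDet E r := by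
  have hone {U V : X.Opens} (hV : V ≤ U) {e : Fin r → Γ(E, U)} (he : β.toFun U e = 1) :
      β.toFun V (fun k ↦ res E hV (e k)) = 1 := by
    rw [β.res_apply, he, map_one]
  -- a frame of volume one generates the exterior power
  have hgen {V : X.Opens} {e : Fin r → Γ(E, V)} (he : IsFrame E V e) (h1 : β.toFun V e = 1)
      (x : ⋀[Γ(X, V)]^r Γ(E, V)) : x = β.lin V x • exteriorPower.ιMulti Γ(X, V) r e := by
    have h2 : LinearMap.id = (β.lin V).smulRight (exteriorPower.ιMulti Γ(X, V) r e) := by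
      refine exteriorPower.linearMap_ext (he.basis.ext_alternating fun v hv ↦ ?_)
      change exteriorPower.ιMulti Γ(X, V) r (fun k ↦ he.basis (v k)) =
        β.lin V (exteriorPower.ιMulti Γ(X, V) r fun k ↦ he.basis (v k)) •
          exteriorPower.ιMulti Γ(X, V) r e
      obtain ⟨σ, hσ⟩ : ∃ σ : Equiv.Perm (Fin r), ⇑σ = v :=
        ⟨Equiv.ofBijective v (Finite.injective_iff_bijective.mp hv), rfl⟩
      have h3 : (fun k ↦ he.basis (v k)) = e ∘ σ := by
        funext k
        simp [← hσ]
      rw [h3, lin_ιMulti, AlternatingMap.map_perm, AlternatingMap.map_perm, h1]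
      rw [smul_assoc, one_smul]
    exact congrArg (fun l : _ →ₗ[Γ(X, V)] _ ↦ l x) h2
  have : IsIso β.hom := by
    refine isIso_of_locally_bijective _ (fun x ↦ ?_) fun V t x hx ↦ ?_
    · obtain ⟨U, e, hxU, he, h1⟩ := h x
      refine ⟨U, hxU, fun V hV ↦ (injective_iff_map_eq_zero _).mpr fun s hs ↦
        section_ext _ fun y hy ↦ ?_⟩
      obtain ⟨W, hWV, hyW, w, hw⟩ := toExteriorPower_locally_surjective V s y hy
      refine ⟨W, hWV, hyW, ?_⟩
      have h2 : β.lin W w = 0 := by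
        rw [← β.hom_app, hw, app_res, hs]
        exact map_zero _
      rw [← hw, hgen (he.restrict (hWV.trans hV)) (hone _ h1) w, h2, zero_smul, map_zero, map_zero]
    · obtain ⟨U, e, hxU, he, h1⟩ := h x
      let t' : Γ(X, V ⊓ U) := resO X inf_le_left t
      refine ⟨V ⊓ U, inf_le_left, ⟨hx, hxU⟩, toExteriorPower E r _
        (t' • exteriorPower.ιMulti Γ(X, V ⊓ U) r fun k ↦ res E inf_le_right (e k)), ?_⟩
      rw [β.hom_app, map_smul, lin_ιMulti, hone _ h1]
      exact mul_one t'
  exact ⟨asIso β.hom⟩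

/-- A module with distinguished local frames that differ by matrices of determinant one has
trivial determinant. -/
lemma hasTrivialDet_of_frames (D : ∀ V : X.Opens, (Fin r → Γ(E, V)) → Prop)
    (hframe : ∀ V e, D V e → IsFrame E V e)
    (hres : ∀ (V V' : X.Opens) (h : V' ≤ V) (e : Fin r → Γ(E, V)), D V e →
      D V' fun k ↦ res E h (e k))
    (hcov : ∀ x : X, ∃ (V : X.Opens) (e : Fin r → Γ(E, V)), x ∈ V ∧ D V e)
    (htrans : ∀ V e e', D V e → D V e' → ∃ P : Matrix (Fin r) (Fin r) Γ(X, V), P.det = 1 ∧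
      ∀ k, e' k = ∑ l, P k l • e l) : HasTrivialDet E r := by
  -- the volume of `m` is its determinant in any distinguished frame
  let P (V : X.Opens) (m : Fin r → Γ(E, V)) (V' : X.Opens) (t : Γ(X, V')) : Prop :=
    ∃ (h : V' ≤ V) (e : Fin r → Γ(E, V')) (he : IsFrame E V' e), D V' e ∧
      t = he.basis.det fun k ↦ res E h (m k)
  have hPres (V : X.Opens) (m : Fin r → Γ(E, V)) (V₁ V₂ : X.Opens) (h : V₂ ≤ V₁) (t : Γ(X, V₁))
      (ht : P V m V₁ t) : P V m V₂ (resO X h t) := by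
    obtain ⟨h1, e, he, hD, rfl⟩ := ht
    refine ⟨h.trans h1, _, he.restrict h, hres _ _ h e hD, ?_⟩
    rw [← he.det_restrict h]
    simp only [res_res]
  have huniq (V : X.Opens) (m : Fin r → Γ(E, V)) (V' : X.Opens) (t t' : Γ(X, V'))
      (ht : P V m V' t) (ht' : P V m V' t') : t = t' := by
    obtain ⟨h1, e, he, hD, rfl⟩ := ht
    obtain ⟨_, e', he', hD', rfl⟩ := ht'
    obtain ⟨A, hA, heA⟩ := htrans V' e e' hD hD'
    have h2 : he.basis.det e' = 1 := by
      rw [Module.Basis.det_apply, ← Matrix.det_transpose, ← hA]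
      congr 1
      ext k l
      have h3 : ∑ l, he.basis.repr (e' k) l • e l = ∑ l, A k l • e l := by
        rw [← heA]
        simpa using he.basis.sum_repr (e' k)
      exact congrFun (he.coord_ext h3) l
    have h3 := he.basis.det.eq_smul_basis_det he'.basis
    have h4 : (⇑he'.basis : Fin r → Γ(E, V')) = e' := funext fun k ↦ he'.basis_apply k
    rw [h4, h2, one_smul] at h3
    rw [h3]
  have hex (V : X.Opens) (m : Fin r → Γ(E, V)) : ∀ x ∈ V, ∃ V' : X.Opens, x ∈ V' ∧ V' ≤ V ∧
      ∃ t, P V m V' t := fun x hx ↦ by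
    obtain ⟨U, e, hxU, hD⟩ := hcov x
    exact ⟨V ⊓ U, ⟨hx, hxU⟩, inf_le_left, _, inf_le_left, _,
      (hframe U e hD).restrict inf_le_right, hres _ _ _ e hD, rfl⟩
  have hglue (V : X.Opens) (m : Fin r → Γ(E, V)) : ∃ t : Γ(X, V), ∀ (V' : X.Opens) (h : V' ≤ V)
      (t' : Γ(X, V')), P V m V' t' → resO X h t = t' :=
    exists_section_of_locally (structureModule X) (P V m) (hPres V m)
      (fun V' s t _ ↦ huniq V m V' s t) (hex V m)
  choose g hg using hglue
  have hdet (V : X.Opens) (x : X) (hx : x ∈ V) : ∃ (V' : X.Opens) (h : V' ≤ V), x ∈ V' ∧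
      ∃ (e : Fin r → Γ(E, V')) (he : IsFrame E V' e), D V' e ∧ ∀ m : Fin r → Γ(E, V),
        resO X h (g V m) = he.basis.det fun k ↦ res E h (m k) := by
    obtain ⟨U, e, hxU, hD⟩ := hcov x
    have hD' := hres _ _ (inf_le_right : V ⊓ U ≤ U) e hD
    exact ⟨V ⊓ U, inf_le_left, ⟨hx, hxU⟩, _, hframe _ _ hD', hD', fun m ↦
      hg V m (V ⊓ U) inf_le_left _ ⟨inf_le_left, _, hframe _ _ hD', hD', rfl⟩⟩
  have hupd {V V' : X.Opens} (h : V' ≤ V) [DecidableEq (Fin r)] (m : Fin r → Γ(E, V)) (k : Fin r)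
      (z : Γ(E, V)) : (fun j ↦ res E h (Function.update m k z j)) =
        Function.update (fun j ↦ res E h (m j)) k (res E h z) := by
    ext j; by_cases hj : j = k <;> [(subst hj; simp); simp [hj]]
  let β : VolumeForm E r :=
    { toFun := fun V ↦
        { toFun := g V
          map_update_add' := fun {_} m k y z ↦ section_ext (structureModule X) fun x hx ↦ by
            obtain ⟨V', h, hxV', e, he, -, hm⟩ := hdet V x hx
            refine ⟨V', h, hxV', ?_⟩
            change resO X h (g V _) = resO X h (g V _ + g V _)
            rw [map_add, hm, hm, hm, hupd, hupd, hupd, map_add, AlternatingMap.map_update_add]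
          map_update_smul' := fun {_} m k c y ↦ section_ext (structureModule X) fun x hx ↦ by
            obtain ⟨V', h, hxV', e, he, -, hm⟩ := hdet V x hx
            refine ⟨V', h, hxV', ?_⟩
            change resO X h (g V _) = resO X h (c * g V _)
            rw [map_mul, hm, hm, hupd, hupd, res_smul, AlternatingMap.map_update_smul, smul_eq_mul]
          map_eq_zero_of_eq' := fun m k l hkl hne ↦ section_ext (structureModule X) fun x hx ↦ by
            obtain ⟨V', h, hxV', e, he, -, hm⟩ := hdet V x hx
            refine ⟨V', h, hxV', ?_⟩
            change resO X h (g V _) = resO X h 0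
            rw [hm, map_zero]
            exact he.basis.det.map_eq_zero_of_eq _ (congrArg (res E h) hkl) hne }
      res_apply := fun V V' h m ↦ section_ext (structureModule X) fun x hx ↦ by
        obtain ⟨V₁, h₁, hx₁, e, he, hD, hm⟩ := hdet V' x hx
        refine ⟨V₁, h₁, hx₁, ?_⟩
        change resO X h₁ (g V' _) = resO X h₁ (resO X h (g V m))
        rw [hm, resO_resO]
        have h2 := hg V m V₁ (h₁.trans h) _ ⟨h₁.trans h, e, he, hD, rfl⟩
        simp only [res_res]
        exact h2.symm }
  refine β.hasTrivialDet fun x ↦ ?_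
  obtain ⟨U, e, hxU, hD⟩ := hcov x
  refine ⟨U, e, hxU, hframe U e hD, ?_⟩
  have h1 := hg U e U le_rfl _ ⟨le_rfl, e, hframe U e hD, hD, rfl⟩
  rw [resO_self] at h1
  refine h1.trans ?_
  have h2 : (fun k ↦ res E le_rfl (e k)) = (hframe U e hD).basis := by
    funext k
    rw [res_self, IsFrame.basis_apply]
  rw [h2, Module.Basis.det_self]

end Det

/-! ### The conormal and the normal sheaf -/

section Conormal

variable {Z X : Scheme.{u}} (i : Z ⟶ X)

/-- The inclusion of sections of the ideal sheaf in the functions. -/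
def idealIncl (V : X.Opens) : Γ(idealModule i, V) →ₗ[Γ(X, V)] Γ(X, V) :=
  appLinear (N := structureModule X) (Limits.kernel.ι _) V

lemma idealIncl_injective (V : X.Opens) : Function.Injective (idealIncl i V) :=
  injective_app_of_mono (Limits.kernel.ι (show structureModule X ⟶
    (Scheme.Modules.pushforward i).obj (structureModule Z)
    from SheafOfModules.unitToPushforwardObjUnit i.toRingCatSheafHom)) V

lemma idealIncl_res {U V : X.Opens} (h : V ≤ U) (m : Γ(idealModule i, U)) :
    idealIncl i V (res _ h m) = resO X h (idealIncl i U m) :=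
  app_res (N := structureModule X) (Limits.kernel.ι _) h m

lemma app_idealIncl (V : X.Opens) (m : Γ(idealModule i, V)) : i.app V (idealIncl i V m) = 0 :=
  CategoryTheory.congr_fun (congrArg (fun k ↦ Scheme.Modules.Hom.app k V)
    (Limits.kernel.condition (show structureModule X ⟶
      (Scheme.Modules.pushforward i).obj (structureModule Z)
      from SheafOfModules.unitToPushforwardObjUnit i.toRingCatSheafHom))) m

lemma exists_idealIncl_eq {V : X.Opens} {c : Γ(X, V)} (hc : i.app V c = 0) :
    ∃ m, idealIncl i V m = c :=
  exists_kernel_app (show structureModule X ⟶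
    (Scheme.Modules.pushforward i).obj (structureModule Z)
    from SheafOfModules.unitToPushforwardObjUnit i.toRingCatSheafHom) V c hc

/-- A function that vanishes on `Z`, as a section of the ideal sheaf. -/
def idealSection (V : X.Opens) : RingHom.ker (i.app V).hom →ₗ[Γ(X, V)] Γ(idealModule i, V) where
  toFun c := (exists_idealIncl_eq i c.2).choose
  map_add' c c' := idealIncl_injective i V (by
    rw [map_add, (exists_idealIncl_eq i c.2).choose_spec, (exists_idealIncl_eq i c'.2).choose_spec,
      (exists_idealIncl_eq i (c + c').2).choose_spec]
    rfl)
  map_smul' r c := idealIncl_injective i V (by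
    rw [map_smul, (exists_idealIncl_eq i c.2).choose_spec,
      (exists_idealIncl_eq i (r • c).2).choose_spec]
    rfl)

lemma idealIncl_idealSection (V : X.Opens) (c : RingHom.ker (i.app V).hom) :
    idealIncl i V (idealSection i V c) = c := (exists_idealIncl_eq i c.2).choose_spec

variable {i}

/-- Restriction of functions that vanish on `Z`. -/
def kerRes {U V : X.Opens} (h : V ≤ U) (c : RingHom.ker (i.app U).hom) :
    RingHom.ker (i.app V).hom :=
  ⟨resO X h c, by
    have hc : i.app U c = 0 := c.2
    change i.app V (resO X h c) = 0
    rw [app_resO, hc, map_zero]⟩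

lemma idealSection_kerRes {U V : X.Opens} (h : V ≤ U) (c : RingHom.ker (i.app U).hom) :
    idealSection i V (kerRes h c) = res _ h (idealSection i U c) := by
  refine idealIncl_injective i V ?_
  rw [idealIncl_idealSection, idealIncl_res, idealIncl_idealSection]
  rfl

variable (i)

/-- The class in the conormal sheaf of a function that vanishes on `Z`. -/
def conormalSection (V : X.Opens) (c : RingHom.ker (i.app V).hom) :
    Γ(conormalSheaf i, i ⁻¹ᵁ V) :=
  pull i (idealModule i) V (idealSection i V c)

lemma conormalSection_add (V : X.Opens) (c c' : RingHom.ker (i.app V).hom) :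
    conormalSection i V (c + c') = conormalSection i V c + conormalSection i V c' := by
  rw [conormalSection, map_add, map_add]
  rfl

lemma conormalSection_smul (V : X.Opens) (r : Γ(X, V)) (c : RingHom.ker (i.app V).hom) :
    conormalSection i V (r • c) = i.app V r • conormalSection i V c := by
  rw [conormalSection, map_smul, pull_smul]
  rfl

lemma conormalSection_kerRes {U V : X.Opens} (h : V ≤ U) (c : RingHom.ker (i.app U).hom) :
    conormalSection i V (kerRes h c) =
      res _ (i.preimage_mono h) (conormalSection i U c) := by
  rw [conormalSection, idealSection_kerRes, pull_res]
  rfl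

/-- The functions `a 0` and `a 1` generate the ideal of `Z` over `W`, and the coefficients of their
relations belong to this ideal. -/
structure IsLocalEquation {W : X.Opens} (a : Fin 2 → RingHom.ker (i.app W).hom) : Prop where
  generate : ∀ (V : X.Opens) (_ : V ≤ W) (c : Γ(X, V)), i.app V c = 0 → ∀ x ∈ V,
    ∃ (V' : X.Opens) (h : V' ≤ V) (hW : V' ≤ W), x ∈ V' ∧
      resO X h c ∈ Ideal.span (Set.range fun k ↦ resO X hW (a k).1)
  relation : ∀ (V : X.Opens) (hV : V ≤ W) (c : Fin 2 → Γ(X, V)),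
    ∑ k, c k * resO X hV (a k).1 = 0 → ∀ k, i.app V (c k) = 0

variable {i}

/-- The classes of two local equations are a frame of the conormal sheaf. -/
lemma IsLocalEquation.isFrame {W : X.Opens} {a : Fin 2 → RingHom.ker (i.app W).hom}
    (h : IsLocalEquation i a) :
    IsFrame (conormalSheaf i) (i ⁻¹ᵁ W) fun k ↦ conormalSection i W (a k) := by
  have hincl {V : X.Opens} (hV : V ≤ W) (c : Fin 2 → Γ(X, V)) :
      idealIncl i V (∑ k, c k • res _ hV (idealSection i W (a k))) =
        ∑ k, c k * resO X hV (a k).1 := by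
    rw [map_sum]
    refine Finset.sum_congr rfl fun k _ ↦ ?_
    rw [map_smul, idealIncl_res, idealIncl_idealSection, smul_eq_mul]
  refine LocallyGenerate.isFrame_pull (M := idealModule i)
    (b := fun k ↦ idealSection i W (a k)) i (fun V hV m x hx ↦ ?_) fun V hV c hc ↦ ?_
  · obtain ⟨V', hV', hW', hxV', hmem⟩ := h.generate V hV _ (app_idealIncl i V m) x hx
    obtain ⟨c, hc⟩ := (Ideal.mem_span_range_iff_exists_fun).mp hmem
    refine ⟨V', hV', hxV', c, idealIncl_injective i V' ?_⟩
    rw [hincl, hc, idealIncl_res]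
  · refine h.relation V hV c ?_
    rw [← hincl hV c, hc, map_zero]

end Conormal

section NormalEval

variable {Z X : Scheme.{u}} {i : Z ⟶ X} {M : X.Modules}

/-- For a function `c` that vanishes on `Z` and a section `s` of `M`, the homomorphism
`ν ↦ ν(c) s` from the normal sheaf to `i^* M`. -/
def normalEval {W : X.Opens} (c : RingHom.ker (i.app W).hom) (s : Γ(M, W)) :
    Γ(homSheaf (dual (conormalSheaf i)) ((Scheme.Modules.pullback i).obj M), i ⁻¹ᵁ W) :=
  mkHomSection (fun V hV ↦
    { toFun := fun ν ↦ dualEval ν (res _ hV (conormalSection i W c)) • res _ hV (pull i M W s)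
      map_add' := fun ν ν' ↦ by
        rw [← add_smul]
        congr 1
      map_smul' := fun r ν ↦ by
        rw [RingHom.id_apply, smul_smul]
        congr 1
        exact dualEval_smul_left (M := conormalSheaf i) ν r _ })
    fun V V' hV h ν ↦ by
      change dualEval (M := conormalSheaf i) (res (dual (conormalSheaf i)) h ν) _ • _ =
        res _ h (dualEval (M := conormalSheaf i) ν _ • _)
      rw [res_smul, resO_dualEval, res_res, res_res]

lemma homEval_normalEval {W : X.Opens} (c : RingHom.ker (i.app W).hom) (s : Γ(M, W))
    {V : Z.Opens} (hV : V ≤ i ⁻¹ᵁ W) (ν : Γ(dual (conormalSheaf i), V)) :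
    homEval (normalEval c s) hV ν = dualEval (M := conormalSheaf i) ν
      (res _ hV (conormalSection i W c)) • res _ hV (pull i M W s) := rfl

lemma normalEval_res {W V : X.Opens} (h : V ≤ W) (c : RingHom.ker (i.app W).hom) (s : Γ(M, W)) :
    normalEval (kerRes h c) (res M h s) = res _ (i.preimage_mono h) (normalEval c s) := by
  refine homSheaf_ext fun V' hV' ν ↦ ?_
  rw [homEval_res, homEval_normalEval, homEval_normalEval, conormalSection_kerRes, pull_res,
    res_res, res_res]

variable {W : X.Opens} {a : Fin 2 → RingHom.ker (i.app W).hom} {g : Γ(M, W)}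

/-- The evaluations at two local equations are a frame, dual to the frame of the normal sheaf. -/
lemma IsLocalEquation.exists_frames (h : IsLocalEquation i a) (hg : IsPrincipal i M W g) :
    ∃ ν : Fin 2 → Γ(dual (conormalSheaf i), i ⁻¹ᵁ W), IsFrame (dual (conormalSheaf i)) (i ⁻¹ᵁ W) ν ∧
      (∀ k l, homEval (normalEval (a k) g) le_rfl (ν l) =
        if k = l then pull i M W g else 0) ∧
      IsFrame (homSheaf (dual (conormalSheaf i)) ((Scheme.Modules.pullback i).obj M)) (i ⁻¹ᵁ W)
        fun k ↦ normalEval (a k) g := by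
  obtain ⟨ν, hν, hνa⟩ := h.isFrame.exists_dualFrame
  have h1 (k l : Fin 2) : homEval (normalEval (a k) g) le_rfl (ν l) =
      if k = l then pull i M W g else 0 := by
    rw [homEval_normalEval, res_self, res_self, hνa]
    by_cases hkl : k = l
    · rw [if_pos hkl.symm, if_pos hkl, one_smul]
    · rw [if_neg (Ne.symm hkl), if_neg hkl, zero_smul]
  exact ⟨ν, hν, h1, IsFrame.homFrame hν hg.isFrame_pull h1⟩

end NormalEval

section Biduality

variable {Z : Scheme.{u}} (N L : Z.Modules)

/-- The evaluation `N ⟶ ℋom(ℋom(N, L), L)`. -/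
def evaluationHom : N ⟶ homSheaf (homSheaf N L) L :=
  mkHom (fun V ↦
    { toFun := fun ν ↦ mkHomSection (fun V' hV' ↦
        { toFun := fun e ↦ homEval e le_rfl (res N hV' ν)
          map_add' := fun _ _ ↦ rfl
          map_smul' := fun r e ↦ by rw [homEval_smul, resO_self]; rfl })
        fun V' V'' hV' h e ↦ by
          change homEval (res _ h e) le_rfl _ = res L h (homEval e le_rfl _)
          rw [homEval_res, res_homEval, res_res]
      map_add' := fun ν ν' ↦ homSheaf_ext fun V' hV' e ↦ by
        change homEval e le_rfl (res N hV' (ν + ν')) =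
          homEval e le_rfl (res N hV' ν) + homEval e le_rfl (res N hV' ν')
        rw [map_add, map_add]
      map_smul' := fun r ν ↦ homSheaf_ext fun V' hV' e ↦ by
        change homEval e le_rfl (res N hV' (r • ν)) = resO Z hV' r • homEval e le_rfl (res N hV' ν)
        rw [res_smul, map_smul] })
    fun V V' h ν ↦ homSheaf_ext fun V'' hV'' e ↦ by
      change homEval e le_rfl (res N hV'' (res N h ν)) =
        homEval e le_rfl (res N (hV''.trans h) ν)
      rw [res_res]

lemma homEval_evaluationHom {V V' : Z.Opens} (h : V' ≤ V) (ν : Γ(N, V))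
    (e : Γ(homSheaf N L, V')) :
    homEval ((evaluationHom N L).app V ν) h e = homEval e le_rfl (res N h ν) := rfl

end Biduality

/-! ### The normal bundle twisted by a line bundle -/

section NormalBundle

variable {Z X : Scheme.{u}} {i : Z ⟶ X} {M : X.Modules}

/-- Local data near the points of `Z` that consist of two equations of `Z` and a generator of `M`,
where `M` is locally isomorphic to `𝒪_Z`. Two choices differ by a matrix of determinant one on `Z`,
acting on the tensors of equations and generators; these tensors are tested on pairs of semilinear
maps. -/
structure IsAtlas (i : Z ⟶ X) (M : X.Modules)
    (D : ∀ W : X.Opens, (Fin 2 → RingHom.ker (i.app W).hom) → Γ(M, W) → Prop) : Prop where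
  equation : ∀ W a g, D W a g → IsLocalEquation i a
  principal : ∀ W a g, D W a g → IsPrincipal i M W g
  restrict : ∀ (W V : X.Opens) (h : V ≤ W) a g, D W a g → D V (fun k ↦ kerRes h (a k)) (res M h g)
  cover : ∀ z : Z, ∃ W a g, i z ∈ W ∧ D W a g
  transition : ∀ W a g a' g', D W a g → D W a' g' →
    ∃ P : Matrix (Fin 2) (Fin 2) Γ(X, W), i.app W P.det = 1 ∧
      ∀ (S Q : Type u) [CommRing S] [AddCommGroup Q] [Module S Q] (ρ : Γ(X, W) →+* S)
        (ν : RingHom.ker (i.app W).hom →ₛₗ[ρ] S) (η : Γ(M, W) →ₛₗ[ρ] Q) (k : Fin 2),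
        ν (a' k) • η g' = (∑ l, ρ (P k l) * ν (a l)) • η g

variable {D : ∀ W : X.Opens, (Fin 2 → RingHom.ker (i.app W).hom) → Γ(M, W) → Prop}

/-- The local frames `normalEval (a k) g` of `ℋom(𝒩, i^* M)` are dual to frames of the normal sheaf
`𝒩`, so that evaluation takes frames to frames. -/
lemma IsAtlas.isIso_evaluationHom (h : IsAtlas i M D) :
    IsIso (evaluationHom (dual (conormalSheaf i)) ((Scheme.Modules.pullback i).obj M)) := by
  refine isIso_of_frames (ι := Fin 2) _ fun z ↦ ?_
  obtain ⟨W, a, g, hz, hD⟩ := h.cover z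
  obtain ⟨ν, hν, hνa, he⟩ := (h.equation W a g hD).exists_frames (h.principal W a g hD)
  refine ⟨i ⁻¹ᵁ W, ν, hz, hν, he.homFrame (h.principal W a g hD).isFrame_pull fun k l ↦ ?_⟩
  rw [homEval_evaluationHom, res_self, hνa]
  simp only [eq_comm]

/-- The frames `normalEval (a k) g` of `ℋom(𝒩, i^* M)` differ by matrices of determinant one. -/
lemma IsAtlas.hasTrivialDet (h : IsAtlas i M D) : HasTrivialDet
    (homSheaf (dual (conormalSheaf i)) ((Scheme.Modules.pullback i).obj M)) 2 := by
  let N := dual (conormalSheaf i)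
  let L := (Scheme.Modules.pullback i).obj M
  refine hasTrivialDet_of_frames (E := homSheaf N L)
    (fun V e ↦ ∃ (W : X.Opens) (a : Fin 2 → RingHom.ker (i.app W).hom) (g : Γ(M, W))
      (hV : V ≤ i ⁻¹ᵁ W), D W a g ∧ e = fun k ↦ res (homSheaf N L) hV (normalEval (a k) g))
    ?_ ?_ ?_ ?_
  · rintro V _ ⟨W, a, g, hV, hD, rfl⟩
    obtain ⟨ν, -, -, he⟩ := (h.equation W a g hD).exists_frames (h.principal W a g hD)
    exact he.restrict hV
  · rintro V V' hV' _ ⟨W, a, g, hV, hD, rfl⟩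
    exact ⟨W, a, g, hV'.trans hV, hD, funext fun k ↦ res_res _ _ _ _⟩
  · intro z
    obtain ⟨W, a, g, hz, hD⟩ := h.cover z
    exact ⟨i ⁻¹ᵁ W, _, hz, W, a, g, le_rfl, hD, rfl⟩
  · rintro V _ _ ⟨W, a, g, hV, hD, rfl⟩ ⟨W', a', g', hV', hD', rfl⟩
    have hV'' : V ≤ i ⁻¹ᵁ (W ⊓ W') := le_inf hV hV'
    obtain ⟨P, hP, hPa⟩ := h.transition (W ⊓ W') _ _ _ _
      (h.restrict W (W ⊓ W') inf_le_left a g hD) (h.restrict W' (W ⊓ W') inf_le_right a' g' hD')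
    let ρ : Γ(X, W ⊓ W') →+* Γ(Z, V) := (resO Z hV'').comp (i.app (W ⊓ W')).hom
    refine ⟨P.map ρ, ?_, fun k ↦ ?_⟩
    · have h1 : (P.map ρ).det = ρ P.det := (ρ.map_det P).symm
      rw [h1]
      change resO Z hV'' (i.app (W ⊓ W') P.det) = 1
      rw [hP, map_one]
    · have hleft : res (homSheaf N L) hV' (normalEval (a' k) g') = res (homSheaf N L) hV''
          (normalEval (kerRes inf_le_right (a' k)) (res M inf_le_right g')) := by
        rw [normalEval_res, res_res]
      have hright (l : Fin 2) : res (homSheaf N L) hV (normalEval (a l) g) =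
          res (homSheaf N L) hV''
            (normalEval (kerRes inf_le_left (a l)) (res M inf_le_left g)) := by
        rw [normalEval_res, res_res]
      refine hleft.trans ?_
      change _ = ∑ l, ρ (P k l) • res (homSheaf N L) hV (normalEval (a l) g)
      simp only [hright]
      refine homSheaf_ext fun V' hV₁ ν ↦ ?_
      have hV₂ := hV₁.trans hV''
      let ρ' : Γ(X, W ⊓ W') →+* Γ(Z, V') := (resO Z hV₂).comp (i.app (W ⊓ W')).hom
      let ν' : RingHom.ker (i.app (W ⊓ W')).hom →ₛₗ[ρ'] Γ(Z, V') :=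
        { toFun := fun c ↦ dualEval ν (res _ hV₂ (conormalSection i (W ⊓ W') c))
          map_add' := fun c c' ↦ by rw [conormalSection_add, map_add, dualEval_add_right]
          map_smul' := fun r c ↦ by
            rw [conormalSection_smul, res_smul, dualEval_smul_right]
            rfl }
      let η' : Γ(M, W ⊓ W') →ₛₗ[ρ'] Γ(L, V') :=
        { toFun := fun s ↦ res L hV₂ (pull i M (W ⊓ W') s)
          map_add' := fun s s' ↦ by rw [map_add, map_add]
          map_smul' := fun r s ↦ by
            rw [pull_smul, res_smul]
            rfl }
      have key := hPa Γ(Z, V') Γ(L, V') ρ' ν' η' k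
      rw [homEval_res, homEval_sum, homEval_normalEval]
      refine key.trans ?_
      rw [Finset.sum_smul]
      refine Finset.sum_congr rfl fun l _ ↦ ?_
      rw [homEval_smul, homEval_res, homEval_normalEval, ← smul_smul]
      congr 1
      exact (resO_resO hV'' hV₁ (i.app (W ⊓ W') (P k l))).symm

end NormalBundle

/-! ### Adapted frames and the determinantal subscheme -/

section Determinantal

variable {Y : Scheme.{u}} {E F : Y.Modules} {n : ℕ} {ω : E ⟶ dual E} {φ : F ⟶ E}

/-- Open subsets of `V ⊆ U` are open subsets of the scheme `U`. -/
lemma exists_eq_image {U : Y.Opens} {V : U.toScheme.Opens} {V₁ : Y.Opens} (h : V₁ ≤ U.ι ''ᵁ V) :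
    ∃ V' ≤ V, V₁ = U.ι ''ᵁ V' := by
  have h1 : V₁ = U.ι ''ᵁ U.ι ⁻¹ᵁ V₁ := by
    rw [U.ι.image_preimage_eq_opensRange_inf, Scheme.Opens.opensRange_ι]
    exact (inf_eq_right.mpr (h.trans (U.ι_image_le _))).symm
  refine ⟨U.ι ⁻¹ᵁ V₁, ?_, h1⟩
  have := U.ι.preimage_mono h
  rwa [U.ι.preimage_image_eq] at this

variable [IsIntegral Y]

/-- The determinantal subscheme of `U` has the functions of the determinantal subscheme of `Y`. -/
lemma exists_determinantalι_app_eq (φ : F ⟶ E) (n : ℕ) {U : Y.Opens} (V : U.toScheme.Opens) :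
    ∃ g : Γ((degeneracyIdeal φ n).subscheme, (degeneracyIdeal φ n).subschemeι ⁻¹ᵁ U.ι ''ᵁ V) →+*
      Γ(determinantalScheme φ n U, determinantalι φ n U ⁻¹ᵁ V), Function.Bijective g ∧
        ∀ c : Γ(Y, U.ι ''ᵁ V), (determinantalι φ n U).app V c =
          g ((degeneracyIdeal φ n).subschemeι.app (U.ι ''ᵁ V) c) := by
  let k := (degeneracyIdeal φ n).subscheme.presheaf.map
    (eqToHom (image_morphismRestrict_preimage (degeneracyIdeal φ n).subschemeι U V)).op
  refine ⟨k.hom, (ConcreteCategory.isIso_iff_bijective k).mp inferInstance, fun c ↦ ?_⟩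
  exact CategoryTheory.congr_fun (morphismRestrict_app (degeneracyIdeal φ n).subschemeι U V) c

lemma surjective_determinantalι_app (φ : F ⟶ E) (n : ℕ) {U : Y.Opens} {V : U.toScheme.Opens}
    (hV : IsAffineOpen V) : Function.Surjective ((determinantalι φ n U).app V) := by
  obtain ⟨g, hg, h⟩ := exists_determinantalι_app_eq φ n V
  intro t
  obtain ⟨t', rfl⟩ := hg.2 t
  obtain ⟨c, rfl⟩ := (degeneracyIdeal φ n).subschemeι_app_surjective
    ⟨U.ι ''ᵁ V, hV.image_of_isOpenImmersion U.ι⟩ t'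
  exact ⟨c, h c⟩

lemma IsNormalLagrangian.app_eq_zero_iff_affine (h : IsNormalLagrangian n ω φ) {U : Y.Opens}
    {V : U.toScheme.Opens} (hV : IsAffineOpen V)
    (c : Γ(U.toScheme, V)) : (determinantalι φ n U).app V c = 0 ↔
      (c : Γ(Y, U.ι ''ᵁ V)) ∈ minorIdeal φ n (U.ι ''ᵁ V) := by
  have h1 := (degeneracyIdeal φ n).ker_subschemeι_app ⟨U.ι ''ᵁ V, hV.image_of_isOpenImmersion U.ι⟩
  rw [degeneracyIdeal_ideal h.frames_source h.frames_target] at h1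
  obtain ⟨g, hg, h2⟩ := exists_determinantalι_app_eq φ n V
  exact (Eq.congr_left (h2 c)).trans ((map_eq_zero_iff g hg.1).trans (SetLike.ext_iff.mp h1 c))

lemma exists_affine_le {X : Scheme.{u}} {V : X.Opens} {x : X} (hx : x ∈ V) :
    ∃ V' ≤ V, IsAffineOpen V' ∧ x ∈ V' := by
  obtain ⟨_, ⟨W, hW, rfl⟩, hxW, hWV⟩ := X.isBasis_affineOpens.exists_subset_of_mem_open hx V.2
  exact ⟨W, hWV, hW, hxW⟩

/-- A function vanishes on the determinantal subscheme if and only if it belongs locally to the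
ideal of minors. -/
lemma IsNormalLagrangian.app_eq_zero_iff (h : IsNormalLagrangian n ω φ) {U : Y.Opens}
    (V : U.toScheme.Opens) (c : Γ(U.toScheme, V)) : (determinantalι φ n U).app V c = 0 ↔
      ∀ x ∈ V, ∃ (V' : U.toScheme.Opens) (hV : V' ≤ V), x ∈ V' ∧
        (resO U.toScheme hV c : Γ(Y, U.ι ''ᵁ V')) ∈ minorIdeal φ n (U.ι ''ᵁ V') := by
  constructor
  · intro hc x hx
    obtain ⟨V', hV', haff, hxV'⟩ := exists_affine_le hx
    refine ⟨V', hV', hxV', (h.app_eq_zero_iff_affine haff _).mp ?_⟩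
    rw [app_resO, hc, map_zero]
  · intro hc
    refine section_ext (structureModule (determinantalScheme φ n U))
      (U := determinantalι φ n U ⁻¹ᵁ V) fun z hz ↦ ?_
    obtain ⟨V', hV', hxV', hmem⟩ := hc _ hz
    obtain ⟨V₁, hV₁, haff, hx₁⟩ := exists_affine_le hxV'
    refine ⟨_, (determinantalι φ n U).preimage_mono (hV₁.trans hV'), hx₁, ?_⟩
    change resO _ _ ((determinantalι φ n U).app V c) = resO _ _ 0
    rw [map_zero, ← app_resO _ (hV₁.trans hV'), h.app_eq_zero_iff_affine haff, ← resO_resO hV' hV₁]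
    exact map_minorIdeal_le φ (U.ι.image_mono hV₁) (Ideal.mem_map_of_mem _ hmem)

lemma IsNormalLagrangian.mem_support_iff (h : IsNormalLagrangian n ω φ) (y : Y) :
    y ∈ (degeneracyIdeal φ n).support ↔ rankAt φ y < n := by
  obtain ⟨V, -, hV, hyV, ⟨f, hf⟩, e, he⟩ := h.exists_frames (Opens.mem_top y)
  have h1 := (degeneracyIdeal φ n).coe_support_inter ⟨V, hV⟩
  rw [degeneracyIdeal_ideal h.frames_source h.frames_target] at h1
  have h2 := Set.ext_iff.mp h1 y
  simp only [Set.mem_inter_iff, SetLike.mem_coe, hyV, and_true] at h2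
  rw [h2, rankAt_lt_iff hf he hyV]
  exact Scheme.mem_zeroLocus_iff ..

lemma IsNormalLagrangian.range_determinantalι (h : IsNormalLagrangian n ω φ) (U : Y.Opens) :
    Set.range (determinantalι φ n U ≫ U.ι) = {y | rankAt φ y < n} ∩ U := by
  have h1 : determinantalι φ n U ≫ U.ι =
      ((degeneracyIdeal φ n).subschemeι ⁻¹ᵁ U).ι ≫ (degeneracyIdeal φ n).subschemeι :=
    morphismRestrict_ι _ _
  ext y
  rw [h1]
  constructor
  · rintro ⟨z, rfl⟩
    refine ⟨(h.mem_support_iff _).mp ?_, z.2⟩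
    rw [← SetLike.mem_coe, ← Scheme.IdealSheafData.range_subschemeι]
    exact ⟨z.1, rfl⟩
  · rintro ⟨hy, hyU⟩
    have h2 := (h.mem_support_iff y).mpr hy
    rw [← SetLike.mem_coe, ← Scheme.IdealSheafData.range_subschemeι] at h2
    obtain ⟨z, rfl⟩ := h2
    exact ⟨⟨z, hyU⟩, rfl⟩

variable {U : Y.Opens}

lemma IsNormalLagrangian.rankAt_lt (h : IsNormalLagrangian n ω φ)
    (z : determinantalScheme φ n U) :
    rankAt φ (U.ι (determinantalι φ n U z)) < n := by
  have h1 : U.ι (determinantalι φ n U z) ∈ Set.range (determinantalι φ n U ≫ U.ι) := ⟨z, rfl⟩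
  rw [h.range_determinantalι] at h1
  exact h1.1

/-- The closed immersion of the determinantal subscheme is surjective on functions, locally. -/
lemma exists_determinantalι_app_eq_res (φ : F ⟶ E) (n : ℕ) (V : U.toScheme.Opens)
    (t : Γ(determinantalScheme φ n U, determinantalι φ n U ⁻¹ᵁ V)) (x : U.toScheme) (hx : x ∈ V) :
    ∃ (V' : U.toScheme.Opens) (h : V' ≤ V), x ∈ V' ∧ ∃ c : Γ(U.toScheme, V'),
      (determinantalι φ n U).app V' c =
        resO _ ((determinantalι φ n U).preimage_mono h) t := by
  obtain ⟨V', hV', haff, hxV'⟩ := exists_affine_le hx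
  exact ⟨V', hV', hxV', surjective_determinantalι_app φ n haff _⟩

/-- The local data on `U` given by an adapted frame: the two coefficients and the generator of the
cokernel. -/
def IsAdaptedChart (ω : E ⟶ dual E) (φ : F ⟶ E) (n : ℕ) (U : Y.Opens) (W : U.toScheme.Opens)
    (a : Fin 2 → RingHom.ker ((determinantalι φ n U).app W).hom)
    (g : Γ((cokernelSheaf ω φ).restrict U.ι, W)) : Prop :=
  ∃ (o : Fin n) (f : Fin n → Γ(F, U.ι ''ᵁ W)) (q : Fin n ⊕ Fin n → Γ(E, U.ι ''ᵁ W))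
    (d : Fin n → Γ(dual F, U.ι ''ᵁ W)),
    IsAdapted ω φ (U.ι ''ᵁ W) o f q (a 0).1 (a 1).1 ∧ IsDualFrame f d ∧
      g = (cokernelProj ω φ).app (U.ι ''ᵁ W) (d o)

variable {W : U.toScheme.Opens} {a : Fin 2 → RingHom.ker ((determinantalι φ n U).app W).hom}
  {g : Γ((cokernelSheaf ω φ).restrict U.ι, W)}

lemma IsAdaptedChart.restrict (hD : IsAdaptedChart ω φ n U W a g) {V : U.toScheme.Opens}
    (hV : V ≤ W) : IsAdaptedChart ω φ n U V (fun k ↦ kerRes hV (a k)) (res _ hV g) := by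
  obtain ⟨o, f, q, d, hA, hd, rfl⟩ := hD
  exact ⟨o, _, _, _, hA.restrict (U.ι.image_mono hV), hd.restrict (U.ι.image_mono hV),
    (app_res (cokernelProj ω φ) (U.ι.image_mono hV) _).symm⟩

lemma IsAdaptedChart.minorIdeal_eq (hD : IsAdaptedChart ω φ n U W a g) :
    minorIdeal φ n (U.ι ''ᵁ W) = Ideal.span (Set.range fun k ↦ (a k).1) := by
  obtain ⟨o, f, q, d, hA, hd, rfl⟩ := hD
  rw [hA.minorIdeal_eq]
  have h1 : Set.range (fun k ↦ (a k).1) = {(a 0).1, (a 1).1} := by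
    ext c
    simp [Fin.exists_fin_two, eq_comm]
  exact congrArg Ideal.span h1.symm

lemma IsAdaptedChart.isLocalEquation (h : IsNormalLagrangian n ω φ)
    (hD : IsAdaptedChart ω φ n U W a g) : IsLocalEquation (determinantalι φ n U) a where
  generate V hV c hc x hx := by
    obtain ⟨V', hV', haff, hxV'⟩ := exists_affine_le hx
    refine ⟨V', hV', hV'.trans hV, hxV', ?_⟩
    have h1 := (h.app_eq_zero_iff_affine haff (resO _ hV' c)).mp (by rw [app_resO, hc, map_zero])
    rw [(hD.restrict (hV'.trans hV)).minorIdeal_eq] at h1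
    exact h1
  relation V hV c hc k := by
    refine (h.app_eq_zero_iff V (c k)).mpr fun x hx ↦ ?_
    obtain ⟨V', hV', haff, hxV'⟩ := exists_affine_le hx
    refine ⟨V', hV', hxV', ?_⟩
    obtain ⟨o, f, q, d, hA, hd, -⟩ := hD.restrict (hV'.trans hV)
    have h1 : resO _ hV' (c 0) * resO _ (hV'.trans hV) (a 0).1 +
        resO _ hV' (c 1) * resO _ (hV'.trans hV) (a 1).1 = 0 := by
      rw [Fin.sum_univ_two] at hc
      have := congrArg (resO _ hV') hc
      rwa [map_add, map_mul, map_mul, map_zero, resO_resO, resO_resO] at this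
    have h2 := hA.mem_minorIdeal_of_relation h (haff.image_of_isOpenImmersion U.ι) h1
    fin_cases k
    exacts [h2.1, h2.2]

lemma restrict_smul_res {M : Y.Modules} {V : U.toScheme.Opens} (hV : V ≤ W) (c : Γ(U.toScheme, V))
    (m : Γ(M.restrict U.ι, W)) : c • res (M.restrict U.ι) hV m =
      (show Γ(M.restrict U.ι, V) from (show Γ(Y, U.ι ''ᵁ V) from c) •
        res M (U.ι.image_mono hV) (show Γ(M, U.ι ''ᵁ W) from m)) := restrict_smul M U V c _

/-- The cokernel on `U` is locally isomorphic to the structure sheaf of the determinantal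
subscheme. -/
lemma IsAdaptedChart.isPrincipal (h : IsNormalLagrangian n ω φ)
    (hD : IsAdaptedChart ω φ n U W a g) :
    IsPrincipal (determinantalι φ n U) ((cokernelSheaf ω φ).restrict U.ι) W g where
  generate V hV m x hx := by
    obtain ⟨o, f, q, d, hA, hd, hg⟩ := hD.restrict hV
    obtain ⟨V₁, hV₁, hxV₁, c, hc⟩ := hA.exists_smul_eq hd
      (show Γ(cokernelSheaf ω φ, U.ι ''ᵁ V) from m) (U.ι x) ⟨x, hx, rfl⟩
    obtain ⟨V', hV', rfl⟩ := exists_eq_image hV₁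
    have hxV' : x ∈ V' := by
      obtain ⟨x', hx', hxx'⟩ := hxV₁
      rwa [← U.ι.isOpenEmbedding.injective hxx']
    refine ⟨V', hV', hxV', fun _ ↦ c, ?_⟩
    rw [Fintype.sum_unique]
    refine (restrict_smul_res (hV'.trans hV) c g).trans ?_
    have h1 : res ((cokernelSheaf ω φ).restrict U.ι) (hV'.trans hV) g =
        res (cokernelSheaf ω φ) (U.ι.image_mono hV') ((cokernelProj ω φ).app _ (d o)) := by
      rw [← hg]
      exact (res_res _ hV hV' g).symm
    exact (congrArg (fun t : Γ(cokernelSheaf ω φ, U.ι ''ᵁ V') ↦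
      (show Γ(Y, U.ι ''ᵁ V') from c) • t) h1).trans hc
  smul_eq_zero_iff V hV c := by
    rw [restrict_smul_res, h.app_eq_zero_iff]
    constructor
    · intro hc x hx
      obtain ⟨o, f, q, d, hA, hd, hg⟩ := hD.restrict hV
      have hc' : (show Γ(Y, U.ι ''ᵁ V) from c) • (cokernelProj ω φ).app _ (d o) = 0 := by
        rw [← hg]
        exact hc
      obtain ⟨V₁, hV₁, hxV₁, hmem⟩ := hA.mem_minorIdeal_of_smul_eq_zero hd hc' (U.ι x) ⟨x, hx, rfl⟩
      obtain ⟨V', hV', rfl⟩ := exists_eq_image hV₁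
      have hxV' : x ∈ V' := by
        obtain ⟨x', hx', hxx'⟩ := hxV₁
        rwa [← U.ι.isOpenEmbedding.injective hxx']
      exact ⟨V', hV', hxV', hmem⟩
    · intro hc
      refine section_ext ((cokernelSheaf ω φ).restrict U.ι) fun x hx ↦ ?_
      obtain ⟨V', hV', hxV', hmem⟩ := hc x hx
      refine ⟨V', hV', hxV', ?_⟩
      rw [map_zero]
      refine (res_smul (cokernelSheaf ω φ) (U.ι.image_mono hV') _ _).trans ?_
      exact h.minor_smul_eq_zero hmem _

/-- Outside the determinantal subscheme the cokernel vanishes. -/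
lemma IsNormalLagrangian.exists_isPrincipal_zero (h : IsNormalLagrangian n ω φ) (x : U.toScheme)
    (hx : ¬ rankAt φ (U.ι x) < n) : ∃ W : U.toScheme.Opens, x ∈ W ∧
      IsPrincipal (determinantalι φ n U) ((cokernelSheaf ω φ).restrict U.ι) W 0 := by
  obtain ⟨V, -, hV, hyV, ⟨f, hf⟩, e, he⟩ := h.exists_frames (Opens.mem_top (U.ι x))
  rw [rankAt_lt_iff hf he hyV] at hx
  push Not at hx
  obtain ⟨r, hr, hxr⟩ := hx
  -- a minor that does not vanish at the point is invertible nearby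
  have htop (V' : U.toScheme.Opens) (hV' : V' ≤ U.ι ⁻¹ᵁ Y.basicOpen r) (c : Γ(Y, U.ι ''ᵁ V')) :
      c ∈ minorIdeal φ n (U.ι ''ᵁ V') := by
    have hle : U.ι ''ᵁ V' ≤ Y.basicOpen r :=
      (U.ι.image_mono hV').trans (U.ι.image_preimage_le _)
    have hunit : IsUnit (resO Y (hle.trans (Y.basicOpen_le r)) r) := by
      rw [← resO_resO (Y.basicOpen_le r) hle]
      exact (RingedSpace.isUnit_res_basicOpen Y.toRingedSpace r).map (resO Y hle)
    rw [Ideal.eq_top_of_isUnit_mem _ (map_minorIdeal_le φ (hle.trans (Y.basicOpen_le r))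
      (Ideal.mem_map_of_mem _ hr)) hunit]
    exact Submodule.mem_top
  refine ⟨U.ι ⁻¹ᵁ Y.basicOpen r, hxr, fun V' hV' m y hy ↦ ⟨V', le_rfl, hy, 0, ?_⟩,
    fun V' hV' c ↦ ⟨fun _ ↦ (h.app_eq_zero_iff V' c).mpr fun y hy ↦ ⟨V', le_rfl, hy, htop V' hV' _⟩,
      fun _ ↦ by rw [map_zero, smul_zero]⟩⟩
  have h1 : (1 : Γ(Y, U.ι ''ᵁ V')) • (show Γ(cokernelSheaf ω φ, U.ι ''ᵁ V') from m) = 0 :=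
    h.minor_smul_eq_zero (htop V' hV' 1) _
  rw [one_smul] at h1
  have h2 : m = 0 := h1
  rw [h2, map_zero]
  exact Finset.sum_eq_zero fun _ _ ↦ zero_smul _ _

/-- A point of the determinantal subscheme has a neighbourhood with an adapted frame. -/
lemma IsNormalLagrangian.exists_isAdaptedChart (h : IsNormalLagrangian n ω φ)
    (hU : ∀ y ∈ U, n ≤ rankAt φ y + 1) (x : U.toScheme) (hx : rankAt φ (U.ι x) < n) :
    ∃ W a g, x ∈ W ∧ IsAffineOpen W ∧ IsAdaptedChart ω φ n U W a g := by
  obtain ⟨V, -, hV, hyV, ⟨f, hf⟩, e, he⟩ := h.exists_frames (Opens.mem_top (U.ι x))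
  obtain ⟨W₀, o, f', q, a, b, hyW₀, -, hA₀⟩ := exists_isAdapted h.symplectic h.lagrangian hf he hyV
    (le_antisymm hx (hU _ x.2))
  obtain ⟨W, hW, haff, hxW⟩ := exists_affine_le (V := U.ι ⁻¹ᵁ W₀) (x := x) hyW₀
  have hle : U.ι ''ᵁ W ≤ W₀ := (U.ι.image_mono hW).trans (U.ι.image_preimage_le _)
  have hA := hA₀.restrict hle
  obtain ⟨d, -, hd⟩ := hA.frame_source.exists_dualFrame
  have hmem (c : Γ(Y, U.ι ''ᵁ W)) (hc : c ∈ ({resO Y hle a, resO Y hle b} : Set _)) :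
      (determinantalι φ n U).app W c = 0 := by
    refine (h.app_eq_zero_iff_affine haff c).mpr ?_
    rw [hA.minorIdeal_eq]
    exact Ideal.subset_span hc
  exact ⟨W, ![⟨resO Y hle a, hmem _ (by simp)⟩, ⟨resO Y hle b, hmem _ (by simp)⟩], _, hxW, haff,
    o, _, _, d, hA, hd, rfl⟩

/-- The transition between two adapted frames. The tensor `a'_k ⊗ g'` is the value of
`e ↦ ∑ ⟨e, φ f_j⟩ ⊗ f_j^*` at `-q' (inr o')` for `k = 0` and at `q' (inl o')` for `k = 1`, hence the
sign in the first row of the matrix. -/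
lemma IsAdaptedChart.exists_transition (h : IsNormalLagrangian n ω φ)
    (hD : IsAdaptedChart ω φ n U W a g)
    {a' : Fin 2 → RingHom.ker ((determinantalι φ n U).app W).hom}
    {g' : Γ((cokernelSheaf ω φ).restrict U.ι, W)} (hD' : IsAdaptedChart ω φ n U W a' g') :
    ∃ P : Matrix (Fin 2) (Fin 2) Γ(U.toScheme, W), (determinantalι φ n U).app W P.det = 1 ∧
      ∀ (S Q : Type u) [CommRing S] [AddCommGroup Q] [Module S Q] (ρ : Γ(U.toScheme, W) →+* S)
        (ν : RingHom.ker ((determinantalι φ n U).app W).hom →ₛₗ[ρ] S)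
        (η : Γ((cokernelSheaf ω φ).restrict U.ι, W) →ₛₗ[ρ] Q) (k : Fin 2),
        ν (a' k) • η g' = (∑ l, ρ (P k l) * ν (a l)) • η g := by
  obtain ⟨o, f, q, d, hA, hd, rfl⟩ := hD
  obtain ⟨o', f', q', d', hA', hd', rfl⟩ := hD'
  let J : Ideal Γ(Y, U.ι ''ᵁ W) := RingHom.ker ((determinantalι φ n U).app W).hom
  let p (s t : Fin n ⊕ Fin n) : Γ(U.toScheme, W) := pairing ω (q' s) (q t)
  have ha (k) : (a k).1 ∈ J := (a k).2
  have ha' (k) : (a' k).1 ∈ J := (a' k).2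
  refine ⟨!![-p (.inr o') (.inl o), -p (.inr o') (.inr o); p (.inl o') (.inl o),
    p (.inl o') (.inr o)], ?_, fun S Q _ _ _ ρ ν η k ↦ ?_⟩
  · have h1 := hA.transition_det h.symplectic hA' (ha' 0) (ha' 1)
    have h2 : (determinantalι φ n U).app W (p (.inl o') (.inl o) * p (.inr o') (.inr o) -
      p (.inl o') (.inr o) * p (.inr o') (.inl o) - 1) = 0 := h1
    rw [map_sub, map_one, sub_eq_zero] at h2
    rw [← h2, Matrix.det_fin_two_of]
    congr 1
    ring
  · let ρ' : Γ(Y, U.ι ''ᵁ W) →+* S := ρ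
    let ν' : J →ₛₗ[ρ'] S := ν
    let η' : Γ(cokernelSheaf ω φ, U.ι ''ᵁ W) →ₛₗ[ρ'] Q :=
      { toFun := η
        map_add' := η.map_add
        map_smul' := fun r m ↦
          (congrArg η (restrict_smul (cokernelSheaf ω φ) U W r m).symm).trans (η.map_smulₛₗ r m) }
    have hmem (s : Fin n ⊕ Fin n) (hs : s = .inl o' ∨ s = .inr o') (j : Fin n) :
        pairing ω (q' s) (φ.app _ (f' j)) ∈ J := by
      by_cases hj : j = o'
      · rcases hs with rfl | rfl
        · exact ((hA'.pairing_inl_app j).trans (if_pos hj)).symm ▸ ha' 1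
        · exact ((hA'.pairing_inr_app j).trans (if_pos hj)).symm ▸ neg_mem (ha' 0)
      · rcases hs with rfl | rfl
        · exact ((hA'.pairing_inl_app j).trans (if_neg hj)).symm ▸ J.zero_mem
        · exact ((hA'.pairing_inr_app j).trans (if_neg hj)).symm ▸ J.zero_mem
    have key (s : Fin n ⊕ Fin n) (hs : s = .inl o' ∨ s = .inr o') :=
      hA.sum_pairing_smul hd hA' hd' (ha 0) (ha 1) (hmem s hs) ρ' ν' η'
    have h0 := key (.inr o') (.inr rfl)
    have h1 := key (.inl o') (.inl rfl)
    have e0 : (⟨_, hmem (.inr o') (.inr rfl) o'⟩ : J) = -(a' 0) :=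
      Subtype.ext ((hA'.pairing_inr_app o').trans (if_pos rfl))
    have e1 : (⟨_, hmem (.inl o') (.inl rfl) o'⟩ : J) = a' 1 :=
      Subtype.ext ((hA'.pairing_inl_app o').trans (if_pos rfl))
    rw [e0] at h0
    rw [e1] at h1
    fin_cases k
    · rw [Fin.sum_univ_two]
      have h2 : ν (-(a' 0)) • η ((cokernelProj ω φ).app _ (d' o')) =
        (ρ (p (.inr o') (.inl o)) * ν (a 0) + ρ (p (.inr o') (.inr o)) * ν (a 1)) •
          η ((cokernelProj ω φ).app _ (d o)) := h0
      rw [map_neg, neg_smul, neg_eq_iff_eq_neg, ← neg_smul] at h2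
      change ν (a' 0) • η ((cokernelProj ω φ).app _ (d' o')) =
        (ρ (-p (.inr o') (.inl o)) * ν (a 0) + ρ (-p (.inr o') (.inr o)) * ν (a 1)) •
          η ((cokernelProj ω φ).app _ (d o))
      rw [h2, map_neg, map_neg]
      congr 1
      ring
    · rw [Fin.sum_univ_two]
      exact h1

end Determinantal

/-! ### The locus of corank one -/

section CorankOne

variable {Y : Scheme.{u}} {E F : Y.Modules} {n : ℕ} {ω : E ⟶ dual E} {φ : F ⟶ E} {U : Y.Opens}
  [IsIntegral Y]

lemma IsNormalLagrangian.isAtlas (h : IsNormalLagrangian n ω φ)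
    (hU : ∀ y ∈ U, n ≤ rankAt φ y + 1) :
    IsAtlas (determinantalι φ n U) ((cokernelSheaf ω φ).restrict U.ι)
      (IsAdaptedChart ω φ n U) where
  equation _ _ _ hD := hD.isLocalEquation h
  principal _ _ _ hD := hD.isPrincipal h
  restrict _ _ hV _ _ hD := hD.restrict hV
  cover z := by
    obtain ⟨W, a, g, hz, -, hD⟩ := h.exists_isAdaptedChart hU _ (h.rankAt_lt z)
    exact ⟨W, a, g, hz, hD⟩
  transition _ _ _ _ _ hD hD' := hD.exists_transition h hD'

/-- The ideal of minors is locally generated by two functions and has height two in a normal ring,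
so that the two functions are a regular sequence. -/
lemma IsNormalLagrangian.isLocalCompleteIntersection (h : IsNormalLagrangian n ω φ)
    (hU : ∀ y ∈ U, n ≤ rankAt φ y + 1) :
    IsLocalCompleteIntersection (determinantalι φ n U) 2 := by
  refine ⟨inferInstanceAs (IsClosedImmersion ((degeneracyIdeal φ n).subschemeι ∣_ U)), fun z ↦ ?_⟩
  obtain ⟨W, a, g, hz, haff, hD⟩ := h.exists_isAdaptedChart hU _ (h.rankAt_lt z)
  have hV : IsAffineOpen (U.ι ''ᵁ W) := haff.image_of_isOpenImmersion U.ι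
  have hzV : U.ι (determinantalι φ n U z) ∈ U.ι ''ᵁ W := ⟨_, hz, rfl⟩
  have hne : Nonempty (U.ι ''ᵁ W) := ⟨⟨_, hzV⟩⟩
  have := h.noetherian
  have : IsNoetherianRing Γ(Y, U.ι ''ᵁ W) := IsLocallyNoetherian.component_noetherian ⟨_, hV⟩
  have := h.normal _ hV hne
  obtain ⟨o, f, q, d, hA, -, -⟩ := hD
  let a₀ : Γ(Y, U.ι ''ᵁ W) := (a 0).1
  let a₁ : Γ(Y, U.ι ''ᵁ W) := (a 1).1
  have hspan : minorIdeal φ n (U.ι ''ᵁ W) = Ideal.span {a₀, a₁} := hA.minorIdeal_eq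
  have hreg : RingTheory.Sequence.IsRegular Γ(Y, U.ι ''ᵁ W) [a₀, a₁] := by
    refine isRegular_pair_of_two_le_height (fun P hP hle ↦ ?_) fun htop ↦ ?_
    · exact h.two_le_height hV hA.frame_source hA.frame_target P hP (hspan.trans_le hle)
    · have h1 : (1 : Γ(Y, U.ι ''ᵁ W)) ∈ minorIdeal φ n (U.ι ''ᵁ W) := by
        rw [hspan]
        exact (Ideal.eq_top_iff_one _).mp htop
      refine (rankAt_lt_iff hA.frame_source hA.frame_target hzV).mp (h.rankAt_lt z) 1 h1 ?_
      rwa [Scheme.basicOpen_of_isUnit _ isUnit_one]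
  refine ⟨⟨W, haff⟩, hz, [a₀, a₁], rfl, hreg, ?_⟩
  refine Ideal.ext fun c ↦ (h.app_eq_zero_iff_affine haff c).trans ?_
  rw [hspan, Ideal.ofList_cons, Ideal.ofList_singleton, ← Ideal.span_insert]
  exact Iff.rfl

/-- The cokernel on `U` is the direct image of its restriction to the determinantal subscheme. -/
lemma IsNormalLagrangian.isIso_unit (h : IsNormalLagrangian n ω φ)
    (hU : ∀ y ∈ U, n ≤ rankAt φ y + 1) :
    IsIso ((Scheme.Modules.pullbackPushforwardAdjunction (determinantalι φ n U)).unit.app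
      ((cokernelSheaf ω φ).restrict U.ι)) := by
  refine isIso_unit_of_isPrincipal (fun x ↦ ?_) fun V t x hx ↦
    exists_determinantalι_app_eq_res φ n V t x hx
  by_cases hx : rankAt φ (U.ι x) < n
  · obtain ⟨W, a, g, hxW, -, hD⟩ := h.exists_isAdaptedChart hU x hx
    exact ⟨W, g, hxW, hD.isPrincipal h⟩
  · obtain ⟨W, hxW, hW⟩ := h.exists_isPrincipal_zero x hx
    exact ⟨W, 0, hxW, hW⟩

lemma IsNormalLagrangian.range_eq_corankOneLocus (h : IsNormalLagrangian n ω φ)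
    (hU : (U : Set Y) = {y | n ≤ rankAt φ y + 1}) :
    Set.range (determinantalι φ n U ≫ U.ι) = corankOneLocus φ n := by
  rw [h.range_determinantalι, hU]
  ext y
  change rankAt φ y < n ∧ n ≤ rankAt φ y + 1 ↔ rankAt φ y + 1 = n
  omega

end CorankOne

section AtlasBundles

variable {Z X : Scheme.{0}} {i : Z ⟶ X} {M : X.Modules}
  {D : ∀ W : X.Opens, (Fin 2 → RingHom.ker (i.app W).hom) → Γ(M, W) → Prop}

lemma IsAtlas.isVectorBundle_pullback (h : IsAtlas i M D) :
    IsVectorBundle ((Scheme.Modules.pullback i).obj M) 1 := by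
  refine isVectorBundle_of_exists_frame fun z ↦ ?_
  obtain ⟨W, a, g, hz, hD⟩ := h.cover z
  exact ⟨i ⁻¹ᵁ W, hz, _, (h.principal W a g hD).isFrame_pull.reindex (Equiv.ofUnique (Fin 1) Unit)⟩

lemma IsAtlas.isVectorBundle_homSheaf (h : IsAtlas i M D) :
    IsVectorBundle (homSheaf (dual (conormalSheaf i)) ((Scheme.Modules.pullback i).obj M)) 2 := by
  refine isVectorBundle_of_exists_frame fun z ↦ ?_
  obtain ⟨W, a, g, hz, hD⟩ := h.cover z
  obtain ⟨-, -, -, he⟩ := (h.equation W a g hD).exists_frames (h.principal W a g hD)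
  exact ⟨i ⁻¹ᵁ W, hz, _, he⟩

end AtlasBundles

lemma isNormalLagrangian_of_smooth {k : Type} [Field k] {Y : Scheme.{0}} (f : Y ⟶ Spec (.of k))
    [IsIntegral Y] [Smooth f] {n : ℕ} {F E : Y.Modules} (hF : IsVectorBundle F n)
    (hE : IsVectorBundle E (2 * n)) {ω : E ⟶ dual E} (hω : IsSymplecticForm ω) {φ : F ⟶ E}
    (hφ : IsLagrangian n ω φ) (hcodim : 2 ≤ codim (degeneracyLocus φ n)) :
    IsNormalLagrangian n ω φ where
  frames_source := hF.exists_frame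
  frames_target := hE.exists_frame
  symplectic := hω
  lagrangian := hφ
  noetherian := LocallyOfFiniteType.isLocallyNoetherian f
  normal _ hV _ := isIntegrallyClosed_of_isAffineOpen f hV
  two_le_codim := hcodim

end LagrangianMorphism

end

theorem mainTheorem4 (Y : Scheme.{0}) (f : Y ⟶ Spec (.of ℂ)) [IsIntegral Y] [IsSeparated f]
    [LocallyOfFiniteType f] [QuasiCompact f] [Smooth f] (n : ℕ) (F E : Y.Modules)
    (hF : IsVectorBundle F n) (hE : IsVectorBundle E (2 * n))
    (ω : E ⟶ dual E) (hω : IsSymplecticForm ω) (φ : F ⟶ E) (hφ : IsLagrangian n ω φ)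
    (hcodim : 2 ≤ codim (degeneracyLocus φ n)) :
    ∃ U : Y.Opens, (U : Set Y) = {y | n ≤ rankAt φ y + 1} ∧
      (∀ V : Y.affineOpens, (degeneracyIdeal φ n).ideal V = minorIdeal φ n V.1) ∧
      Set.range (determinantalι φ n U ≫ U.ι) = corankOneLocus φ n ∧
      HasPureCodim (corankOneLocus φ n) 2 ∧
      IsLocalCompleteIntersection (determinantalι φ n U) 2 ∧
      ∃ (G : Y.Modules) (p : dual F ⟶ G) (L E₂ : (determinantalScheme φ n U).Modules)
        (h₁ : φ ≫ transpose ω φ = 0) (h₂ : transpose ω φ ≫ p = 0),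
        Mono φ ∧ (ShortComplex.mk φ (transpose ω φ) h₁).Exact ∧
        (ShortComplex.mk (transpose ω φ) p h₂).Exact ∧ Epi p ∧
        IsTorsionSheaf G ∧ IsSupportedOn G (degeneracyLocus φ n) ∧
        IsVectorBundle L 1 ∧
        Nonempty (G.restrict U.ι ≅ (Scheme.Modules.pushforward (determinantalι φ n U)).obj L) ∧
        IsVectorBundle E₂ 2 ∧ HasTrivialDet E₂ 2 ∧
        Nonempty (normalSheaf (determinantalι φ n U) ≅ homSheaf E₂ L) := by
  have h := isNormalLagrangian_of_smooth f hF hE hω hφ hcodim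
  let U : Y.Opens := ⟨{y | n ≤ rankAt φ y + 1}, h.isOpen_rank⟩
  have hU : ∀ y ∈ U, n ≤ rankAt φ y + 1 := fun _ hy ↦ hy
  have hD := h.isAtlas hU
  have := h.isIso_unit hU
  let N := dual (conormalSheaf (determinantalι φ n U))
  let L := (Scheme.Modules.pullback (determinantalι φ n U)).obj ((cokernelSheaf ω φ).restrict U.ι)
  have : IsIso (evaluationHom N L) := hD.isIso_evaluationHom
  let e : N ≅ homSheaf (homSheaf N L) L := asIso (evaluationHom N L)
  refine ⟨U, rfl, degeneracyIdeal_ideal h.frames_source h.frames_target φ,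
    h.range_eq_corankOneLocus rfl, h.hasPureCodim, h.isLocalCompleteIntersection hU,
    cokernelSheaf ω φ, cokernelProj ω φ, L, homSheaf N L, h.comp_transpose,
    transpose_comp_cokernelProj ω φ, mono_of_injective_app φ h.injective_app, h.exact_left,
    exact_cokernelProj ω φ, inferInstance, h.isTorsionSheaf, h.isSupportedOn,
    hD.isVectorBundle_pullback, ⟨asIso ((Scheme.Modules.pullbackPushforwardAdjunction
      (determinantalι φ n U)).unit.app ((cokernelSheaf ω φ).restrict U.ι))⟩,
    hD.isVectorBundle_homSheaf, hD.hasTrivialDet, ⟨e⟩⟩
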